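/- **Setting.** Fix $T>0$. For integers $\ell\ge 1$, let $H^\ell=H^\ell(\mathbb R/T\mathbb Z,\mathbb R^m)$ be the space of $T$-periodic functions $f$ (identified with their continuous representatives) whose Fourier coefficients satisfy $|f|_{H^\ell}^2:=\sum_{k\in\mathbb Z}(1+k^2)^\ell|f^{(k)}|^2<\infty$. For a set $\Omega$ containing the origin of a finite-dimensional normed space, $V\in\mathcal A(\Omega,H^\ell)$ with constants $c,\rho>0$ means that there are symmetric $q$-linear maps $V_q(t)$, $q\ge0$, with $V(u,t)=\sum_{q\ge 0}V_q(t)[u,\dots,u]$ for $u\in\Omega$ and all $t$, and $|V_q(\cdot)[u_1,\dots,u_q]|_{H^\ell}\le \frac{c}{\rho^q}|u_1|\cdots|u_q|$ for all $u_1,\dots,u_q$. A map is called analytic on $\Omega$ below if it is in $\mathcal A(\Omega,H^\ell)$ for some constants $c,\rho$. $\mathcal P_p(E_0,H^{\ell+1}(\mathbb R/T\mathbb Z,E_1))$ is the space of polynomials $\sum_{|\alpha|\le p}P_\alpha(t)x^\alpha$, where $x$ are linear coordinates on $E_0$ and $P_\alpha\in H^{\ell+1}$ takes values in $E_1$. **Theorem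 2.1.** Let $\mathbb R^m=E_0\oplus E_1$ with $m_0=\dim E_0$, $m_1=\dim E_1$, and let $L=L_0\oplus L_1$ with $L_i$ a linear operator on $E_i$. Assume that $L_0$ is diagonalizable over $\mathbb C$, with eigenvalues $\lambda^{(0)}_1,\dots,\lambda^{(0)}_{m_0}$, and let $\lambda^{(1)}_1,\dots,\lambda^{(1)}_{m_1}$ be the eigenvalues of $L_1$ and $\nu$ the maximal size of the Jordan blocks of $L_1$ (over $\mathbb C$). Let $\ell\ge1$ be an integer and $\tau>0$ with $\tau\nu\le\ell$, and assume that for some $\gamma>0$ $$\Big|\langle a,\lambda^{(0)}\rangle+ik\tfrac{2\pi}{T}-\lambda^{(1)}_j\Big|\ \ge\ \frac{\gamma}{(|a|+|k|)^\tau}\qquad\text{for all } a\in\mathbb N^{m_0},\ k\in\mathbb Z,\ (a,k)\ne(0,0),\ 1\le j\le m_1 .$$ Let $c,\rho>0$ and put $b=\frac1{\ell+\tau\nu+1}$. Then there are positive constants $M,M_0,\omega,K$, depending only on the data introduced so far, such that for every neighborhood $\Omega$ of the origin in $\mathbb R^m$ there is $\delta_0>0$ with the following property. Let $V=V_0+V_1$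 (with $V_i$ valued in $E_i$) belong to $\mathcal A(\Omega,H^\ell(\mathbb R/T\mathbb Z,\mathbb R^m))$ with constants $c,\rho$, and let $V(0,\cdot)=0$, $D_uV(0,\cdot)=0$. Then for every $\delta\in\,]0,\delta_0[$ there are an integer $p_\delta\ge 0$ with $p_\delta\le K\delta^{-b}$ and $\Phi_\delta\in\mathcal P_{p_\delta}(E_0,H^{\ell+1}(\mathbb R/T\mathbb Z,E_1))$ with $\Phi_\delta(0,\cdot)=0$, $D_{u_0}\Phi_\delta(0,\cdot)=0$, such that the change of variables $u_1=v_1+\Phi_\delta(u_0,t)$ transforms, over the region $|u_0|\le\delta$, $|v_1|\le\delta_0$, the system $$\frac{du_0}{dt}=L_0u_0+V_0(u_0+u_1,t),\qquad \frac{du_1}{dt}=L_1u_1+V_1(u_0+u_1,t)$$ into $$\frac{du_0}{dt}=L_0u_0+V^0(u_0,v_1,t),\qquad \frac{dv_1}{dt}=L_1v_1+V^1(u_0,v_1,t)+R(u_0,t),$$ where $V^0$ and $V^1$ are analytic on $\{|u_0|\le\delta,\ |v_1|\le\delta_0\}$, $R$ is analytic on $\{|u_0|\le\delta\}$, these maps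 have values in $E_0$, $E_1$, $E_1$ respectively, $$|V^1(u_0,v_1,\cdot)|_{H^\ell}\le M_0|v_1|\,(|u_0|+|v_1|)\quad\text{for }|u_0|\le\delta,\ |v_1|\le\delta_0,\qquad \sup_{|u_0|\le\delta}|R(u_0,\cdot)|_{H^\ell}\le M e^{-\omega/\delta^b},$$ and $V^0(u_0,v_1,t)=V_0(u_0+v_1+\Phi_\delta(u_0,t),t)$. -/

import Mathlib

open Module Topology
open scoped TensorProduct

/-! Periodic functions of Sobolev class. A `T`-periodic function of time is a function on the circle
`AddCircle T = ℝ / Tℤ`. -/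

/-- `|f^{(k)}|²`, the squared norm of the `k`-th Fourier coefficient (a vector of `ℂᵐ`) of a
`T`-periodic function with values in `ℝᵐ`. -/
noncomputable def fourierNormSq {T : ℝ} [Fact (0 < T)] {m : ℕ}
    (f : AddCircle T → EuclideanSpace ℝ (Fin m)) (k : ℤ) : ℝ :=
  ∑ i : Fin m, ‖fourierCoeff (fun x : AddCircle T => ((f x i : ℝ) : ℂ)) k‖ ^ 2

/-- `f ∈ H^ℓ(ℝ/Tℤ, ℝᵐ)`, for `ℓ ≥ 1`: the series `∑ (1 + k²)^ℓ |f^{(k)}|²` converges. As usual, an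
element of `H^ℓ` with `ℓ ≥ 1` is identified with its continuous representative. -/
def MemSobolev {T : ℝ} [Fact (0 < T)] {m : ℕ} (l : ℕ)
    (f : AddCircle T → EuclideanSpace ℝ (Fin m)) : Prop :=
  Continuous f ∧ Summable fun k : ℤ => (1 + (k : ℝ) ^ 2) ^ l * fourierNormSq f k

/-- The norm of `H^ℓ(ℝ/Tℤ, ℝᵐ)` (meaningful together with `MemSobolev`). -/
noncomputable def sobolevNorm {T : ℝ} [Fact (0 < T)] {m : ℕ} (l : ℕ)
    (f : AddCircle T → EuclideanSpace ℝ (Fin m)) : ℝ :=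
  √(∑' k : ℤ, (1 + (k : ℝ) ^ 2) ^ l * fourierNormSq f k)

/-- `V ∈ 𝒜(S, H^ℓ(ℝ/Tℤ, ℝᵐ))` with constants `c`, `ρ`: on `S`, `V(u,t) = ∑_q A_q(t)[u,…,u]` with
symmetric `q`-linear maps `A_q(t)` such that
`|A_q(·)[u₁,…,u_q]|_{H^ℓ} ≤ (c / ρ^q) |u₁| ⋯ |u_q|`. -/
def IsAnalyticWith {T : ℝ} [Fact (0 < T)] {m : ℕ} {F : Type*} [NormedAddCommGroup F]
    [NormedSpace ℝ F] (l : ℕ) (c ρ : ℝ) (S : Set F)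
    (V : F → AddCircle T → EuclideanSpace ℝ (Fin m)) : Prop :=
  ∃ A : (q : ℕ) → AddCircle T →
      MultilinearMap ℝ (fun _ : Fin q => F) (EuclideanSpace ℝ (Fin m)),
    (∀ q t (σ : Equiv.Perm (Fin q)) (x : Fin q → F), A q t (x ∘ σ) = A q t x) ∧
    (∀ q (x : Fin q → F), MemSobolev l (fun t => A q t x) ∧
      sobolevNorm l (fun t => A q t x) ≤ c / ρ ^ q * ∏ i, ‖x i‖) ∧
    ∀ u ∈ S, ∀ t, HasSum (fun q => A q t (fun _ => u)) (V u t)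

/-- `V ∈ 𝒜(S, H^ℓ(ℝ/Tℤ, ℝᵐ))`. -/
def IsAnalyticSobolev {T : ℝ} [Fact (0 < T)] {m : ℕ} {F : Type*} [NormedAddCommGroup F]
    [NormedSpace ℝ F] (l : ℕ) (S : Set F)
    (V : F → AddCircle T → EuclideanSpace ℝ (Fin m)) : Prop :=
  ∃ c > 0, ∃ ρ > 0, IsAnalyticWith l c ρ S V

/-- `P ∈ 𝒫_p(E₀, H^l(ℝ/Tℤ, E₁))`: `P(u,t) = ∑_{|α| ≤ p} P_α(t) x^α`, where `x` are the coordinates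
of `u` in a basis of `E₀` (the notion does not depend on the basis) and `P_α ∈ H^l(ℝ/Tℤ, E₁)`. -/
def IsSobolevPolynomial {T : ℝ} [Fact (0 < T)] {m : ℕ}
    {E₀ E₁ : Submodule ℝ (EuclideanSpace ℝ (Fin m))} (l p : ℕ)
    (P : E₀ → AddCircle T → E₁) : Prop :=
  ∃ C : (Fin (finrank ℝ E₀) → ℕ) → AddCircle T → E₁,
    (∀ α, MemSobolev l (fun t => (C α t : EuclideanSpace ℝ (Fin m)))) ∧
    ∀ u t, P u t = ∑ n ∈ Finset.range (p + 1), ∑ α ∈ Finset.piAntidiag Finset.univ n,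
      (∏ i, (finBasis ℝ E₀).repr u i ^ α i) • C α t

/-! Linear algebra. Spectral notions of a real operator are those of its complexification. -/

/-- The real operator `f` is diagonalizable over `ℂ`, with eigenvalues (repeated according to
multiplicity) `lam j`. -/
def IsDiagonalizedBy {W : Type*} [AddCommGroup W] [Module ℝ W] (f : W →ₗ[ℝ] W)
    (lam : Fin (finrank ℝ W) → ℂ) : Prop :=
  ∃ v : Basis (Fin (finrank ℝ W)) ℂ (ℂ ⊗[ℝ] W), ∀ j, f.baseChange ℂ (v j) = lam j • v j

/-- The maximal size of the Jordan blocks of the real operator `f` (over `ℂ`), that is, the maximal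
length `k + 1` of a Jordan chain `x, (f - μ) x, …, (f - μ)^k x` (`0` for a zero space). -/
noncomputable def maxJordanBlockSize {W : Type*} [AddCommGroup W] [Module ℝ W]
    (f : W →ₗ[ℝ] W) : ℕ :=
  sSup {n : ℕ | ∃ (μ : ℂ) (x : ℂ ⊗[ℝ] W) (k : ℕ), n = k + 1 ∧
    ((f.baseChange ℂ - algebraMap ℂ (End ℂ (ℂ ⊗[ℝ] W)) μ) ^ k) x ≠ 0 ∧
    ((f.baseChange ℂ - algebraMap ℂ (End ℂ (ℂ ⊗[ℝ] W)) μ) ^ (k + 1)) x = 0}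

/-- The non-resonance condition: for some `γ > 0`,
`|⟨a, λ⟩ + 2πik/T - μ| ≥ γ / (|a| + |k|)^τ` for all `a ∈ ℕ^{m₀}`, `k ∈ ℤ` not both zero and all
eigenvalues `μ` of `f`. -/
def NonResonant (T : ℝ) {n : ℕ} (lam : Fin n → ℂ) {W : Type*} [AddCommGroup W] [Module ℝ W]
    (f : W →ₗ[ℝ] W) (τ : ℝ) : Prop :=
  ∃ γ : ℝ, 0 < γ ∧ ∀ (a : Fin n → ℕ) (k : ℤ) (μ : ℂ), (a ≠ 0 ∨ k ≠ 0) →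
    End.HasEigenvalue (f.baseChange ℂ) μ →
    γ / ((∑ j, (a j : ℝ)) + |(k : ℝ)|) ^ τ ≤
      ‖(∑ j, (a j : ℂ) * lam j) + Complex.I * k * (2 * Real.pi / T) - μ‖

/-! Differential systems on `E₀ ⊕ E₁`. -/

/-- At time `t`, the curves `u₀`, `u₁` satisfy `du₀/dt = X₀(u₀,u₁,t)`, `du₁/dt = X₁(u₀,u₁,t)`, where
`X₀`, `X₁` are `T`-periodic in time. -/
def SolvesAt {T : ℝ} {G₀ G₁ : Type*} [NormedAddCommGroup G₀] [NormedSpace ℝ G₀]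
    [NormedAddCommGroup G₁] [NormedSpace ℝ G₁] (X₀ : G₀ → G₁ → AddCircle T → G₀)
    (X₁ : G₀ → G₁ → AddCircle T → G₁) (u₀ : ℝ → G₀) (u₁ : ℝ → G₁) (t : ℝ) : Prop :=
  HasDerivAt u₀ (X₀ (u₀ t) (u₁ t) (t : AddCircle T)) t ∧
  HasDerivAt u₁ (X₁ (u₀ t) (u₁ t) (t : AddCircle T)) t

/-- The change of variables `u₁ = v₁ + Φ(u₀,t)` transforms the system `(X₀, X₁)` in `(u₀,u₁)` into
the system `(Y₀, Y₁)` in `(u₀,v₁)`, over the region `S` of the `(u₀,v₁)`-space: at each time at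
which it passes through `S`, a curve `(u₀,v₁)` satisfies the new system if and only if `(u₀,u₁)`
satisfies the old one. -/
def TransformsOn {T : ℝ} {G₀ G₁ : Type*} [NormedAddCommGroup G₀] [NormedSpace ℝ G₀]
    [NormedAddCommGroup G₁] [NormedSpace ℝ G₁] (S : Set (G₀ × G₁)) (Φ : G₀ → AddCircle T → G₁)
    (X₀ : G₀ → G₁ → AddCircle T → G₀) (X₁ : G₀ → G₁ → AddCircle T → G₁)
    (Y₀ : G₀ → G₁ → AddCircle T → G₀) (Y₁ : G₀ → G₁ → AddCircle T → G₁) : Prop :=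
  ∀ (u₀ : ℝ → G₀) (v₁ : ℝ → G₁) (t : ℝ), (u₀ t, v₁ t) ∈ S →
    (SolvesAt X₀ X₁ u₀ (fun s => v₁ s + Φ (u₀ s) (s : AddCircle T)) t ↔ SolvesAt Y₀ Y₁ u₀ v₁ t)

/-!
The change of variables `u₁ = v₁ + Φ(u₀, t)` removes the terms of the second equation that depend on
`u₀` alone if `Φ` solves the nonlinear homological equation
`∂_t Φ + DΦ · (L₀ u₀ + V₀(u₀ + Φ, t)) = L₁ Φ + V₁(u₀ + Φ, t)`. Such a `Φ` does not exist in general: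
the divisors of the linear part `∂_t + D·L₀ - L₁` are not bounded below, and `DΦ` loses a derivative.
Both defects are controlled on polynomials of a fixed degree `p`, and there the whole equation, cut off
at degree `p`, is solved at once by a contraction; no recursion over the degree is needed.

The contraction takes place in the Banach algebra `PowAlg ι (SobAlg T l)` of power series whose
coefficients form a summable family in `H^l(ℝ/Tℤ)`, where `SobAlg T l` is `H^l` with a multiple of its
norm that is submultiplicative. The variables are the eigencoordinates of `L₀` together with their
complex conjugates (`exists_adaptedFrame`), divided by a radius `r`, and the coordinates of `E₁`.
Doubling the eigencoordinates makes real functions recognizable as the power series invariant under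
the conjugation `PowAlg.conj`, and does not alter the non-resonance condition, since the spectrum of
`L₀` is invariant under conjugation (`NonResonant.freq_bound`). In these variables the homological
operator acts on the mode `X^α e^{2πikt/T}` as the matrix `freq T Λ α k - L₁`. Its inverse is the
resolvent of `L₁`, bounded by `C p^{τν}` for `1 ≤ |α| ≤ p`, where `ν` is the maximal size of the Jordan
blocks, and it gains one derivative in time (`resolventMatrix_freq_bound`). Differentiation costs a
factor `p / r` and the nonlinearity has size `r²`, so that the equation is a contraction of the ball of
radius `r` as soon as `p^{τν} p r` is small (`Frame.exists_fixedPoint`). The choice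
`r = c₀ p^{-(l + τν + 1)}` is more than sufficient (`exists_isNormalizer`).

The error is the part of degree greater than `p` of the vector field along `Φ`, whose norm is bounded
by a constant. At points whose scaled coordinates are at most `1/e` its value is therefore
`O(e^{-(p+1)})` (`IsNormalizer.norm_ev_remainder_le`). The ball `|u₀| ≤ δ` consists of such points
for `p = ⌊K δ^{-b}⌋` (`exists_degree`), which turns `e^{-p}` into `e^{-ω / δ^b}`.

That the change of variables conjugates the two systems is the identity
`IsNormalizer.key_identity`, inserted into the chain rule along solutions
(`IsNormalizer.hasDerivAt_value`, `IsNormalizer.transformsOn`). The bound for the new nonlinearity of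
the second equation, linear in `v₁`, is proved at each point in the algebra `H^l`
(`IsNormalizer.norm_ev_field_increment_le`). Finally, `PowAlg.isAnalyticSobolev` and
`isSobolevPolynomial_of_ev` translate power series in complex linear forms into analytic maps and into
polynomials in real coordinates.
-/

/-! ### Weighted sequences and convolution -/

section SobolevWeight

/-- The weight `(1 + k²)^{l/2}` of the `k`-th Fourier mode. -/
noncomputable def sobWeight (l : ℕ) (k : ℤ) : ℝ := √((1 + (k : ℝ) ^ 2) ^ l)

lemma sobWeight_sq (l : ℕ) (k : ℤ) : sobWeight l k ^ 2 = (1 + (k : ℝ) ^ 2) ^ l :=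
  Real.sq_sqrt (by positivity)

lemma one_le_sobWeight (l : ℕ) (k : ℤ) : 1 ≤ sobWeight l k := by
  rw [sobWeight, Real.one_le_sqrt]
  exact one_le_pow₀ (by nlinarith [sq_nonneg (k : ℝ)])

lemma sobWeight_pos (l : ℕ) (k : ℤ) : 0 < sobWeight l k :=
  lt_of_lt_of_le one_pos (one_le_sobWeight l k)

lemma sobWeight_neg (l : ℕ) (k : ℤ) : sobWeight l (-k) = sobWeight l k := by
  simp [sobWeight]

lemma summable_inv_sobWeight_sq {l : ℕ} (hl : 1 ≤ l) :
    Summable fun k : ℤ => (sobWeight l k ^ 2)⁻¹ := by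
  have h := (Real.summable_one_div_int_pow (p := 2)).2 one_lt_two
  refine Summable.of_norm_bounded_eventually (g := fun n : ℤ => 1 / (n : ℝ) ^ 2) h ?_
  rw [Filter.eventually_cofinite]
  refine (Set.finite_singleton (0 : ℤ)).subset fun k hk => ?_
  by_contra h0
  apply hk
  have hk0 : (0 : ℝ) < (k : ℝ) ^ 2 := by
    have : (k : ℝ) ≠ 0 := by exact_mod_cast h0
    positivity
  have h1 : (k : ℝ) ^ 2 ≤ sobWeight l k ^ 2 := by
    rw [sobWeight_sq]
    calc (k : ℝ) ^ 2 ≤ 1 + (k : ℝ) ^ 2 := by linarith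
      _ ≤ (1 + (k : ℝ) ^ 2) ^ l := le_self_pow₀ (by linarith) (by omega)
  rw [Real.norm_of_nonneg (by positivity), one_div]
  exact inv_anti₀ hk0 h1

/-- Multiplying the norm of `H^l` by this constant makes it submultiplicative. -/
noncomputable def sobConst (l : ℕ) : ℝ := 1 + √(2 * 4 ^ l * ∑' k : ℤ, (sobWeight l k ^ 2)⁻¹)

lemma one_le_sobConst (l : ℕ) : 1 ≤ sobConst l := by
  have := Real.sqrt_nonneg (2 * 4 ^ l * ∑' k : ℤ, (sobWeight l k ^ 2)⁻¹)
  rw [sobConst]; linarith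

lemma sobConst_pos (l : ℕ) : 0 < sobConst l := lt_of_lt_of_le one_pos (one_le_sobConst l)

lemma le_sobConst_sq (l : ℕ) :
    2 * 4 ^ l * ∑' k : ℤ, (sobWeight l k ^ 2)⁻¹ ≤ sobConst l ^ 2 := by
  have h0 : 0 ≤ ∑' k : ℤ, (sobWeight l k ^ 2)⁻¹ := tsum_nonneg fun _ => by positivity
  have h1 : 0 ≤ 2 * 4 ^ l * ∑' k : ℤ, (sobWeight l k ^ 2)⁻¹ := by positivity
  have := Real.sqrt_nonneg (2 * 4 ^ l * ∑' k : ℤ, (sobWeight l k ^ 2)⁻¹)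
  have h2 := Real.sq_sqrt h1
  rw [sobConst]; nlinarith

lemma sobWeight_add_sq_le (l : ℕ) (j k : ℤ) :
    sobWeight l (j + k) ^ 2 ≤ 4 ^ l * (sobWeight l j ^ 2 + sobWeight l k ^ 2) := by
  simp only [sobWeight_sq]
  wlog h : (k : ℝ) ^ 2 ≤ (j : ℝ) ^ 2 generalizing j k
  · rw [add_comm j k, add_comm (_ ^ l) _]
    exact this k j (le_of_lt (not_le.1 h))
  have h1 : (1 + ((j + k : ℤ) : ℝ) ^ 2) ≤ 4 * (1 + (j : ℝ) ^ 2) := by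
    push_cast; nlinarith [sq_nonneg ((j : ℝ) - k)]
  calc (1 + ((j + k : ℤ) : ℝ) ^ 2) ^ l ≤ (4 * (1 + (j : ℝ) ^ 2)) ^ l :=
        pow_le_pow_left₀ (by positivity) h1 l
    _ = 4 ^ l * (1 + (j : ℝ) ^ 2) ^ l := mul_pow _ _ _
    _ ≤ _ := by gcongr; linarith [show 0 ≤ (1 + (k : ℝ) ^ 2) ^ l by positivity]

/-- Cauchy–Schwarz for series. -/
lemma tsum_mul_sq_le {ι : Type*} {a b : ι → ℝ} (ha : ∀ i, 0 ≤ a i) (hb : ∀ i, 0 ≤ b i)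
    (hsa : Summable fun i => a i ^ 2) (hsb : Summable fun i => b i ^ 2) :
    Summable (fun i => a i * b i) ∧
      (∑' i, a i * b i) ^ 2 ≤ (∑' i, a i ^ 2) * ∑' i, b i ^ 2 := by
  have h := Real.inner_le_Lp_mul_Lq_tsum_of_nonneg Real.HolderConjugate.two_two ha hb
    (by simpa using hsa) (by simpa using hsb)
  refine ⟨Real.summable_mul_of_Lp_Lq_of_nonneg Real.HolderConjugate.two_two ha hb
    (by simpa using hsa) (by simpa using hsb), ?_⟩
  have h2 := h
  simp only [Real.rpow_two, ← Real.sqrt_eq_rpow] at h2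
  have h0 : 0 ≤ ∑' i, a i * b i := tsum_nonneg fun i => mul_nonneg (ha i) (hb i)
  have hA : 0 ≤ ∑' i, a i ^ 2 := tsum_nonneg fun i => by positivity
  have hB : 0 ≤ ∑' i, b i ^ 2 := tsum_nonneg fun i => by positivity
  calc (∑' i, a i * b i) ^ 2 ≤ (√(∑' i, a i ^ 2) * √(∑' i, b i ^ 2)) ^ 2 :=
        pow_le_pow_left₀ h0 h2 2
    _ = _ := by rw [mul_pow, Real.sq_sqrt hA, Real.sq_sqrt hB]

/-- A sequence in weighted `ℓ²` is summable. -/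
lemma summable_of_sobWeight {l : ℕ} (hl : 1 ≤ l) {f : ℤ → ℂ}
    (hf : Summable fun k => sobWeight l k ^ 2 * ‖f k‖ ^ 2) :
    Summable (fun k => ‖f k‖) ∧ (∑' k, ‖f k‖) ^ 2 ≤
      (∑' k : ℤ, (sobWeight l k ^ 2)⁻¹) * ∑' k, sobWeight l k ^ 2 * ‖f k‖ ^ 2 := by
  have h := tsum_mul_sq_le (a := fun k : ℤ => (sobWeight l k)⁻¹)
    (b := fun k => sobWeight l k * ‖f k‖) (fun k => (inv_pos.2 (sobWeight_pos l k)).le)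
    (fun k => mul_nonneg (sobWeight_pos l k).le (norm_nonneg _))
    (by simpa [inv_pow] using summable_inv_sobWeight_sq hl) (by simpa [mul_pow] using hf)
  have e : ∀ k, (sobWeight l k)⁻¹ * (sobWeight l k * ‖f k‖) = ‖f k‖ := fun k => by
    have := (sobWeight_pos l k).ne'
    field_simp
  simpa only [e, inv_pow, mul_pow] using h

/-- The algebra property of `H^l`, `l ≥ 1`, on the level of Fourier coefficients. -/
lemma sobolev_convolution {l : ℕ} (hl : 1 ≤ l) {f g : ℤ → ℂ}
    (hf : Summable fun k => sobWeight l k ^ 2 * ‖f k‖ ^ 2)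
    (hg : Summable fun k => sobWeight l k ^ 2 * ‖g k‖ ^ 2) :
    Summable (fun n => sobWeight l n ^ 2 * ‖∑' k, f k * g (n - k)‖ ^ 2) ∧
      ∑' n, sobWeight l n ^ 2 * ‖∑' k, f k * g (n - k)‖ ^ 2 ≤
        sobConst l ^ 2 * ((∑' k, sobWeight l k ^ 2 * ‖f k‖ ^ 2) *
          ∑' k, sobWeight l k ^ 2 * ‖g k‖ ^ 2) := by
  set F : ℤ → ℝ := fun k => sobWeight l k ^ 2 * ‖f k‖ ^ 2 with hF
  set G : ℤ → ℝ := fun k => sobWeight l k ^ 2 * ‖g k‖ ^ 2 with hG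
  have hF0 : ∀ k, 0 ≤ F k := fun k => by positivity
  have hG0 : ∀ k, 0 ≤ G k := fun k => by positivity
  have hFG : HasSum (fun p : ℤ × ℤ => F p.1 * G p.2) ((∑' k, F k) * ∑' k, G k) :=
    hf.hasSum.mul hg.hasSum (hf.mul_of_nonneg hg hF0 hG0)
  -- The double series indexed by `(n, k)` is the product series indexed by `(k, n - k)`.
  let e : ℤ × ℤ ≃ ℤ × ℤ :=
    { toFun := fun p => (p.2, p.1 - p.2)
      invFun := fun p => (p.1 + p.2, p.1)
      left_inv := fun p => by simp
      right_inv := fun p => by simp }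
  have hFG' : HasSum (fun p : ℤ × ℤ => F p.2 * G (p.1 - p.2)) ((∑' k, F k) * ∑' k, G k) :=
    (e.hasSum_iff (f := fun p : ℤ × ℤ => F p.1 * G p.2)).2 hFG
  have hfib : ∀ n, Summable fun k => F k * G (n - k) := fun n =>
    hFG'.summable.prod_factor n
  have hout : HasSum (fun n => ∑' k, F k * G (n - k)) ((∑' k, F k) * ∑' k, G k) :=
    hFG'.prod_fiberwise fun n => (hfib n).hasSum
  have hw := summable_inv_sobWeight_sq hl
  have key : ∀ n, sobWeight l n ^ 2 * ‖∑' k, f k * g (n - k)‖ ^ 2 ≤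
      sobConst l ^ 2 * ∑' k, F k * G (n - k) := by
    intro n
    -- Cauchy–Schwarz against the reciprocal weights `a k`. As `w_n² ≲ w_k² + w_{n-k}²`, the sum of
    -- `w_n² a_k²` over `k` is bounded uniformly in `n`.
    set a : ℤ → ℝ := fun k => (sobWeight l k * sobWeight l (n - k))⁻¹ with ha
    set b : ℤ → ℝ := fun k => sobWeight l k * ‖f k‖ * (sobWeight l (n - k) * ‖g (n - k)‖) with hb
    have hshift : Summable fun k : ℤ => (sobWeight l (n - k) ^ 2)⁻¹ :=
      ((Equiv.subLeft n).summable_iff (f := fun k : ℤ => (sobWeight l k ^ 2)⁻¹)).2 hw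
    have hshift' : ∑' k : ℤ, (sobWeight l (n - k) ^ 2)⁻¹ = ∑' k : ℤ, (sobWeight l k ^ 2)⁻¹ :=
      (Equiv.subLeft n).tsum_eq (fun k : ℤ => (sobWeight l k ^ 2)⁻¹)
    have hbound : ∀ k, sobWeight l n ^ 2 * a k ^ 2 ≤
        4 ^ l * ((sobWeight l (n - k) ^ 2)⁻¹ + (sobWeight l k ^ 2)⁻¹) := by
      intro k
      have h1 := sobWeight_add_sq_le l k (n - k)
      rw [add_sub_cancel] at h1
      have p1 := sobWeight_pos l k
      have p2 := sobWeight_pos l (n - k)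
      have : 4 ^ l * ((sobWeight l (n - k) ^ 2)⁻¹ + (sobWeight l k ^ 2)⁻¹) =
          4 ^ l * (sobWeight l k ^ 2 + sobWeight l (n - k) ^ 2) * a k ^ 2 := by
        rw [ha]; field_simp
      rw [this]
      gcongr
    have hsum4 : Summable fun k => (4 : ℝ) ^ l *
        ((sobWeight l (n - k) ^ 2)⁻¹ + (sobWeight l k ^ 2)⁻¹) := (hshift.add hw).mul_left _
    have hsa' : Summable fun k => sobWeight l n ^ 2 * a k ^ 2 :=
      Summable.of_nonneg_of_le (fun k => by positivity) hbound hsum4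
    have hn2 : sobWeight l n ^ 2 ≠ 0 := pow_ne_zero _ (sobWeight_pos l n).ne'
    have hsa : Summable fun k => a k ^ 2 := (summable_mul_left_iff hn2).1 hsa'
    have hA : sobWeight l n ^ 2 * ∑' k, a k ^ 2 ≤ sobConst l ^ 2 := by
      rw [← tsum_mul_left]
      refine (hsa'.tsum_le_tsum hbound hsum4).trans (le_trans (le_of_eq ?_) (le_sobConst_sq l))
      rw [tsum_mul_left, hshift.tsum_add hw, hshift']
      ring
    have hb2 : ∀ k, b k ^ 2 = F k * G (n - k) := fun k => by
      rw [hb, hF, hG]; ring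
    have hcs := tsum_mul_sq_le (a := a) (b := b)
      (fun k => (inv_pos.2 (mul_pos (sobWeight_pos l k) (sobWeight_pos l (n - k)))).le)
      (fun k => by
        have p1 := sobWeight_pos l k
        have p2 := sobWeight_pos l (n - k)
        positivity) hsa (by simpa only [hb2] using hfib n)
    have hab : ∀ k, a k * b k = ‖f k * g (n - k)‖ := fun k => by
      have p1 := (sobWeight_pos l k).ne'
      have p2 := (sobWeight_pos l (n - k)).ne'
      rw [ha, hb, norm_mul]
      field_simp
    simp only [hab, hb2] at hcs
    have hnorm : ‖∑' k, f k * g (n - k)‖ ≤ ∑' k, ‖f k * g (n - k)‖ := norm_tsum_le_tsum_norm hcs.1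
    have hB0 : 0 ≤ ∑' k, F k * G (n - k) := tsum_nonneg fun k => mul_nonneg (hF0 _) (hG0 _)
    calc sobWeight l n ^ 2 * ‖∑' k, f k * g (n - k)‖ ^ 2
        ≤ sobWeight l n ^ 2 * ((∑' k, a k ^ 2) * ∑' k, F k * G (n - k)) := by
          gcongr
          exact (pow_le_pow_left₀ (norm_nonneg _) hnorm 2).trans hcs.2
      _ = (sobWeight l n ^ 2 * ∑' k, a k ^ 2) * ∑' k, F k * G (n - k) := by ring
      _ ≤ _ := by gcongr
  have hs := Summable.of_nonneg_of_le (fun n => by positivity) key (hout.summable.mul_left _)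
  refine ⟨hs, (hs.tsum_le_tsum key (hout.summable.mul_left _)).trans (le_of_eq ?_)⟩
  rw [tsum_mul_left, hout.tsum_eq]

end SobolevWeight

/-! ### The Sobolev space of the circle as a Banach algebra -/

section SobolevAlgebra

/-- The complex Sobolev space `H^l` of the circle of length `T`, as a space of Fourier coefficients:
the sequence stored in `ℓ²` is the sequence of Fourier coefficients multiplied by the weights
`sobConst l * sobWeight l k`. -/
def SobAlg (_T : ℝ) (_l : ℕ) : Type := lp (fun _ : ℤ => ℂ) 2

namespace SobAlg

variable {T : ℝ} {l : ℕ}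

noncomputable instance : NormedAddCommGroup (SobAlg T l) :=
  inferInstanceAs (NormedAddCommGroup (lp (fun _ : ℤ => ℂ) 2))

noncomputable instance : NormedSpace ℂ (SobAlg T l) :=
  inferInstanceAs (NormedSpace ℂ (lp (fun _ : ℤ => ℂ) 2))

instance : CompleteSpace (SobAlg T l) :=
  inferInstanceAs (CompleteSpace (lp (fun _ : ℤ => ℂ) 2))

/-- The weighted sequence of Fourier coefficients. -/
def weighted (x : SobAlg T l) : lp (fun _ : ℤ => ℂ) 2 := x

/-- The Fourier coefficients of an element of `H^l`. -/
noncomputable def coef (x : SobAlg T l) (k : ℤ) : ℂ :=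
  x.weighted k / ((sobConst l * sobWeight l k : ℝ) : ℂ)

lemma weight_ne_zero (l : ℕ) (k : ℤ) : ((sobConst l * sobWeight l k : ℝ) : ℂ) ≠ 0 :=
  Complex.ofReal_ne_zero.2 (mul_pos (sobConst_pos l) (sobWeight_pos l k)).ne'

lemma coef_add (x y : SobAlg T l) (k : ℤ) : (x + y).coef k = x.coef k + y.coef k :=
  add_div _ _ _

lemma coef_smul (c : ℂ) (x : SobAlg T l) (k : ℤ) : (c • x).coef k = c * x.coef k :=
  mul_div_assoc _ _ _

lemma coef_zero (k : ℤ) : (0 : SobAlg T l).coef k = 0 :=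
  zero_div _

lemma norm_weight_mul_coef (x : SobAlg T l) (k : ℤ) :
    ‖x.weighted k‖ = sobConst l * sobWeight l k * ‖x.coef k‖ := by
  rw [coef, norm_div, Complex.norm_real, Real.norm_of_nonneg
    (mul_pos (sobConst_pos l) (sobWeight_pos l k)).le, mul_div_cancel₀]
  exact (mul_pos (sobConst_pos l) (sobWeight_pos l k)).ne'

lemma hasSum_coef (x : SobAlg T l) :
    HasSum (fun k => sobWeight l k ^ 2 * ‖x.coef k‖ ^ 2) ((‖x‖ / sobConst l) ^ 2) := by
  have h := lp.hasSum_norm (p := 2) (by norm_num) x.weighted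
  have h2 := h.mul_left ((sobConst l ^ 2)⁻¹)
  have hc := (sobConst_pos l).ne'
  simp only [norm_weight_mul_coef, ENNReal.toReal_ofNat, Real.rpow_two] at h2
  have e1 : ∀ k, (sobConst l ^ 2)⁻¹ * (sobConst l * sobWeight l k * ‖x.coef k‖) ^ 2 =
      sobWeight l k ^ 2 * ‖x.coef k‖ ^ 2 := fun k => by field_simp
  have e2 : (sobConst l ^ 2)⁻¹ * ‖x.weighted‖ ^ 2 = (‖x‖ / sobConst l) ^ 2 := by
    rw [div_pow, div_eq_inv_mul]
    rfl
  simpa only [e1, e2] using h2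

@[ext]
lemma ext {x y : SobAlg T l} (h : ∀ k, x.coef k = y.coef k) : x = y := by
  refine lp.ext (funext fun k => ?_)
  exact (div_left_inj' (weight_ne_zero l k)).1 (h k)

/-- The element of `H^l` with given Fourier coefficients. -/
noncomputable def ofCoef (c : ℤ → ℂ) (hc : Summable fun k => sobWeight l k ^ 2 * ‖c k‖ ^ 2) :
    SobAlg T l :=
  (⟨fun k => ((sobConst l * sobWeight l k : ℝ) : ℂ) * c k, by
    refine memℓp_gen ?_
    refine (hc.mul_left (sobConst l ^ 2)).congr fun k => ?_
    rw [norm_mul, Complex.norm_real, Real.norm_of_nonneg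
      (mul_pos (sobConst_pos l) (sobWeight_pos l k)).le]
    simp only [ENNReal.toReal_ofNat, Real.rpow_two]
    ring⟩ : lp (fun _ : ℤ => ℂ) 2)

@[simp]
lemma coef_ofCoef (c : ℤ → ℂ) (hc : Summable fun k => sobWeight l k ^ 2 * ‖c k‖ ^ 2) (k : ℤ) :
    (ofCoef c hc : SobAlg T l).coef k = c k :=
  mul_div_cancel_left₀ _ (weight_ne_zero l k)

lemma norm_sq_eq (x : SobAlg T l) :
    ‖x‖ ^ 2 = sobConst l ^ 2 * ∑' k, sobWeight l k ^ 2 * ‖x.coef k‖ ^ 2 := by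
  have := (sobConst_pos l).ne'
  rw [x.hasSum_coef.tsum_eq]
  field_simp

lemma norm_le_of_coef_le {x : SobAlg T l} {S : ℝ} (hS : 0 ≤ S)
    (h : ∑' k, sobWeight l k ^ 2 * ‖x.coef k‖ ^ 2 ≤ S ^ 2) : ‖x‖ ≤ sobConst l * S := by
  refine (pow_le_pow_iff_left₀ (norm_nonneg _) (mul_nonneg (sobConst_pos l).le hS)
    two_ne_zero).1 ?_
  rw [norm_sq_eq, mul_pow]
  gcongr

lemma summable_coef [hl : Fact (1 ≤ l)] (x : SobAlg T l) : Summable fun k => ‖x.coef k‖ :=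
  (summable_of_sobWeight hl.out x.hasSum_coef.summable).1

/-- The constant in the embedding of `H^l` into the continuous functions. -/
noncomputable def embConst (l : ℕ) : ℝ := √(∑' k : ℤ, (sobWeight l k ^ 2)⁻¹)

lemma tsum_norm_coef_le [hl : Fact (1 ≤ l)] (x : SobAlg T l) :
    ∑' k, ‖x.coef k‖ ≤ embConst l * ‖x‖ := by
  have h := (summable_of_sobWeight hl.out x.hasSum_coef.summable).2
  have h0 : 0 ≤ ∑' k : ℤ, (sobWeight l k ^ 2)⁻¹ := tsum_nonneg fun _ => by positivity
  refine (pow_le_pow_iff_left₀ (tsum_nonneg fun _ => norm_nonneg _)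
    (mul_nonneg (Real.sqrt_nonneg _) (norm_nonneg _)) two_ne_zero).1 (h.trans ?_)
  rw [mul_pow, Real.sq_sqrt h0, x.hasSum_coef.tsum_eq]
  exact mul_le_mul_of_nonneg_left (pow_le_pow_left₀
    (div_nonneg (norm_nonneg _) (sobConst_pos l).le)
    (div_le_self (norm_nonneg _) (one_le_sobConst l)) 2) h0

variable [hT : Fact (0 < T)]

lemma summable_toCont [hl : Fact (1 ≤ l)] (x : SobAlg T l) :
    Summable fun k => x.coef k • (fourier k : C(AddCircle T, ℂ)) := by
  refine Summable.of_norm ?_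
  simpa only [norm_smul, fourier_norm, mul_one] using x.summable_coef

/-- The continuous function with given Fourier coefficients. -/
noncomputable def toCont (x : SobAlg T l) : C(AddCircle T, ℂ) :=
  ∑' k, x.coef k • (fourier k : C(AddCircle T, ℂ))

lemma hasSum_toCont [hl : Fact (1 ≤ l)] (x : SobAlg T l) :
    HasSum (fun k => x.coef k • (fourier k : C(AddCircle T, ℂ))) x.toCont :=
  x.summable_toCont.hasSum

lemma fourierCoeff_of_hasSum {c : ℤ → ℂ} {f : C(AddCircle T, ℂ)}
    (h : HasSum (fun k => c k • (fourier k : C(AddCircle T, ℂ))) f) (n : ℤ) :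
    fourierCoeff f n = c n := by
  -- The Fourier coefficient is a continuous functional on `C(AddCircle T, ℂ)`, through `L²`.
  have h1 : HasSum (fun k => fourierCoeff (T := T) (fun t => c k • fourier k t) n)
      (fourierCoeff f n) := by
    let Λ : C(AddCircle T, ℂ) →L[ℂ] ℂ :=
      ((innerSL ℂ (fourierBasis (T := T) n))).comp
        (ContinuousMap.toLp (E := ℂ) 2 AddCircle.haarAddCircle ℂ)
    have hΛ : ∀ g : C(AddCircle T, ℂ), Λ g = fourierCoeff g n := by
      intro g
      show inner ℂ (fourierBasis (T := T) n)
        (ContinuousMap.toLp (E := ℂ) 2 AddCircle.haarAddCircle ℂ g) = _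
      rw [← HilbertBasis.repr_apply_apply, fourierBasis_repr, fourierCoeff_toLp]
    have := h.mapL Λ
    simp only [hΛ] at this
    exact this
  have h2 : ∀ k, fourierCoeff (T := T) (fun t => c k • fourier k t) n =
      if k = n then c n else 0 := by
    intro k
    have h3 := congrFun (fourierCoeff_fourier (T := T) k) n
    refine (fourierCoeff.const_smul (T := T) (fun t => fourier k t) (c k) n).trans ?_
    rw [h3, Pi.single_apply]
    by_cases hk : k = n
    · simp [hk]
    · simp [hk, Ne.symm hk]
  simp only [h2] at h1
  exact h1.unique (hasSum_ite_eq n (c n))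

variable [hl : Fact (1 ≤ l)]

lemma fourierCoeff_toCont (x : SobAlg T l) (n : ℤ) : fourierCoeff x.toCont n = x.coef n :=
  fourierCoeff_of_hasSum x.hasSum_toCont n

lemma toCont_eq_iff {x : SobAlg T l} {f : C(AddCircle T, ℂ)} :
    x.toCont = f ↔ ∀ n, fourierCoeff f n = x.coef n := by
  refine ⟨fun h n => by rw [← h, fourierCoeff_toCont], fun h => ?_⟩
  have hs : Summable (fourierCoeff f) := by
    refine Summable.of_norm ?_
    simpa only [h] using x.summable_coef
  have := hasSum_fourier_series_of_summable hs
  simp only [h] at this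
  exact x.hasSum_toCont.unique this

lemma toCont_injective : Function.Injective (toCont : SobAlg T l → C(AddCircle T, ℂ)) := by
  intro x y h
  ext k
  rw [← fourierCoeff_toCont, h, fourierCoeff_toCont]

lemma toCont_add (x y : SobAlg T l) : (x + y).toCont = x.toCont + y.toCont := by
  refine (HasSum.unique ?_ (x + y).hasSum_toCont).symm
  simpa only [coef_add, add_smul] using x.hasSum_toCont.add y.hasSum_toCont

lemma toCont_smul (c : ℂ) (x : SobAlg T l) : (c • x).toCont = c • x.toCont := by
  refine (HasSum.unique ?_ (c • x).hasSum_toCont).symm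
  simpa only [coef_smul, mul_smul] using x.hasSum_toCont.const_smul c

lemma norm_toCont_le (x : SobAlg T l) : ‖x.toCont‖ ≤ embConst l * ‖x‖ := by
  refine le_trans (tsum_of_norm_bounded (f := fun k => x.coef k • (fourier k : C(AddCircle T, ℂ)))
    x.summable_coef.hasSum fun k => ?_) x.tsum_norm_coef_le
  rw [norm_smul, fourier_norm, mul_one]

/-- The product of `H^l`: convolution of Fourier coefficients. -/
noncomputable instance : Mul (SobAlg T l) where
  mul x y := ofCoef (fun n => ∑' k, x.coef k * y.coef (n - k))
    (sobolev_convolution hl.out x.hasSum_coef.summable y.hasSum_coef.summable).1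

lemma coef_mul (x y : SobAlg T l) (n : ℤ) :
    (x * y).coef n = ∑' k, x.coef k * y.coef (n - k) :=
  coef_ofCoef _ _ _

lemma norm_mul_le' (x y : SobAlg T l) : ‖x * y‖ ≤ ‖x‖ * ‖y‖ := by
  have h := (sobolev_convolution hl.out x.hasSum_coef.summable y.hasSum_coef.summable).2
  have hc := sobConst_pos l
  have h2 : ‖x * y‖ ≤ sobConst l * (‖x‖ * ‖y‖ / sobConst l) := by
    refine norm_le_of_coef_le (by positivity) ?_
    simp only [coef_mul]
    refine h.trans (le_of_eq ?_)
    rw [x.hasSum_coef.tsum_eq, y.hasSum_coef.tsum_eq]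
    field_simp
  rwa [mul_div_cancel₀] at h2
  exact hc.ne'

lemma toCont_mul (x y : SobAlg T l) : (x * y).toCont = x.toCont * y.toCont := by
  let F : ℤ → C(AddCircle T, ℂ) := fun k => x.coef k • fourier k
  let G : ℤ → C(AddCircle T, ℂ) := fun k => y.coef k • fourier k
  have hF : Summable fun k => ‖F k‖ := by
    simpa only [F, norm_smul, fourier_norm, mul_one] using x.summable_coef
  have hG : Summable fun k => ‖G k‖ := by
    simpa only [G, norm_smul, fourier_norm, mul_one] using y.summable_coef
  have h : HasSum (fun p : ℤ × ℤ => F p.1 * G p.2) (x.toCont * y.toCont) :=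
    HasSum.mul (f := F) (g := G) x.hasSum_toCont y.hasSum_toCont
      (summable_mul_of_summable_norm hF hG)
  -- Summing the product of the two Fourier series along `k + k' = n` gives the coefficients of the
  -- convolution.
  let e : ℤ × ℤ ≃ ℤ × ℤ :=
    { toFun := fun p => (p.2, p.1 - p.2)
      invFun := fun p => (p.1 + p.2, p.1)
      left_inv := fun p => by simp
      right_inv := fun p => by simp }
  have h' : HasSum (fun p : ℤ × ℤ => F p.2 * G (p.1 - p.2)) (x.toCont * y.toCont) :=
    (e.hasSum_iff (f := fun p : ℤ × ℤ => F p.1 * G p.2)).2 h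
  have hprod : ∀ n k : ℤ, F k * G (n - k) =
      (x.coef k * y.coef (n - k)) • (fourier n : C(AddCircle T, ℂ)) := by
    intro n k
    have hk : (fourier n : C(AddCircle T, ℂ)) = fourier k * fourier (n - k) := by
      ext t
      rw [ContinuousMap.mul_apply, ← fourier_add, add_sub_cancel]
    simp only [F, G]
    rw [hk, smul_mul_smul_comm]
  simp only [hprod] at h'
  have hc : ∀ n, Summable fun k => x.coef k * y.coef (n - k) := by
    intro n
    have h1 := h'.summable.prod_factor n
    have h2 := h1.mapL (ContinuousMap.evalCLM ℂ (0 : AddCircle T))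
    simpa using h2
  have hout : HasSum (fun n => (x * y).coef n • (fourier n : C(AddCircle T, ℂ)))
      (x.toCont * y.toCont) := by
    have hfib : ∀ n, HasSum (fun k => (x.coef k * y.coef (n - k)) •
        (fourier n : C(AddCircle T, ℂ))) ((x * y).coef n • (fourier n : C(AddCircle T, ℂ))) := by
      intro n
      have h1 : HasSum (fun k => x.coef k * y.coef (n - k)) ((x * y).coef n) := by
        rw [coef_mul]
        exact (hc n).hasSum
      exact h1.smul_const (fourier n : C(AddCircle T, ℂ))
    exact h'.prod_fiberwise hfib
  exact (x * y).hasSum_toCont.unique hout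

/-- The constant functions. -/
noncomputable def const (c : ℂ) : SobAlg T l :=
  ofCoef (fun k => if k = 0 then c else 0) (by
    refine summable_of_ne_finset_zero (s := {0}) fun k hk => ?_
    have : k ≠ 0 := by simpa using hk
    simp [this])

lemma toCont_const (c : ℂ) : (const c : SobAlg T l).toCont = ContinuousMap.const _ c := by
  refine (HasSum.unique ?_ (const c : SobAlg T l).hasSum_toCont).symm
  have h := hasSum_ite_eq (0 : ℤ) (ContinuousMap.const (AddCircle T) c)
  convert h using 2 with k
  simp only [const, coef_ofCoef]
  split_ifs with hk
  · ext t; simp [hk]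
  · simp

noncomputable instance : One (SobAlg T l) := ⟨const 1⟩

lemma toCont_one : (1 : SobAlg T l).toCont = 1 := toCont_const 1

noncomputable instance : NormedCommRing (SobAlg T l) :=
  { (inferInstance : NormedAddCommGroup (SobAlg T l)),
    (inferInstance : Mul (SobAlg T l)), (inferInstance : One (SobAlg T l)) with
    left_distrib := fun x y z => toCont_injective (by simp only [toCont_mul, toCont_add]; ring)
    right_distrib := fun x y z => toCont_injective (by simp only [toCont_mul, toCont_add]; ring)
    zero_mul := fun x => toCont_injective (by
      have h0 : (0 : SobAlg T l).toCont = 0 := by simpa using toCont_smul 0 (0 : SobAlg T l)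
      rw [toCont_mul, h0, zero_mul])
    mul_zero := fun x => toCont_injective (by
      have h0 : (0 : SobAlg T l).toCont = 0 := by simpa using toCont_smul 0 (0 : SobAlg T l)
      rw [toCont_mul, h0, mul_zero])
    mul_assoc := fun x y z => toCont_injective (by simp only [toCont_mul]; ring)
    mul_comm := fun x y => toCont_injective (by simp only [toCont_mul]; ring)
    one_mul := fun x => toCont_injective (by rw [toCont_mul, toCont_one, one_mul])
    mul_one := fun x => toCont_injective (by rw [toCont_mul, toCont_one, mul_one])
    norm_mul_le := norm_mul_le' }

noncomputable instance : NormedAlgebra ℂ (SobAlg T l) :=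
  { Algebra.ofModule
      (fun c x y => toCont_injective (by simp only [toCont_mul, toCont_smul, smul_mul_assoc]))
      (fun c x y => toCont_injective (by simp only [toCont_mul, toCont_smul, mul_smul_comm])) with
    norm_smul_le := norm_smul_le }

/-- Evaluation of an element of `H^l` at a point of the circle. -/
noncomputable def eval (t : AddCircle T) : SobAlg T l →+* ℂ where
  toFun x := x.toCont t
  map_one' := by rw [toCont_one]; rfl
  map_mul' x y := by rw [toCont_mul]; rfl
  map_zero' := by
    have h0 : (0 : SobAlg T l).toCont = 0 := by simpa using toCont_smul 0 (0 : SobAlg T l)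
    rw [h0]; rfl
  map_add' x y := by rw [toCont_add]; rfl

lemma eval_smul (t : AddCircle T) (c : ℂ) (x : SobAlg T l) : eval t (c • x) = c * eval t x := by
  show (c • x).toCont t = c * x.toCont t
  rw [toCont_smul]; rfl

lemma norm_eval_le (t : AddCircle T) (x : SobAlg T l) : ‖eval t x‖ ≤ embConst l * ‖x‖ :=
  (x.toCont.norm_coe_le_norm t).trans x.norm_toCont_le

lemma continuous_eval (t : AddCircle T) : Continuous (eval t : SobAlg T l → ℂ) :=
  AddMonoidHomClass.continuous_of_bound (eval t : SobAlg T l →+* ℂ) (embConst l) (norm_eval_le t)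

lemma ext_eval {x y : SobAlg T l} (h : ∀ t, eval t x = eval t y) : x = y :=
  toCont_injective (ContinuousMap.ext h)

/-- Complex conjugation of functions. -/
noncomputable def conj (x : SobAlg T l) : SobAlg T l :=
  ofCoef (fun k => (starRingEnd ℂ) (x.coef (-k))) (by
    have h := ((Equiv.neg ℤ).summable_iff
      (f := fun k => sobWeight l k ^ 2 * ‖x.coef k‖ ^ 2)).2 x.hasSum_coef.summable
    refine h.congr fun k => ?_
    simp [sobWeight_neg])

lemma coef_conj (x : SobAlg T l) (k : ℤ) : x.conj.coef k = (starRingEnd ℂ) (x.coef (-k)) :=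
  coef_ofCoef _ _ _

lemma norm_conj (x : SobAlg T l) : ‖x.conj‖ = ‖x‖ := by
  refine (pow_left_inj₀ (norm_nonneg _) (norm_nonneg _) two_ne_zero).1 ?_
  rw [norm_sq_eq, norm_sq_eq]
  congr 1
  rw [← (Equiv.neg ℤ).tsum_eq]
  simp [coef_conj, sobWeight_neg]

lemma hasSum_eval (t : AddCircle T) (x : SobAlg T l) :
    HasSum (fun k => x.coef k * fourier k t) (eval t x) :=
  (x.hasSum_toCont).mapL (ContinuousMap.evalCLM ℂ t)

lemma eval_conj (t : AddCircle T) (x : SobAlg T l) :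
    eval t x.conj = (starRingEnd ℂ) (eval t x) := by
  have h3 := Complex.hasSum_conj'.2 (hasSum_eval t x)
  have h4 := ((Equiv.neg ℤ).hasSum_iff).2 h3
  refine (hasSum_eval t x.conj).unique (h4.congr_fun fun k => ?_)
  simp only [coef_conj, Function.comp_apply, Equiv.neg_apply, map_mul, fourier_neg,
    Complex.conj_conj]

/-- Complex conjugation as a ring homomorphism. -/
noncomputable def conjHom : SobAlg T l →+* SobAlg T l where
  toFun := conj
  map_one' := ext_eval fun t => by rw [eval_conj, map_one, map_one]
  map_mul' x y := ext_eval fun t => by simp only [eval_conj, map_mul]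
  map_zero' := ext_eval fun t => by simp only [eval_conj, map_zero]
  map_add' x y := ext_eval fun t => by simp only [eval_conj, map_add]

end SobAlg
end SobolevAlgebra

/-! ### Sobolev norms of periodic maps and elements of the algebra -/

section SobolevBridge

namespace SobAlg

variable {T : ℝ} {l : ℕ}

/-- The Fourier multiplier with symbol `b` (meaningful for bounded `b`). -/
noncomputable def multiplier (b : ℤ → ℂ) (x : SobAlg T l) : SobAlg T l :=
  open Classical in
  if h : Summable fun k => sobWeight l k ^ 2 * ‖b k * x.coef k‖ ^ 2 then ofCoef _ h else 0

lemma multiplier_bound {b : ℤ → ℂ} {K : ℝ} (hb : ∀ k, ‖b k‖ ≤ K) (x : SobAlg T l) (k : ℤ) :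
    sobWeight l k ^ 2 * ‖b k * x.coef k‖ ^ 2 ≤ K ^ 2 * (sobWeight l k ^ 2 * ‖x.coef k‖ ^ 2) := by
  have h1 : ‖b k‖ ^ 2 ≤ K ^ 2 := pow_le_pow_left₀ (norm_nonneg _) (hb k) 2
  rw [norm_mul, mul_pow]
  nlinarith [mul_le_mul_of_nonneg_right h1
    (show 0 ≤ sobWeight l k ^ 2 * ‖x.coef k‖ ^ 2 by positivity)]

lemma coef_multiplier {b : ℤ → ℂ} {K : ℝ} (hb : ∀ k, ‖b k‖ ≤ K) (x : SobAlg T l) (k : ℤ) :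
    (multiplier b x).coef k = b k * x.coef k := by
  have h : Summable fun k => sobWeight l k ^ 2 * ‖b k * x.coef k‖ ^ 2 :=
    Summable.of_nonneg_of_le (fun k => by positivity) (multiplier_bound hb x)
      (x.hasSum_coef.summable.mul_left _)
  rw [multiplier, dif_pos h, coef_ofCoef]

lemma norm_multiplier_le {b : ℤ → ℂ} {K : ℝ} (hb : ∀ k, ‖b k‖ ≤ K) (x : SobAlg T l) :
    ‖multiplier b x‖ ≤ K * ‖x‖ := by
  have hK : 0 ≤ K := (norm_nonneg _).trans (hb 0)
  refine (pow_le_pow_iff_left₀ (norm_nonneg _) (mul_nonneg hK (norm_nonneg _)) two_ne_zero).1 ?_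
  rw [mul_pow, norm_sq_eq, norm_sq_eq]
  simp only [coef_multiplier hb]
  have hs := x.hasSum_coef.summable.mul_left (K ^ 2)
  have h := (Summable.of_nonneg_of_le (fun k => by positivity) (multiplier_bound hb x)
    hs).tsum_le_tsum (multiplier_bound hb x) hs
  rw [tsum_mul_left] at h
  nlinarith [mul_le_mul_of_nonneg_left h (sq_nonneg (sobConst l))]

variable [hT : Fact (0 < T)] [hl : Fact (1 ≤ l)]

lemma conj_multiplier {b : ℤ → ℂ} {K : ℝ} (hb : ∀ k, ‖b k‖ ≤ K) {b' : ℤ → ℂ}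
    (hb' : ∀ k, b' k = (starRingEnd ℂ) (b (-k))) (x : SobAlg T l) :
    (multiplier b x).conj = multiplier b' x.conj := by
  have h' : ∀ k, ‖b' k‖ ≤ K := fun k => by rw [hb', RCLike.norm_conj]; exact hb _
  ext k
  rw [coef_conj, coef_multiplier hb, coef_multiplier h', coef_conj, hb', map_mul]

/-- Termwise differentiation of a Fourier series whose derivative is in `H^l`. -/
lemma hasDerivAt_eval {x y : SobAlg T l}
    (h : ∀ k : ℤ, y.coef k = 2 * Real.pi * Complex.I * k / T * x.coef k) (t : ℝ) :
    HasDerivAt (fun s : ℝ => eval (s : AddCircle T) x) (eval (t : AddCircle T) y) t := by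
  have hd : ∀ (k : ℤ) (s : ℝ), HasDerivAt (fun s : ℝ => x.coef k * fourier k (s : AddCircle T))
      (y.coef k * fourier k (s : AddCircle T)) s := by
    intro k s
    refine ((hasDerivAt_fourier T k s).const_mul (x.coef k)).congr_deriv ?_
    rw [h]; ring
  have hn : ∀ (k : ℤ) (s : ℝ), ‖y.coef k * fourier k (s : AddCircle T)‖ ≤ ‖y.coef k‖ := by
    intro k s
    rw [norm_mul]
    refine mul_le_of_le_one_right (norm_nonneg _) ?_
    have := (fourier k : C(AddCircle T, ℂ)).norm_coe_le_norm (s : AddCircle T)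
    rwa [fourier_norm] at this
  have := hasDerivAt_tsum y.summable_coef hd hn (hasSum_eval ((0 : ℝ) : AddCircle T) x).summable t
  have e : (fun s : ℝ => eval (s : AddCircle T) x) =
      fun s : ℝ => ∑' k, x.coef k * fourier k (s : AddCircle T) :=
    funext fun s => (hasSum_eval _ x).tsum_eq.symm
  rw [e, ← (hasSum_eval _ y).tsum_eq]
  exact this

lemma fourierCoeff_eq_coef {x : SobAlg T l} {f : AddCircle T → ℂ} (h : ∀ t, eval t x = f t)
    (k : ℤ) : fourierCoeff f k = x.coef k := by
  have : f = x.toCont := funext fun t => (h t).symm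
  rw [this, fourierCoeff_toCont]

/-- The components of a function of class `H^l` are elements of the algebra `H^l`. -/
lemma exists_of_memSobolev {m : ℕ} {f : AddCircle T → EuclideanSpace ℝ (Fin m)}
    (hf : MemSobolev l f) (i : Fin m) :
    ∃ x : SobAlg T l, (∀ t, eval t x = ((f t i : ℝ) : ℂ)) ∧
      ‖x‖ ≤ sobConst l * sobolevNorm l f := by
  obtain ⟨hc, hs⟩ := hf
  let g : C(AddCircle T, ℂ) := ⟨fun t => ((f t i : ℝ) : ℂ), by fun_prop⟩
  have hle : ∀ k : ℤ, sobWeight l k ^ 2 * ‖fourierCoeff g k‖ ^ 2 ≤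
      (1 + (k : ℝ) ^ 2) ^ l * fourierNormSq f k := by
    intro k
    rw [sobWeight_sq]
    gcongr
    exact Finset.single_le_sum (f := fun i : Fin m =>
      ‖fourierCoeff (fun x : AddCircle T => ((f x i : ℝ) : ℂ)) k‖ ^ 2)
      (fun _ _ => by positivity) (Finset.mem_univ i)
  have hg : Summable fun k : ℤ => sobWeight l k ^ 2 * ‖fourierCoeff g k‖ ^ 2 :=
    Summable.of_nonneg_of_le (fun k => by positivity) hle hs
  refine ⟨ofCoef (fourierCoeff g) hg, fun t => ?_, ?_⟩
  · have : (ofCoef (fourierCoeff g) hg : SobAlg T l).toCont = g :=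
      toCont_eq_iff.2 fun n => (coef_ofCoef _ _ _).symm
    show (ofCoef (fourierCoeff g) hg : SobAlg T l).toCont t = _
    rw [this]; rfl
  · have h0 : 0 ≤ ∑' k : ℤ, (1 + (k : ℝ) ^ 2) ^ l * fourierNormSq f k :=
      tsum_nonneg fun k => mul_nonneg (by positivity)
        (Finset.sum_nonneg fun _ _ => by positivity)
    refine norm_le_of_coef_le (Real.sqrt_nonneg _) ?_
    rw [sobolevNorm, Real.sq_sqrt h0]
    simp only [coef_ofCoef]
    exact hg.tsum_le_tsum hle hs

/-- A function whose components are (real) elements of the algebra `H^l` and satisfy the stronger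
summability of `H^n` is of class `H^n`. -/
lemma memSobolev_of_eval {m n : ℕ} {f : AddCircle T → EuclideanSpace ℝ (Fin m)}
    {x : Fin m → SobAlg T l} (h : ∀ i t, eval t (x i) = ((f t i : ℝ) : ℂ))
    (hs : ∀ i, Summable fun k => sobWeight n k ^ 2 * ‖(x i).coef k‖ ^ 2) : MemSobolev n f := by
  constructor
  · have : ∀ i, Continuous fun t => f t i := fun i => by
      have e : (fun t => f t i) = fun t => ((x i).toCont t).re := funext fun t => by
        have := h i t
        change (x i).toCont t = _ at this
        rw [this, Complex.ofReal_re]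
      rw [e]; fun_prop
    exact (PiLp.continuous_toLp 2 _).comp (continuous_pi this)
  · have : ∀ k : ℤ, (1 + (k : ℝ) ^ 2) ^ n * fourierNormSq f k =
        ∑ i, sobWeight n k ^ 2 * ‖(x i).coef k‖ ^ 2 := by
      intro k
      rw [fourierNormSq, Finset.mul_sum, sobWeight_sq]
      exact Finset.sum_congr rfl fun i _ => by rw [fourierCoeff_eq_coef (h i)]
    simp only [this]
    exact summable_sum fun i _ => hs i

lemma sobolevNorm_le_of_eval {m : ℕ} {f : AddCircle T → EuclideanSpace ℝ (Fin m)}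
    {x : Fin m → SobAlg T l} (h : ∀ i t, eval t (x i) = ((f t i : ℝ) : ℂ)) :
    MemSobolev l f ∧ sobolevNorm l f ≤ ∑ i, ‖x i‖ := by
  refine ⟨memSobolev_of_eval h fun i => (x i).hasSum_coef.summable, ?_⟩
  have hk : ∀ k : ℤ, (1 + (k : ℝ) ^ 2) ^ l * fourierNormSq f k =
      ∑ i, sobWeight l k ^ 2 * ‖(x i).coef k‖ ^ 2 := by
    intro k
    rw [fourierNormSq, Finset.mul_sum, sobWeight_sq]
    exact Finset.sum_congr rfl fun i _ => by rw [fourierCoeff_eq_coef (h i)]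
  rw [sobolevNorm]
  simp only [hk]
  rw [Summable.tsum_finsetSum fun i _ => (x i).hasSum_coef.summable]
  simp only [(hasSum_coef _).tsum_eq]
  refine Real.sqrt_le_iff.2 ⟨Finset.sum_nonneg fun _ _ => norm_nonneg _, ?_⟩
  calc ∑ i, (‖x i‖ / sobConst l) ^ 2 ≤ ∑ i, ‖x i‖ ^ 2 :=
        Finset.sum_le_sum fun i _ => pow_le_pow_left₀
          (div_nonneg (norm_nonneg _) (sobConst_pos l).le)
          (div_le_self (norm_nonneg _) (one_le_sobConst l)) 2
    _ ≤ (∑ i, ‖x i‖) ^ 2 := Finset.sum_sq_le_sq_sum_of_nonneg fun i _ => norm_nonneg _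

end SobAlg
end SobolevBridge

/-! ### The Banach algebra of power series with summable coefficients -/

section PowerSeriesAlgebra

/-- The algebra of power series `∑ f_α X^α` in the variables `X_i`, `i ∈ ι`, with coefficients in the
Banach algebra `H` and `∑ ‖f_α‖ < ∞`. -/
def PowAlg (ι H : Type*) [NormedCommRing H] : Type _ := lp (fun _ : ι →₀ ℕ => H) 1

namespace PowAlg

variable {ι H : Type*} [NormedCommRing H]

noncomputable instance : NormedAddCommGroup (PowAlg ι H) :=
  inferInstanceAs (NormedAddCommGroup (lp (fun _ : ι →₀ ℕ => H) 1))

instance [CompleteSpace H] : CompleteSpace (PowAlg ι H) :=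
  inferInstanceAs (CompleteSpace (lp (fun _ : ι →₀ ℕ => H) 1))

noncomputable instance [NormedAlgebra ℂ H] : NormedSpace ℂ (PowAlg ι H) :=
  inferInstanceAs (NormedSpace ℂ (lp (fun _ : ι →₀ ℕ => H) 1))

/-- The underlying summable family. -/
def family (f : PowAlg ι H) : lp (fun _ : ι →₀ ℕ => H) 1 := f

/-- The coefficient of `X^α`. -/
def coef (f : PowAlg ι H) (α : ι →₀ ℕ) : H := f.family α

lemma coef_add (f g : PowAlg ι H) (α : ι →₀ ℕ) : (f + g).coef α = f.coef α + g.coef α := rfl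

lemma coef_sub (f g : PowAlg ι H) (α : ι →₀ ℕ) : (f - g).coef α = f.coef α - g.coef α := rfl

lemma coef_zero (α : ι →₀ ℕ) : (0 : PowAlg ι H).coef α = 0 := rfl

lemma coef_smul [NormedAlgebra ℂ H] (c : ℂ) (f : PowAlg ι H) (α : ι →₀ ℕ) :
    (c • f).coef α = c • f.coef α := rfl

@[ext]
lemma ext {f g : PowAlg ι H} (h : ∀ α, f.coef α = g.coef α) : f = g :=
  lp.ext (funext h)

lemma hasSum_norm (f : PowAlg ι H) : HasSum (fun α => ‖f.coef α‖) ‖f‖ := by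
  have h := lp.hasSum_norm (p := 1) (by norm_num) f.family
  simp only [ENNReal.toReal_one, Real.rpow_one] at h
  exact h

/-- The power series with given absolutely summable coefficients. -/
noncomputable def ofCoef (c : (ι →₀ ℕ) → H) (hc : Summable fun α => ‖c α‖) : PowAlg ι H :=
  (⟨c, memℓp_gen (by simpa using hc)⟩ : lp (fun _ : ι →₀ ℕ => H) 1)

@[simp]
lemma coef_ofCoef (c : (ι →₀ ℕ) → H) (hc : Summable fun α => ‖c α‖) (α : ι →₀ ℕ) :
    (ofCoef c hc).coef α = c α := rfl

lemma norm_coef_le (f : PowAlg ι H) (α : ι →₀ ℕ) : ‖f.coef α‖ ≤ ‖f‖ :=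
  le_hasSum f.hasSum_norm α fun _ _ => norm_nonneg _

lemma norm_le_of_coef {f : PowAlg ι H} {b : (ι →₀ ℕ) → ℝ} {S : ℝ} (hb : HasSum b S)
    (h : ∀ α, ‖f.coef α‖ ≤ b α) : ‖f‖ ≤ S :=
  hasSum_le h f.hasSum_norm hb

/-- The additive map taking the coefficient of `X^α`. -/
def coefHom (α : ι →₀ ℕ) : PowAlg ι H →+ H where
  toFun f := f.coef α
  map_zero' := rfl
  map_add' _ _ := rfl

lemma coef_sum {κ : Type*} (s : Finset κ) (f : κ → PowAlg ι H) (α : ι →₀ ℕ) :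
    (∑ j ∈ s, f j).coef α = ∑ j ∈ s, (f j).coef α :=
  map_sum (coefHom α) f s

lemma continuous_coef (α : ι →₀ ℕ) : Continuous fun f : PowAlg ι H => f.coef α :=
  AddMonoidHomClass.continuous_of_bound (coefHom α : PowAlg ι H →+ H) 1
    fun f => (f.norm_coef_le α).trans_eq (one_mul _).symm

lemma summable_product (f g : PowAlg ι H) :
    Summable fun p : (ι →₀ ℕ) × (ι →₀ ℕ) => ‖f.coef p.1‖ * ‖g.coef p.2‖ :=
  f.hasSum_norm.summable.mul_of_nonneg g.hasSum_norm.summable (fun _ => norm_nonneg _)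
    fun _ => norm_nonneg _

variable [DecidableEq ι]

lemma hasSum_antidiagonal (f g : PowAlg ι H) :
    HasSum (fun α => ∑ p ∈ Finset.HasAntidiagonal.antidiagonal α, ‖f.coef p.1‖ * ‖g.coef p.2‖)
      (‖f‖ * ‖g‖) := by
  have h := summable_sum_mul_antidiagonal_of_summable_mul (f := fun α => ‖f.coef α‖)
    (g := fun α => ‖g.coef α‖) (summable_product f g)
  have h2 := Summable.tsum_mul_tsum_eq_tsum_sum_antidiagonal (f := fun α => ‖f.coef α‖)
    (g := fun α => ‖g.coef α‖) f.hasSum_norm.summable g.hasSum_norm.summable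
    (summable_product f g)
  rw [f.hasSum_norm.tsum_eq, g.hasSum_norm.tsum_eq] at h2
  rw [h2]
  exact h.hasSum

lemma norm_antidiagonal_le (f g : PowAlg ι H) (α : ι →₀ ℕ) :
    ‖∑ p ∈ Finset.HasAntidiagonal.antidiagonal α, f.coef p.1 * g.coef p.2‖ ≤
      ∑ p ∈ Finset.HasAntidiagonal.antidiagonal α, ‖f.coef p.1‖ * ‖g.coef p.2‖ :=
  (norm_sum_le _ _).trans (Finset.sum_le_sum fun _ _ => norm_mul_le _ _)

/-- The product of power series. -/
noncomputable instance : Mul (PowAlg ι H) where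
  mul f g := ofCoef (fun α => ∑ p ∈ Finset.HasAntidiagonal.antidiagonal α, f.coef p.1 * g.coef p.2)
    (Summable.of_nonneg_of_le (fun _ => norm_nonneg _) (norm_antidiagonal_le f g)
      (hasSum_antidiagonal f g).summable)

lemma coef_mul (f g : PowAlg ι H) (α : ι →₀ ℕ) :
    (f * g).coef α = ∑ p ∈ Finset.HasAntidiagonal.antidiagonal α, f.coef p.1 * g.coef p.2 := rfl

/-- The monomial `h X^α`. -/
noncomputable def monomial (α : ι →₀ ℕ) (h : H) : PowAlg ι H :=
  ofCoef (fun β => if β = α then h else 0)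
    (summable_of_ne_finset_zero (s := {α}) fun β hβ => by
      have : β ≠ α := by simpa using hβ
      simp [this])

lemma coef_monomial (α : ι →₀ ℕ) (h : H) (β : ι →₀ ℕ) :
    (monomial α h).coef β = if β = α then h else 0 := rfl

lemma norm_monomial (α : ι →₀ ℕ) (h : H) : ‖monomial α h‖ = ‖h‖ := by
  refine (monomial α h).hasSum_norm.unique ?_
  have := hasSum_ite_eq α ‖h‖
  refine this.congr_fun fun β => ?_
  rw [coef_monomial]
  split_ifs <;> simp

noncomputable instance : One (PowAlg ι H) := ⟨monomial 0 1⟩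

/-- The underlying formal power series. -/
def toMv (f : PowAlg ι H) : MvPowerSeries ι H := f.coef

lemma toMv_injective : Function.Injective (toMv : PowAlg ι H → MvPowerSeries ι H) :=
  fun _ _ h => ext fun α => congrFun h α

lemma toMv_mul (f g : PowAlg ι H) : (f * g).toMv = f.toMv * g.toMv := by
  ext α
  rw [MvPowerSeries.coeff_mul]
  rfl

lemma toMv_one : (1 : PowAlg ι H).toMv = 1 := by
  ext α
  rw [MvPowerSeries.coeff_one]
  rfl

lemma toMv_add (f g : PowAlg ι H) : (f + g).toMv = f.toMv + g.toMv := rfl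

lemma toMv_zero : (0 : PowAlg ι H).toMv = 0 := rfl

noncomputable instance : NormedCommRing (PowAlg ι H) :=
  { (inferInstance : NormedAddCommGroup (PowAlg ι H)),
    (inferInstance : Mul (PowAlg ι H)), (inferInstance : One (PowAlg ι H)) with
    left_distrib := fun x y z => toMv_injective (by simp only [toMv_mul, toMv_add]; ring)
    right_distrib := fun x y z => toMv_injective (by simp only [toMv_mul, toMv_add]; ring)
    zero_mul := fun x => toMv_injective (by rw [toMv_mul, toMv_zero, zero_mul])
    mul_zero := fun x => toMv_injective (by rw [toMv_mul, toMv_zero, mul_zero])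
    mul_assoc := fun x y z => toMv_injective (by simp only [toMv_mul]; ring)
    mul_comm := fun x y => toMv_injective (by simp only [toMv_mul]; ring)
    one_mul := fun x => toMv_injective (by rw [toMv_mul, toMv_one, one_mul])
    mul_one := fun x => toMv_injective (by rw [toMv_mul, toMv_one, mul_one])
    norm_mul_le := fun f g =>
      norm_le_of_coef (hasSum_antidiagonal f g) (norm_antidiagonal_le f g) }

noncomputable instance [NormedAlgebra ℂ H] : NormedAlgebra ℂ (PowAlg ι H) :=
  { Algebra.ofModule
      (fun c x y => ext fun α => by
        simp only [coef_mul, coef_smul, smul_mul_assoc, Finset.smul_sum])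
      (fun c x y => ext fun α => by
        simp only [coef_mul, coef_smul, mul_smul_comm, Finset.smul_sum]) with
    norm_smul_le := norm_smul_le }

/-- Constant power series. -/
noncomputable def C : H →+* PowAlg ι H where
  toFun h := monomial 0 h
  map_one' := rfl
  map_mul' x y := toMv_injective (by
    rw [toMv_mul]
    have e : ∀ h : H, (monomial 0 h : PowAlg ι H).toMv = MvPowerSeries.C h := fun h => by
      ext α
      rw [MvPowerSeries.coeff_C]; rfl
    rw [e, e, e, map_mul])
  map_zero' := ext fun α => by rw [coef_monomial, coef_zero, ite_self]
  map_add' x y := ext fun α => by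
    rw [coef_add]
    simp only [coef_monomial]
    split_ifs <;> simp

lemma norm_C (h : H) : ‖(C h : PowAlg ι H)‖ = ‖h‖ := norm_monomial 0 h

/-- The variables. -/
noncomputable def X (i : ι) : PowAlg ι H := monomial (Finsupp.single i 1) 1

lemma norm_X (i : ι) : ‖(X i : PowAlg ι H)‖ = ‖(1 : H)‖ := norm_monomial _ 1

/-! ### Order of vanishing at the origin -/

/-- `f` vanishes to order `k` at the origin. -/
def OrderGe (k : ℕ) (f : PowAlg ι H) : Prop := ∀ α : ι →₀ ℕ, α.degree < k → f.coef α = 0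

lemma OrderGe.mono {j k : ℕ} {f : PowAlg ι H} (hf : OrderGe k f) (h : j ≤ k) : OrderGe j f :=
  fun α hα => hf α (hα.trans_le h)

lemma orderGe_zero (f : PowAlg ι H) : OrderGe 0 f := fun _ h => absurd h (by omega)

lemma OrderGe.add {k : ℕ} {f g : PowAlg ι H} (hf : OrderGe k f) (hg : OrderGe k g) :
    OrderGe k (f + g) := fun α h => by rw [coef_add, hf α h, hg α h, add_zero]

lemma OrderGe.sub {k : ℕ} {f g : PowAlg ι H} (hf : OrderGe k f) (hg : OrderGe k g) :
    OrderGe k (f - g) := fun α h => by rw [coef_sub, hf α h, hg α h, sub_zero]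

lemma OrderGe.smul [NormedAlgebra ℂ H] {k : ℕ} {f : PowAlg ι H} (hf : OrderGe k f) (c : ℂ) :
    OrderGe k (c • f) := fun α h => by rw [coef_smul, hf α h, smul_zero]

lemma OrderGe.sum {κ : Type*} {s : Finset κ} {k : ℕ} {f : κ → PowAlg ι H}
    (hf : ∀ j ∈ s, OrderGe k (f j)) : OrderGe k (∑ j ∈ s, f j) := fun α h => by
  rw [coef_sum]; exact Finset.sum_eq_zero fun j hj => hf j hj α h

lemma OrderGe.mul {j k : ℕ} {f g : PowAlg ι H} (hf : OrderGe j f) (hg : OrderGe k g) :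
    OrderGe (j + k) (f * g) := fun α h => by
  rw [coef_mul]
  refine Finset.sum_eq_zero fun p hp => ?_
  have hp' : p.1.degree + p.2.degree = α.degree := by
    rw [← map_add, Finset.HasAntidiagonal.mem_antidiagonal.1 hp]
  by_cases h1 : p.1.degree < j
  · rw [hf _ h1, zero_mul]
  · rw [hg _ (by omega), mul_zero]

lemma OrderGe.prod {κ : Type*} {s : Finset κ} {f : κ → PowAlg ι H}
    (hf : ∀ j ∈ s, OrderGe 1 (f j)) : OrderGe s.card (∏ j ∈ s, f j) := by
  classical
  induction s using Finset.induction_on with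
  | empty => exact orderGe_zero _
  | insert a s ha ih =>
    rw [Finset.prod_insert ha, Finset.card_insert_of_notMem ha, add_comm]
    exact (hf a (Finset.mem_insert_self a s)).mul
      (ih fun j hj => hf j (Finset.mem_insert_of_mem hj))

lemma OrderGe.of_hasSum {κ : Type*} {k : ℕ} {f : κ → PowAlg ι H} {g : PowAlg ι H}
    (h : HasSum f g) (hf : ∀ j, OrderGe k (f j)) : OrderGe k g := fun α hα => by
  have h1 : HasSum (fun j => (f j).coef α) (g.coef α) := h.map (coefHom α) (continuous_coef α)
  simp only [fun j => hf j α hα] at h1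
  exact h1.unique hasSum_zero

lemma orderGe_X (i : ι) : OrderGe 1 (X i : PowAlg ι H) := fun α h => by
  have : α ≠ Finsupp.single i 1 := by
    rintro rfl
    simp at h
  rw [X, coef_monomial, if_neg this]

/-! ### Evaluation at points of the unit polydisc -/

/-- The value `ζ^α` of a monomial. -/
def mon [Fintype ι] (ζ : ι → ℂ) (α : ι →₀ ℕ) : ℂ := ∏ i, ζ i ^ α i

variable [Fintype ι]

omit [DecidableEq ι] in
lemma mon_add (ζ : ι → ℂ) (α β : ι →₀ ℕ) : mon ζ (α + β) = mon ζ α * mon ζ β := by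
  simp [mon, pow_add, Finset.prod_mul_distrib]

omit [DecidableEq ι] in
lemma mon_zero (ζ : ι → ℂ) : mon ζ 0 = 1 := by simp [mon]

lemma mon_single (ζ : ι → ℂ) (i : ι) : mon ζ (Finsupp.single i 1) = ζ i := by
  rw [mon, Finset.prod_eq_single i]
  · simp
  · intro j _ hj; simp [hj.symm]
  · simp

omit [DecidableEq ι] in
lemma norm_mon_le {ζ : ι → ℂ} {θ : ℝ} (hζ : ∀ i, ‖ζ i‖ ≤ θ) (α : ι →₀ ℕ) :
    ‖mon ζ α‖ ≤ θ ^ α.degree := by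
  rw [mon, norm_prod, Finsupp.degree_eq_sum, ← Finset.prod_pow_eq_pow_sum]
  refine Finset.prod_le_prod (fun _ _ => norm_nonneg _) fun i _ => ?_
  rw [norm_pow]
  exact pow_le_pow_left₀ (norm_nonneg _) (hζ i) _

omit [DecidableEq ι] in
lemma norm_mon_le_one {ζ : ι → ℂ} (hζ : ∀ i, ‖ζ i‖ ≤ 1) (α : ι →₀ ℕ) : ‖mon ζ α‖ ≤ 1 := by
  simpa using norm_mon_le hζ α

variable [NormedAlgebra ℂ H]

/-- The value `∑ ζ^α f_α ∈ H` of a power series at `ζ`. -/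
noncomputable def ev (ζ : ι → ℂ) (f : PowAlg ι H) : H := ∑' α, mon ζ α • f.coef α

lemma summable_norm_ev {ζ : ι → ℂ} (hζ : ∀ i, ‖ζ i‖ ≤ 1) (f : PowAlg ι H) :
    Summable fun α => ‖mon ζ α • f.coef α‖ :=
  Summable.of_nonneg_of_le (fun _ => norm_nonneg _)
    (fun α => by
      rw [norm_smul]
      exact mul_le_of_le_one_left (norm_nonneg _) (norm_mon_le_one hζ α))
    f.hasSum_norm.summable

lemma norm_ev_le {ζ : ι → ℂ} {θ : ℝ} (hζ : ∀ i, ‖ζ i‖ ≤ θ) (hθ0 : 0 ≤ θ) (hθ : θ ≤ 1) {k : ℕ}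
    {f : PowAlg ι H} (hf : OrderGe k f) : ‖ev ζ f‖ ≤ θ ^ k * ‖f‖ := by
  refine tsum_of_norm_bounded (f.hasSum_norm.mul_left (θ ^ k)) fun α => ?_
  by_cases h : α.degree < k
  · rw [hf α h]; simp
  · rw [norm_smul]
    gcongr
    exact (norm_mon_le hζ α).trans (pow_le_pow_of_le_one hθ0 hθ (by omega))

lemma ev_monomial (ζ : ι → ℂ) (α : ι →₀ ℕ) (h : H) : ev ζ (monomial α h) = mon ζ α • h := by
  rw [ev, tsum_eq_single α]
  · rw [coef_monomial, if_pos rfl]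
  · intro β hβ; rw [coef_monomial, if_neg hβ, smul_zero]

lemma ev_C (ζ : ι → ℂ) (h : H) : ev ζ (C h : PowAlg ι H) = h := by
  have := ev_monomial ζ 0 h
  rwa [mon_zero, one_smul] at this

lemma ev_X (ζ : ι → ℂ) (i : ι) : ev ζ (X i : PowAlg ι H) = ζ i • (1 : H) := by
  rw [X, ev_monomial, mon_single]

lemma ev_smul (ζ : ι → ℂ) (c : ℂ) (f : PowAlg ι H) : ev ζ (c • f) = c • ev ζ f := by
  simp only [ev, coef_smul]
  rw [← tsum_const_smul'']
  exact tsum_congr fun α => smul_comm _ _ _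

variable [CompleteSpace H]

lemma hasSum_ev {ζ : ι → ℂ} (hζ : ∀ i, ‖ζ i‖ ≤ 1) (f : PowAlg ι H) :
    HasSum (fun α => mon ζ α • f.coef α) (ev ζ f) :=
  (summable_norm_ev hζ f).of_norm.hasSum

/-- Evaluation at a point of the unit polydisc is a homomorphism of algebras. -/
noncomputable def evHom (ζ : ι → ℂ) (hζ : ∀ i, ‖ζ i‖ ≤ 1) : PowAlg ι H →ₐ[ℂ] H where
  toFun := ev ζ
  map_one' := by
    show ev ζ (C 1 : PowAlg ι H) = 1
    exact ev_C ζ 1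
  map_mul' f g := by
    have hs : Summable fun p : (ι →₀ ℕ) × (ι →₀ ℕ) =>
        (mon ζ p.1 • f.coef p.1) * (mon ζ p.2 • g.coef p.2) :=
      summable_mul_of_summable_norm (f := fun α => mon ζ α • f.coef α)
        (g := fun α => mon ζ α • g.coef α) (summable_norm_ev hζ f) (summable_norm_ev hζ g)
    have h := Summable.tsum_mul_tsum_eq_tsum_sum_antidiagonal (f := fun α => mon ζ α • f.coef α)
      (g := fun α => mon ζ α • g.coef α) (hasSum_ev hζ f).summable (hasSum_ev hζ g).summable hs
    show ev ζ (f * g) = ev ζ f * ev ζ g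
    rw [ev, ev, ev, h]
    refine tsum_congr fun α => ?_
    rw [coef_mul, Finset.smul_sum]
    refine Finset.sum_congr rfl fun p hp => ?_
    rw [← Finset.HasAntidiagonal.mem_antidiagonal.1 hp, mon_add, smul_mul_smul_comm]
  map_zero' := by simp [ev, coef_zero]
  map_add' f g := by
    refine (hasSum_ev hζ (f + g)).unique ?_
    simpa only [coef_add, smul_add] using (hasSum_ev hζ f).add (hasSum_ev hζ g)
  commutes' c := by
    rw [Algebra.algebraMap_eq_smul_one, Algebra.algebraMap_eq_smul_one, ev_smul]
    congr 1
    exact ev_C ζ 1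

lemma evHom_apply (ζ : ι → ℂ) (hζ : ∀ i, ‖ζ i‖ ≤ 1) (f : PowAlg ι H) :
    evHom ζ hζ f = ev ζ f := rfl

lemma continuous_evHom (ζ : ι → ℂ) (hζ : ∀ i, ‖ζ i‖ ≤ 1) :
    Continuous (evHom ζ hζ : PowAlg ι H → H) :=
  AddMonoidHomClass.continuous_of_bound (evHom ζ hζ : PowAlg ι H →ₐ[ℂ] H) 1 fun f => by
    simpa [evHom_apply] using norm_ev_le hζ zero_le_one le_rfl (orderGe_zero f)

end PowAlg
end PowerSeriesAlgebra

/-! ### Derivatives, Fourier multipliers and conjugation of power series -/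

section PowerSeriesOperators

namespace PowAlg

variable {ι : Type*} [DecidableEq ι]

section Diagonal

variable {H : Type*} [NormedCommRing H]

/-- The operator acting on the coefficient of `X^α` by `m α` (meaningful for uniformly bounded
`m α`). -/
noncomputable def diag (m : (ι →₀ ℕ) → H → H) (f : PowAlg ι H) : PowAlg ι H :=
  open Classical in
  if h : Summable fun α => ‖m α (f.coef α)‖ then ofCoef _ h else 0

lemma coef_diag {m : (ι →₀ ℕ) → H → H} {K : ℝ} (hm : ∀ α h, ‖m α h‖ ≤ K * ‖h‖)
    (f : PowAlg ι H) (α : ι →₀ ℕ) : (diag m f).coef α = m α (f.coef α) := by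
  have h : Summable fun α => ‖m α (f.coef α)‖ :=
    Summable.of_nonneg_of_le (fun _ => norm_nonneg _) (fun α => hm α _)
      (f.hasSum_norm.summable.mul_left K)
  rw [diag, dif_pos h, coef_ofCoef]

lemma norm_diag_le {m : (ι →₀ ℕ) → H → H} {K : ℝ} (hm : ∀ α h, ‖m α h‖ ≤ K * ‖h‖)
    (f : PowAlg ι H) : ‖diag m f‖ ≤ K * ‖f‖ :=
  norm_le_of_coef (f.hasSum_norm.mul_left K) fun α => by
    rw [coef_diag hm]; exact hm α _

end Diagonal

section Derivative

variable {H : Type*} [NormedCommRing H] [NormedAlgebra ℂ H]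

omit [DecidableEq ι] in
lemma shift_injective (i : ι) :
    Function.Injective fun α : ι →₀ ℕ => α + Finsupp.single i 1 :=
  add_left_injective _

lemma summable_shift (f : PowAlg ι H) (i : ι) :
    Summable fun α => ‖f.coef (α + Finsupp.single i 1)‖ :=
  f.hasSum_norm.summable.comp_injective (shift_injective i)

lemma tsum_shift_le (f : PowAlg ι H) (i : ι) :
    ∑' α, ‖f.coef (α + Finsupp.single i 1)‖ ≤ ‖f‖ := by
  rw [← f.hasSum_norm.tsum_eq]
  exact tsum_comp_le_tsum_of_inj f.hasSum_norm.summable (fun _ => norm_nonneg _)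
    (shift_injective i)

/-- The coefficients of the derivative `∂_i f`, cut off at degree `p`. -/
noncomputable def pderivCoef (p : ℕ) (i : ι) (f : PowAlg ι H) (α : ι →₀ ℕ) : H :=
  if α.degree < p then ((α i + 1 : ℕ) : ℂ) • f.coef (α + Finsupp.single i 1) else 0

lemma norm_pderivCoef_le (p : ℕ) (i : ι) (f : PowAlg ι H) (α : ι →₀ ℕ) :
    ‖pderivCoef p i f α‖ ≤ p * ‖f.coef (α + Finsupp.single i 1)‖ := by
  rw [pderivCoef]
  split_ifs with h
  · rw [norm_smul, Complex.norm_natCast]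
    gcongr
    have := Finsupp.le_degree i α
    omega
  · rw [norm_zero]; positivity

/-- The partial derivative `∂_i f`, cut off at degree `p`: on polynomials of degree at most `p` it is
the partial derivative, and it is a bounded operator. -/
noncomputable def pderiv (p : ℕ) (i : ι) (f : PowAlg ι H) : PowAlg ι H :=
  ofCoef (pderivCoef p i f) (Summable.of_nonneg_of_le (fun _ => norm_nonneg _)
    (norm_pderivCoef_le p i f) ((summable_shift f i).mul_left _))

lemma coef_pderiv (p : ℕ) (i : ι) (f : PowAlg ι H) (α : ι →₀ ℕ) :
    (pderiv p i f).coef α = if α.degree < p then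
      ((α i + 1 : ℕ) : ℂ) • f.coef (α + Finsupp.single i 1) else 0 := rfl

lemma norm_pderiv_le (p : ℕ) (i : ι) (f : PowAlg ι H) : ‖pderiv p i f‖ ≤ p * ‖f‖ := by
  refine (norm_le_of_coef ((summable_shift f i).hasSum.mul_left (p : ℝ))
    (norm_pderivCoef_le p i f)).trans ?_
  gcongr
  exact tsum_shift_le f i

lemma pderiv_sub (p : ℕ) (i : ι) (f g : PowAlg ι H) :
    pderiv p i (f - g) = pderiv p i f - pderiv p i g := by
  ext α
  simp only [coef_sub, coef_pderiv]
  split_ifs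
  · rw [smul_sub]
  · rw [sub_zero]

variable [Fintype ι]

/-- Well inside the polydisc the derivative is bounded independently of the degree. -/
lemma norm_ev_pderiv_le {ζ : ι → ℂ} (hζ : ∀ i, ‖ζ i‖ ≤ 1 / 2) (p : ℕ) (i : ι)
    (f : PowAlg ι H) : ‖ev ζ (pderiv p i f)‖ ≤ ‖f‖ := by
  refine (tsum_of_norm_bounded (summable_shift f i).hasSum fun α => ?_).trans (tsum_shift_le f i)
  rw [norm_smul, coef_pderiv]
  split_ifs
  · rw [norm_smul, Complex.norm_natCast, ← mul_assoc]
    refine mul_le_of_le_one_left (norm_nonneg _) ?_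
    have h1 := norm_mon_le hζ α
    -- The factor lost by differentiation is absorbed by `2^{-|α|}`.
    have h2 : ((α i + 1 : ℕ) : ℝ) ≤ 2 ^ α.degree := by
      have h3 := Finsupp.le_degree i α
      have h4 : α.degree + 1 ≤ 2 ^ α.degree := Nat.lt_two_pow_self
      exact_mod_cast (by omega : α i + 1 ≤ 2 ^ α.degree)
    calc ‖mon ζ α‖ * ((α i + 1 : ℕ) : ℝ) ≤ (1 / 2) ^ α.degree * 2 ^ α.degree := by gcongr
      _ = 1 := by rw [← mul_pow]; norm_num
  · rw [norm_zero, mul_zero]; exact norm_nonneg _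

end Derivative

section Symbol

variable {T : ℝ} {l : ℕ} [hT : Fact (0 < T)] [hl : Fact (1 ≤ l)]

/-- The operator multiplying the `k`-th Fourier coefficient of the coefficient of `X^α` by
`b α k`. -/
noncomputable def symb (b : (ι →₀ ℕ) → ℤ → ℂ) (f : PowAlg ι (SobAlg T l)) :
    PowAlg ι (SobAlg T l) :=
  diag (fun α => SobAlg.multiplier (b α)) f

lemma coef_symb' {b : (ι →₀ ℕ) → ℤ → ℂ} {K : ℝ} (hb : ∀ α k, ‖b α k‖ ≤ K)
    (f : PowAlg ι (SobAlg T l)) (α : ι →₀ ℕ) :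
    (symb b f).coef α = SobAlg.multiplier (b α) (f.coef α) :=
  coef_diag (fun α h => SobAlg.norm_multiplier_le (hb α) h) f α

lemma coef_symb {b : (ι →₀ ℕ) → ℤ → ℂ} {K : ℝ} (hb : ∀ α k, ‖b α k‖ ≤ K)
    (f : PowAlg ι (SobAlg T l)) (α : ι →₀ ℕ) (k : ℤ) :
    ((symb b f).coef α).coef k = b α k * (f.coef α).coef k := by
  rw [coef_symb' hb, SobAlg.coef_multiplier (hb α)]

lemma norm_symb_le {b : (ι →₀ ℕ) → ℤ → ℂ} {K : ℝ} (hb : ∀ α k, ‖b α k‖ ≤ K)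
    (f : PowAlg ι (SobAlg T l)) : ‖symb b f‖ ≤ K * ‖f‖ :=
  norm_diag_le (fun α h => SobAlg.norm_multiplier_le (hb α) h) f

lemma symb_sub {b : (ι →₀ ℕ) → ℤ → ℂ} {K : ℝ} (hb : ∀ α k, ‖b α k‖ ≤ K)
    (f g : PowAlg ι (SobAlg T l)) : symb b (f - g) = symb b f - symb b g := by
  have hsub : ∀ (x y : SobAlg T l) k, (x - y).coef k = x.coef k - y.coef k := fun x y k =>
    sub_div _ _ _
  ext α k
  rw [coef_symb hb, coef_sub, coef_sub, hsub, hsub, coef_symb hb, coef_symb hb, mul_sub]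

/-! ### Complex conjugation: a permutation `σ` pairs the variables with their conjugates -/

/-- The permutation of multi-indices induced by `σ`. -/
noncomputable def permIdx (σ : Equiv.Perm ι) : (ι →₀ ℕ) ≃+ (ι →₀ ℕ) := Finsupp.domCongr σ.symm

omit [DecidableEq ι] in
lemma permIdx_apply (σ : Equiv.Perm ι) (α : ι →₀ ℕ) (i : ι) : permIdx σ α i = α (σ i) := rfl

omit [DecidableEq ι] in
lemma degree_permIdx [Fintype ι] (σ : Equiv.Perm ι) (α : ι →₀ ℕ) :
    (permIdx σ α).degree = α.degree := by
  simp only [Finsupp.degree_eq_sum, permIdx_apply]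
  exact Equiv.sum_comp σ α

lemma permIdx_single (σ : Equiv.Perm ι) (i : ι) :
    permIdx σ (Finsupp.single (σ i) 1) = Finsupp.single i 1 := by
  ext j
  simp [permIdx_apply, Finsupp.single_apply]

/-- The power series of the complex conjugate function, where the conjugate of the variable `X_i` is
the variable `X_{σ i}`. -/
noncomputable def conj (σ : Equiv.Perm ι) (f : PowAlg ι (SobAlg T l)) : PowAlg ι (SobAlg T l) :=
  ofCoef (fun α => (f.coef (permIdx σ α)).conj) (by
    simp only [SobAlg.norm_conj]
    exact ((permIdx σ).toEquiv.summable_iff (f := fun α => ‖f.coef α‖)).2 f.hasSum_norm.summable)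

lemma coef_conj (σ : Equiv.Perm ι) (f : PowAlg ι (SobAlg T l)) (α : ι →₀ ℕ) :
    (conj σ f).coef α = (f.coef (permIdx σ α)).conj := rfl

lemma norm_conj (σ : Equiv.Perm ι) (f : PowAlg ι (SobAlg T l)) : ‖conj σ f‖ = ‖f‖ := by
  have h := ((permIdx σ).toEquiv.hasSum_iff (f := fun α => ‖f.coef α‖)).2 f.hasSum_norm
  refine (conj σ f).hasSum_norm.unique (h.congr_fun fun α => ?_)
  rw [coef_conj, SobAlg.norm_conj]; rfl

lemma conj_monomial (σ : Equiv.Perm ι) (α : ι →₀ ℕ) (h : SobAlg T l) :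
    conj σ (monomial (permIdx σ α) h) = monomial α h.conj := by
  ext1 β
  rw [coef_conj, coef_monomial, coef_monomial]
  simp only [(permIdx σ).injective.eq_iff]
  split_ifs
  · rfl
  · exact map_zero SobAlg.conjHom

/-- Complex conjugation as a ring homomorphism. -/
noncomputable def conjHom (σ : Equiv.Perm ι) :
    PowAlg ι (SobAlg T l) →+* PowAlg ι (SobAlg T l) where
  toFun := conj σ
  map_one' := by
    have h := conj_monomial (T := T) (l := l) σ 0 1
    rw [map_zero] at h
    have h1 : (1 : SobAlg T l).conj = 1 := map_one SobAlg.conjHom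
    rw [h1] at h
    exact h
  map_mul' f g := by
    ext1 α
    rw [coef_conj, coef_mul, coef_mul]
    refine (map_sum SobAlg.conjHom _ _).trans ?_
    refine (Finset.sum_equiv ((permIdx σ).toEquiv.prodCongr (permIdx σ).toEquiv)
      (fun p => ?_) fun p _ => ?_).symm
    · rw [Finset.HasAntidiagonal.mem_antidiagonal, Finset.HasAntidiagonal.mem_antidiagonal]
      show _ ↔ permIdx σ p.1 + permIdx σ p.2 = _
      rw [← map_add, (permIdx σ).injective.eq_iff]
    · rw [coef_conj, coef_conj]
      exact (map_mul SobAlg.conjHom _ _).symm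
  map_zero' := ext fun α => map_zero SobAlg.conjHom
  map_add' f g := ext fun α => map_add SobAlg.conjHom _ _

lemma conjHom_apply (σ : Equiv.Perm ι) (f : PowAlg ι (SobAlg T l)) :
    conjHom σ f = conj σ f := rfl

lemma continuous_conjHom (σ : Equiv.Perm ι) :
    Continuous (conjHom σ : PowAlg ι (SobAlg T l) → PowAlg ι (SobAlg T l)) :=
  AddMonoidHomClass.continuous_of_bound (conjHom σ : PowAlg ι (SobAlg T l) →+* _) 1 fun f => by
    rw [conjHom_apply, norm_conj, one_mul]

lemma conj_C (σ : Equiv.Perm ι) (h : SobAlg T l) :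
    conj σ (C h : PowAlg ι (SobAlg T l)) = C h.conj := by
  have := conj_monomial σ 0 h
  rwa [map_zero] at this

lemma conj_X (σ : Equiv.Perm ι) (i : ι) :
    conj σ (X i : PowAlg ι (SobAlg T l)) = X (σ i) := by
  have := conj_monomial (T := T) (l := l) σ (Finsupp.single (σ i) 1) 1
  have h1 : (1 : SobAlg T l).conj = 1 := map_one SobAlg.conjHom
  rwa [permIdx_single, h1] at this

lemma conj_smul (σ : Equiv.Perm ι) (c : ℂ) (f : PowAlg ι (SobAlg T l)) :
    conj σ (c • f) = (starRingEnd ℂ) c • conj σ f := by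
  ext α k
  rw [coef_conj, coef_smul, coef_smul, coef_conj, SobAlg.coef_conj, SobAlg.coef_smul,
    SobAlg.coef_smul, SobAlg.coef_conj, map_mul]

lemma conj_symb (σ : Equiv.Perm ι) {b : (ι →₀ ℕ) → ℤ → ℂ} {K : ℝ} (hb : ∀ α k, ‖b α k‖ ≤ K)
    (hσ : ∀ α k, b α k = (starRingEnd ℂ) (b (permIdx σ α) (-k)))
    (f : PowAlg ι (SobAlg T l)) : conj σ (symb b f) = symb b (conj σ f) := by
  ext1 α
  rw [coef_conj, coef_symb' hb, coef_symb' hb, coef_conj]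
  exact SobAlg.conj_multiplier (hb _) (hσ α) _

lemma conj_pderiv [Fintype ι] (σ : Equiv.Perm ι) (p : ℕ) (i : ι) (f : PowAlg ι (SobAlg T l)) :
    conj σ (pderiv p i f) = pderiv p (σ i) (conj σ f) := by
  ext1 α
  rw [coef_conj, coef_pderiv, coef_pderiv, degree_permIdx, permIdx_apply]
  split_ifs
  · rw [coef_conj, map_add, permIdx_single]
    ext k
    rw [SobAlg.coef_conj, SobAlg.coef_smul, SobAlg.coef_smul, SobAlg.coef_conj, map_mul,
      Complex.conj_natCast]
  · exact map_zero SobAlg.conjHom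

lemma eval_ev_conj [Fintype ι] (σ : Equiv.Perm ι) {ζ : ι → ℂ} (hζ : ∀ i, ‖ζ i‖ ≤ 1)
    (hσ : ∀ i, ζ (σ i) = (starRingEnd ℂ) (ζ i)) (t : AddCircle T) (f : PowAlg ι (SobAlg T l)) :
    SobAlg.eval t (ev ζ (conj σ f)) = (starRingEnd ℂ) (SobAlg.eval t (ev ζ f)) := by
  have key : ∀ g : PowAlg ι (SobAlg T l),
      HasSum (fun α => mon ζ α * SobAlg.eval t (g.coef α)) (SobAlg.eval t (ev ζ g)) := by
    intro g
    have := (hasSum_ev hζ g).map (SobAlg.eval t) (SobAlg.continuous_eval t)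
    refine this.congr_fun fun α => ?_
    rw [Function.comp_apply, SobAlg.eval_smul]
  have h1 := Complex.hasSum_conj'.2 (key f)
  have h2 := ((permIdx σ).toEquiv.hasSum_iff).2 h1
  refine (key (conj σ f)).unique (h2.congr_fun fun α => ?_)
  rw [coef_conj, SobAlg.eval_conj]
  show _ = (starRingEnd ℂ) (mon ζ (permIdx σ α) * SobAlg.eval t (f.coef (permIdx σ α)))
  rw [map_mul]
  congr 1
  simp only [mon, map_prod, map_pow, permIdx_apply, ← hσ]
  exact (Equiv.prod_comp σ fun i => ζ i ^ α i).symm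

end Symbol

end PowAlg
end PowerSeriesOperators

/-! ### Substitution into power series -/

section Substitution

variable {B : Type*} [NormedCommRing B] {m : ℕ}

/-- The homogeneous part of degree `q`, at `u`, of the power series with coefficient `a q J` at the
word `J`. -/
def wordSum (a : (q : ℕ) → (Fin q → Fin m) → B) (u : Fin m → B) (q : ℕ) : B :=
  ∑ J, a q J * ∏ k, u (J k)

/-- The sum at `u` of the power series with coefficient `a q J` at the word `J`. The point `u` has
components in an arbitrary commutative Banach algebra. -/
noncomputable def wordSeries (a : (q : ℕ) → (Fin q → Fin m) → B) (u : Fin m → B) : B :=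
  ∑' q, wordSum a u q

/-- Cauchy estimates for a power series without terms of degree `0` and `1`. -/
structure WordBound (a : (q : ℕ) → (Fin q → Fin m) → B) (c ρ : ℝ) : Prop where
  bound : ∀ q J, ‖a q J‖ ≤ c / ρ ^ q
  zero : ∀ J, a 0 J = 0
  one : ∀ J, a 1 J = 0

lemma norm_mul_prod_le {q : ℕ} (h : B) (x : Fin q → B) {s : ℝ} (hx : ∀ k, ‖x k‖ ≤ s) :
    ‖h * ∏ k, x k‖ ≤ ‖h‖ * s ^ q := by
  induction q generalizing h with
  | zero => simp
  | succ q ih =>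
    have hs : 0 ≤ s := (norm_nonneg _).trans (hx 0)
    rw [Fin.prod_univ_succ, ← mul_assoc]
    calc ‖h * x 0 * ∏ k, x k.succ‖ ≤ ‖h * x 0‖ * s ^ q := ih _ _ fun k => hx k.succ
      _ ≤ (‖h‖ * s) * s ^ q := by
          gcongr
          exact (norm_mul_le _ _).trans (mul_le_mul_of_nonneg_left (hx 0) (norm_nonneg _))
      _ = _ := by ring

lemma norm_mul_prod_sub_le {q : ℕ} (h : B) (x y : Fin q → B) {s d : ℝ} (hx : ∀ k, ‖x k‖ ≤ s)
    (hy : ∀ k, ‖y k‖ ≤ s) (hd : ∀ k, ‖x k - y k‖ ≤ d) :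
    ‖h * ∏ k, x k - h * ∏ k, y k‖ ≤ ‖h‖ * (q * s ^ (q - 1) * d) := by
  induction q generalizing h with
  | zero => simp
  | succ q ih =>
    have hs : 0 ≤ s := (norm_nonneg _).trans (hx 0)
    have hd0 : 0 ≤ d := (norm_nonneg _).trans (hd 0)
    rw [Fin.prod_univ_succ, Fin.prod_univ_succ]
    -- Replace the factors of the product one at a time.
    have e : h * (x 0 * ∏ k, x (Fin.succ k)) - h * (y 0 * ∏ k, y (Fin.succ k)) =
        (h * x 0 * ∏ k, x (Fin.succ k) - h * x 0 * ∏ k, y (Fin.succ k)) +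
          h * (x 0 - y 0) * ∏ k, y (Fin.succ k) := by ring
    rw [e]
    have h1 := ih (h * x 0) (fun k => x k.succ) (fun k => y k.succ) (fun k => hx k.succ)
      (fun k => hy k.succ) (fun k => hd k.succ)
    have h2 := norm_mul_prod_le (h * (x 0 - y 0)) (fun k => y k.succ) (fun k => hy k.succ)
    have h3 : ‖h * x 0‖ ≤ ‖h‖ * s :=
      (norm_mul_le _ _).trans (mul_le_mul_of_nonneg_left (hx 0) (norm_nonneg _))
    have h4 : ‖h * (x 0 - y 0)‖ ≤ ‖h‖ * d :=
      (norm_mul_le _ _).trans (mul_le_mul_of_nonneg_left (hd 0) (norm_nonneg _))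
    have h5 : s * (q * s ^ (q - 1)) = q * s ^ q := by
      rcases q with _ | q
      · simp
      · simp only [Nat.add_sub_cancel, pow_succ]; ring
    calc _ ≤ ‖h * x 0‖ * (q * s ^ (q - 1) * d) + ‖h * (x 0 - y 0)‖ * s ^ q :=
          (norm_add_le _ _).trans (add_le_add h1 h2)
      _ ≤ (‖h‖ * s) * (q * s ^ (q - 1) * d) + (‖h‖ * d) * s ^ q := by gcongr
      _ = ‖h‖ * ((s * (q * s ^ (q - 1))) * d + s ^ q * d) := by ring
      _ = _ := by rw [h5, Nat.add_sub_cancel]; push_cast; ring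

variable {a : (q : ℕ) → (Fin q → Fin m) → B} {c ρ : ℝ}

lemma WordBound.const_nonneg (ha : WordBound a c ρ) : 0 ≤ c := by
  have := (norm_nonneg _).trans (ha.bound 0 (fun k => Fin.elim0 k))
  simpa using this

lemma WordBound.wordSum_zero (ha : WordBound a c ρ) (u : Fin m → B) : wordSum a u 0 = 0 :=
  Finset.sum_eq_zero fun J _ => by rw [ha.zero, zero_mul]

lemma WordBound.wordSum_one (ha : WordBound a c ρ) (u : Fin m → B) : wordSum a u 1 = 0 :=
  Finset.sum_eq_zero fun J _ => by rw [ha.one, zero_mul]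

lemma sum_words_le {q : ℕ} {F : (Fin q → Fin m) → ℝ} {K : ℝ} (h : ∀ J, F J ≤ K) :
    ∑ J, F J ≤ (m : ℝ) ^ q * K := by
  refine (Finset.sum_le_card_nsmul _ _ K fun J _ => h J).trans (le_of_eq ?_)
  simp

lemma WordBound.norm_wordSum_le (ha : WordBound a c ρ) (hρ : 0 < ρ) {u : Fin m → B} {s : ℝ}
    (hs0 : 0 ≤ s) (hs : 2 * m * s ≤ ρ) (hu : ∀ j, ‖u j‖ ≤ s) (q : ℕ) :
    ‖wordSum a u q‖ ≤ c * (1 / 2) ^ q := by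
  have hc := ha.const_nonneg
  have h1 : ‖wordSum a u q‖ ≤ (m : ℝ) ^ q * (c / ρ ^ q * s ^ q) := by
    refine (norm_sum_le _ _).trans (sum_words_le fun J => ?_)
    refine (norm_mul_prod_le _ _ fun k => hu (J k)).trans ?_
    gcongr
    exact ha.bound q J
  have h2 : m * s / ρ ≤ 1 / 2 := by
    rw [div_le_iff₀ hρ]; linarith
  calc _ ≤ _ := h1
    _ = c * (m * s / ρ) ^ q := by rw [div_pow, mul_pow]; ring
    _ ≤ _ := by gcongr

/-- The Lipschitz constant of a power series near the origin. -/
noncomputable def lipConst (m : ℕ) (c ρ : ℝ) : ℝ := 8 * c * (m / ρ) ^ 2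

lemma WordBound.norm_wordSum_sub_le (ha : WordBound a c ρ) (hρ : 0 < ρ) {u v : Fin m → B}
    {s d : ℝ} (hs0 : 0 ≤ s) (hd0 : 0 ≤ d) (hs : 2 * m * s ≤ ρ) (hu : ∀ j, ‖u j‖ ≤ s)
    (hv : ∀ j, ‖v j‖ ≤ s) (hd : ∀ j, ‖u j - v j‖ ≤ d) (q : ℕ) :
    ‖wordSum a u q - wordSum a v q‖ ≤ 4 * c * (m / ρ) ^ 2 * s * d * (q * (1 / 2) ^ q) := by
  have hc := ha.const_nonneg
  rcases q with _ | _ | q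
  · simp [ha.wordSum_zero]
  · rw [ha.wordSum_one, ha.wordSum_one, sub_zero, norm_zero]; positivity
  · have h1 : ‖wordSum a u (q + 2) - wordSum a v (q + 2)‖ ≤ (m : ℝ) ^ (q + 2) *
        (c / ρ ^ (q + 2) * (((q + 2 : ℕ) : ℝ) * s ^ (q + 1) * d)) := by
      rw [wordSum, wordSum, ← Finset.sum_sub_distrib]
      refine (norm_sum_le _ _).trans (sum_words_le fun J => ?_)
      exact (norm_mul_prod_sub_le _ _ _ (fun k => hu (J k)) (fun k => hv (J k))
        fun k => hd (J k)).trans (mul_le_mul_of_nonneg_right (ha.bound _ J) (by positivity))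
    have h2 : m * s / ρ ≤ 1 / 2 := by
      rw [div_le_iff₀ hρ]; linarith
    calc _ ≤ _ := h1
      -- Two powers of `m / ρ` and one of `s` are split off; the rest is geometric with ratio
      -- `m s / ρ ≤ 1 / 2`.
      _ = c * (m / ρ) ^ 2 * s * d * (((q + 2 : ℕ) : ℝ) * (m * s / ρ) ^ q) := by
          simp only [div_eq_mul_inv, mul_pow, inv_pow]; ring
      _ ≤ c * (m / ρ) ^ 2 * s * d * (((q + 2 : ℕ) : ℝ) * (1 / 2) ^ q) := by gcongr
      _ = _ := by push_cast; ring

variable [CompleteSpace B]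

lemma WordBound.hasSum (ha : WordBound a c ρ) (hρ : 0 < ρ) {u : Fin m → B} {s : ℝ}
    (hs0 : 0 ≤ s) (hs : 2 * m * s ≤ ρ) (hu : ∀ j, ‖u j‖ ≤ s) :
    HasSum (wordSum a u) (wordSeries a u) :=
  (Summable.of_norm_bounded ((summable_geometric_two).mul_left c)
    (ha.norm_wordSum_le hρ hs0 hs hu)).hasSum

lemma WordBound.norm_wordSeries_sub_le (ha : WordBound a c ρ) (hρ : 0 < ρ) {u v : Fin m → B}
    {s d : ℝ} (hs0 : 0 ≤ s) (hd0 : 0 ≤ d) (hs : 2 * m * s ≤ ρ) (hu : ∀ j, ‖u j‖ ≤ s)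
    (hv : ∀ j, ‖v j‖ ≤ s) (hd : ∀ j, ‖u j - v j‖ ≤ d) :
    ‖wordSeries a u - wordSeries a v‖ ≤ lipConst m c ρ * s * d := by
  have h := (ha.hasSum hρ hs0 hs hu).sub (ha.hasSum hρ hs0 hs hv)
  have hg : HasSum (fun q : ℕ => (q : ℝ) * (1 / 2) ^ q) 2 := by
    have := hasSum_coe_mul_geometric_of_norm_lt_one (r := (1 / 2 : ℝ)) (by norm_num)
    norm_num at this ⊢
    exact this
  have := h.norm_le_of_bounded (hg.mul_left _) (ha.norm_wordSum_sub_le hρ hs0 hd0 hs hu hv hd)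
  refine this.trans (le_of_eq ?_)
  rw [lipConst]; ring

lemma WordBound.wordSeries_zero (ha : WordBound a c ρ) : wordSeries a (0 : Fin m → B) = 0 := by
  have : ∀ q, wordSum a (0 : Fin m → B) q = 0 := by
    intro q
    rcases q with _ | q
    · exact ha.wordSum_zero _
    · refine Finset.sum_eq_zero fun J _ => ?_
      rw [Fin.prod_univ_succ, Pi.zero_apply, zero_mul, mul_zero]
  rw [wordSeries]
  simp [this]

lemma WordBound.norm_wordSeries_le (ha : WordBound a c ρ) (hρ : 0 < ρ) {u : Fin m → B}
    {s : ℝ} (hs0 : 0 ≤ s) (hs : 2 * m * s ≤ ρ) (hu : ∀ j, ‖u j‖ ≤ s) :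
    ‖wordSeries a u‖ ≤ lipConst m c ρ * s ^ 2 := by
  have := ha.norm_wordSeries_sub_le hρ (v := 0) hs0 hs0 hs hu (fun j => by simpa using hs0)
    (fun j => by simpa using hu j)
  rw [ha.wordSeries_zero, sub_zero] at this
  exact this.trans (le_of_eq (by ring))

/-- Power series commute with continuous homomorphisms. -/
lemma WordBound.map_wordSeries (ha : WordBound a c ρ) (hρ : 0 < ρ) {u : Fin m → B}
    {s : ℝ} (hs0 : 0 ≤ s) (hs : 2 * m * s ≤ ρ) (hu : ∀ j, ‖u j‖ ≤ s)
    {B' : Type*} [NormedCommRing B'] (φ : B →+* B') (hφ : Continuous φ) :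
    φ (wordSeries a u) = wordSeries (fun q J => φ (a q J)) fun j => φ (u j) := by
  have h := (ha.hasSum hρ hs0 hs hu).map φ hφ
  rw [← h.tsum_eq]
  refine tsum_congr fun q => ?_
  simp only [Function.comp_apply, wordSum, map_sum, map_mul, map_prod]

lemma WordBound.comp_of_norm_le {a : (q : ℕ) → (Fin q → Fin m) → B} (ha : WordBound a c ρ)
    {B' : Type*} [NormedCommRing B'] (φ : B →+* B') (hφ : ∀ x, ‖φ x‖ ≤ ‖x‖) :
    WordBound (fun q J => φ (a q J)) c ρ where
  bound q J := (hφ _).trans (ha.bound q J)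
  zero J := by rw [ha.zero, map_zero]
  one J := by rw [ha.one, map_zero]

lemma PowAlg.OrderGe.wordSeries {ι H : Type*} [DecidableEq ι] [NormedCommRing H] [CompleteSpace H]
    {a : (q : ℕ) → (Fin q → Fin m) → PowAlg ι H} (ha : WordBound a c ρ) (hρ : 0 < ρ)
    {u : Fin m → PowAlg ι H} {s : ℝ} (hs0 : 0 ≤ s) (hs : 2 * m * s ≤ ρ) (hu : ∀ j, ‖u j‖ ≤ s)
    (h1 : ∀ j, PowAlg.OrderGe 1 (u j)) : PowAlg.OrderGe 2 (wordSeries a u) := by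
  refine PowAlg.OrderGe.of_hasSum (ha.hasSum hρ hs0 hs hu) fun q => ?_
  -- Only words of length at least two contribute, and a product of `q` factors of order one has
  -- order at least `q`.
  rcases q with _ | _ | q
  · rw [ha.wordSum_zero]; exact fun _ _ => rfl
  · rw [ha.wordSum_one]; exact fun _ _ => rfl
  · refine PowAlg.OrderGe.sum fun J _ => ?_
    have h2 := PowAlg.OrderGe.prod (s := (Finset.univ : Finset (Fin (q + 2))))
      (f := fun k => u (J k)) fun k _ => h1 (J k)
    rw [Finset.card_univ, Fintype.card_fin] at h2
    exact ((PowAlg.orderGe_zero (a (q + 2) J)).mul h2).mono (by omega)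

end Substitution

/-! ### Expansion of an analytic map in Sobolev coefficients -/

section AnalyticExpansion

variable {T : ℝ} [hT : Fact (0 < T)] {m l : ℕ} [hl : Fact (1 ≤ l)]

/-- If the analytic map vanishes to second order at the origin, the terms of degree `0` and `1` of its
expansion vanish. -/
lemma expansion_vanish {Ω : Set (EuclideanSpace ℝ (Fin m))} (hΩ : Ω ∈ 𝓝 0)
    {f : EuclideanSpace ℝ (Fin m) → EuclideanSpace ℝ (Fin m)}
    {A : (q : ℕ) → MultilinearMap ℝ (fun _ : Fin q => EuclideanSpace ℝ (Fin m))
      (EuclideanSpace ℝ (Fin m))}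
    (hA : ∀ u ∈ Ω, HasSum (fun q => A q fun _ => u) (f u)) (h0 : f 0 = 0)
    (h1 : HasFDerivAt f (0 : EuclideanSpace ℝ (Fin m) →L[ℝ] EuclideanSpace ℝ (Fin m)) 0) :
    (∀ x, A 0 x = 0) ∧ ∀ x, A 1 x = 0 := by
  constructor
  · intro x
    have h := hA 0 (mem_of_mem_nhds hΩ)
    have h2 : HasSum (fun q => A q fun _ => (0 : EuclideanSpace ℝ (Fin m))) (A 0 x) := by
      have : (A 0 fun _ => (0 : EuclideanSpace ℝ (Fin m))) = A 0 x := by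
        congr 1; exact Subsingleton.elim _ _
      rw [← this]
      refine hasSum_single 0 fun q hq => ?_
      obtain ⟨q, rfl⟩ := Nat.exists_eq_succ_of_ne_zero hq
      exact (A (q + 1)).map_coord_zero 0 rfl
    rw [h2.unique h, h0]
  · intro x
    have hx : x = fun _ => x 0 := by
      funext k; rw [Subsingleton.elim k 0]
    -- The linear term is the derivative at `0` of `f` along the line through `e`, since the
    -- expansion restricted to that line is a power series in one variable.
    set e := x 0 with he
    let p : FormalMultilinearSeries ℝ ℝ (EuclideanSpace ℝ (Fin m)) := fun q =>
      ContinuousMultilinearMap.mkPiRing ℝ (Fin q) (A q fun _ => e)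
    have hp : HasFPowerSeriesAt (fun s : ℝ => f (s • e)) p 0 := by
      rw [hasFPowerSeriesAt_iff]
      have hc : Filter.Tendsto (fun s : ℝ => s • e) (𝓝 0) (𝓝 0) := by
        have : Continuous fun s : ℝ => s • e := by fun_prop
        simpa using this.tendsto 0
      filter_upwards [hc hΩ] with s hs
      have h := hA (s • e) hs
      rw [zero_add]
      refine h.congr_fun fun q => ?_
      simp only [FormalMultilinearSeries.coeff, p, ContinuousMultilinearMap.mkPiRing_apply, Pi.one_apply, Finset.prod_const_one,
        one_smul]
      have := (A q).map_smul_univ (fun _ => s) (fun _ => e)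
      simpa using this.symm
    have hd : HasDerivAt (fun s : ℝ => f (s • e)) 0 0 := by
      have hs : HasDerivAt (fun s : ℝ => s • e) e 0 := by
        simpa using (hasDerivAt_id (0 : ℝ)).smul_const e
      have h1' : HasFDerivAt f (0 : EuclideanSpace ℝ (Fin m) →L[ℝ] EuclideanSpace ℝ (Fin m))
          ((0 : ℝ) • e) := by simpa using h1
      exact (h1'.comp_hasDerivAt (0 : ℝ) hs).congr_deriv (by simp)
    have := hp.hasDerivAt.unique hd
    rw [hx]
    simpa [p] using this

/-- The expansion of an analytic map into words, with coefficients in the algebra `H^l`. -/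
lemma exists_wordSeries {c ρ : ℝ} {Ω : Set (EuclideanSpace ℝ (Fin m))} (hΩ : Ω ∈ 𝓝 0)
    {V : EuclideanSpace ℝ (Fin m) → AddCircle T → EuclideanSpace ℝ (Fin m)}
    (hV : IsAnalyticWith l c ρ Ω V) (h0 : ∀ t, V 0 t = 0)
    (h1 : ∀ t, HasFDerivAt (fun u => V u t)
      (0 : EuclideanSpace ℝ (Fin m) →L[ℝ] EuclideanSpace ℝ (Fin m)) 0) :
    ∃ a : Fin m → (q : ℕ) → (Fin q → Fin m) → SobAlg T l,
      (∀ i, WordBound (a i) (sobConst l * c) ρ) ∧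
      (∀ i q J, (a i q J).conj = a i q J) ∧
      ∀ u ∈ Ω, ∀ t i, ((V u t i : ℝ) : ℂ) =
        wordSeries (fun q J => SobAlg.eval t (a i q J)) fun j => ((u j : ℝ) : ℂ) := by
  obtain ⟨A, -, hb, hs⟩ := hV
  have hvan := fun t => expansion_vanish hΩ (A := fun q => A q t) (f := fun u => V u t)
    (fun u hu => hs u hu t) (h0 t) (h1 t)
  let e : Fin m → EuclideanSpace ℝ (Fin m) := fun j => EuclideanSpace.single j 1
  have hex := fun (i : Fin m) (q : ℕ) (J : Fin q → Fin m) =>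
    SobAlg.exists_of_memSobolev (hb q fun k => e (J k)).1 i
  choose a ha hna using hex
  -- The coefficient at a word is the multilinear form on the corresponding basis vectors.
  refine ⟨a, fun i => ⟨fun q J => ?_, fun J => ?_, fun J => ?_⟩, fun i q J => ?_, ?_⟩
  · refine (hna i q J).trans ?_
    have := (hb q fun k => e (J k)).2
    have hn : ∀ j, ‖e j‖ = 1 := fun j => by simp [e]
    simp only [hn, Finset.prod_const_one, mul_one] at this
    rw [mul_div_assoc]
    exact mul_le_mul_of_nonneg_left this (sobConst_pos l).le
  · refine SobAlg.ext_eval fun t => ?_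
    rw [ha, (hvan t).1, map_zero]; simp
  · refine SobAlg.ext_eval fun t => ?_
    rw [ha, (hvan t).2, map_zero]; simp
  · refine SobAlg.ext_eval fun t => ?_
    rw [SobAlg.eval_conj, ha, Complex.conj_ofReal]
  · intro u hu t i
    have h := hs u hu t
    have hi : HasSum (fun q => (((A q t fun _ => u) i : ℝ) : ℂ)) ((V u t i : ℝ) : ℂ) :=
      Complex.hasSum_ofReal.2 (h.mapL (EuclideanSpace.proj (𝕜 := ℝ) i))
    rw [wordSeries, ← hi.tsum_eq]
    refine tsum_congr fun q => ?_
    -- Expand the multilinear form in the components of `u`.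
    have hu' : u = ∑ j, u j • e j := by
      ext k
      simp [e, Pi.single_apply]
    have hexp : (A q t fun _ => u) = ∑ J : Fin q → Fin m, (∏ k, u (J k)) • A q t fun k => e (J k) := by
      conv_lhs => rw [hu']
      rw [MultilinearMap.map_sum]
      exact Finset.sum_congr rfl fun J _ => (A q t).map_smul_univ _ _
    rw [hexp, wordSum]
    simp only [ha]
    simp only [WithLp.ofLp_sum, Finset.sum_apply, PiLp.smul_apply, smul_eq_mul]
    push_cast
    exact Finset.sum_congr rfl fun J _ => mul_comm _ _

end AnalyticExpansion

/-! ### Complex eigencoordinates of a real operator -/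

section EigenCoordinates

variable {W : Type*} [AddCommGroup W] [Module ℝ W]

/-- A real operator that is diagonalizable over `ℂ` has complex linear coordinates in which it is
diagonal, and its spectrum is invariant under complex conjugation. -/
lemma exists_eigenCoordinates {f : W →ₗ[ℝ] W} {lam : Fin (finrank ℝ W) → ℂ}
    (h : IsDiagonalizedBy f lam) :
    ∃ x : Fin (finrank ℝ W) → W →ₗ[ℝ] ℂ, (∀ i u, x i (f u) = lam i * x i u) ∧
      (∀ g : W →ₗ[ℝ] ℂ, ∃ v : Fin (finrank ℝ W) → ℂ, ∀ u, g u = ∑ i, v i * x i u) ∧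
      ∀ i, ∃ j, lam j = (starRingEnd ℂ) (lam i) := by
  obtain ⟨v, hv⟩ := h
  -- The coordinates are those of the complexification with respect to an eigenbasis `v`, restricted
  -- to `W`.
  let x : Fin (finrank ℝ W) → W →ₗ[ℝ] ℂ := fun i =>
    ((v.coord i).restrictScalars ℝ).comp (TensorProduct.mk ℝ ℂ W 1)
  have hx : ∀ i u, x i u = v.repr (1 ⊗ₜ u) i := fun i u => rfl
  have hcoord : ∀ i, (v.coord i).comp (f.baseChange ℂ) = lam i • v.coord i := by
    intro i
    refine v.ext fun j => ?_
    simp only [LinearMap.comp_apply, hv, map_smul, LinearMap.smul_apply, Basis.coord_apply,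
      Basis.repr_self, smul_eq_mul, Finsupp.single_apply]
    split_ifs with hij
    · rw [hij]
    · simp
  refine ⟨x, fun i u => ?_, fun g => ?_, fun i => ?_⟩
  · have := LinearMap.congr_fun (hcoord i) (1 ⊗ₜ u)
    simpa [hx] using this
  · refine ⟨fun i => g.liftBaseChange ℂ (v i), fun u => ?_⟩
    have h1 : g u = g.liftBaseChange ℂ (1 ⊗ₜ u) := by
      rw [LinearMap.liftBaseChange_tmul, one_smul]
    rw [h1]
    conv_lhs => rw [← v.sum_repr (1 ⊗ₜ u)]
    rw [map_sum]
    exact Finset.sum_congr rfl fun i _ => by rw [map_smul, smul_eq_mul, mul_comm, hx]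
  -- The conjugate of the coordinate `x i` is an eigenvector of the transpose for the conjugate
  -- eigenvalue. If that number were not in the spectrum, the conjugate would vanish on every vector
  -- of the eigenbasis, so that `x i = 0`.
  · let g : W →ₗ[ℝ] ℂ := Complex.conjAe.toLinearMap.comp (x i)
    have hg : ∀ u, g u = (starRingEnd ℂ) (x i u) := fun u => rfl
    have hG : ∀ y, g.liftBaseChange ℂ (f.baseChange ℂ y) =
        (starRingEnd ℂ) (lam i) * g.liftBaseChange ℂ y := by
      intro y
      induction y using TensorProduct.induction_on with
      | zero => simp
      | tmul a w =>
        have h2 := LinearMap.congr_fun (hcoord i) (1 ⊗ₜ w)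
        have h3 : x i (f w) = lam i * x i w := by simpa [hx] using h2
        rw [LinearMap.baseChange_tmul, LinearMap.liftBaseChange_tmul,
          LinearMap.liftBaseChange_tmul, hg, hg, h3, map_mul, smul_eq_mul, smul_eq_mul]
        ring
      | add y z hy hz => rw [map_add, map_add, map_add, hy, hz, mul_add]
    by_contra hcon
    push Not at hcon
    have hzero : ∀ j, g.liftBaseChange ℂ (v j) = 0 := by
      intro j
      have h2 := hG (v j)
      rw [hv, map_smul, smul_eq_mul] at h2
      by_contra h0
      exact hcon j (mul_right_cancel₀ h0 h2)
    have hG0 : g.liftBaseChange ℂ = 0 := v.ext fun j => by rw [hzero]; rfl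
    have hx0 : ∀ u, x i u = 0 := by
      intro u
      have h2 := LinearMap.congr_fun hG0 (1 ⊗ₜ u)
      rw [LinearMap.liftBaseChange_tmul, one_smul, hg] at h2
      simpa using h2
    have hc0 : v.coord i = 0 := by
      refine LinearMap.ext fun y => ?_
      induction y using TensorProduct.induction_on with
      | zero => simp
      | tmul a w =>
        have h2 : a ⊗ₜ[ℝ] w = a • ((1 : ℂ) ⊗ₜ[ℝ] w) := by
          rw [TensorProduct.smul_tmul', smul_eq_mul, mul_one]
        rw [h2, map_smul]
        have h3 : v.coord i (1 ⊗ₜ w) = 0 := hx0 w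
        rw [h3]; simp
      | add y z hy hz => rw [map_add, hy, hz]; simp
    have := LinearMap.congr_fun hc0 (v i)
    simp at this

end EigenCoordinates

/-! ### The resolvent and the size of the Jordan blocks -/

section Resolvent

variable {W : Type*} [AddCommGroup W] [Module ℝ W] [FiniteDimensional ℝ W]

/-- Every generalized eigenvector is killed by the power `maxJordanBlockSize`. -/
lemma pow_maxJordanBlockSize_apply (f : W →ₗ[ℝ] W) {μ : ℂ} {x : ℂ ⊗[ℝ] W}
    (hx : x ∈ End.maxGenEigenspace (f.baseChange ℂ) μ) :
    ((f.baseChange ℂ - algebraMap ℂ (End ℂ (ℂ ⊗[ℝ] W)) μ) ^ maxJordanBlockSize f) x = 0 ∧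
      (x ≠ 0 → End.HasEigenvalue (f.baseChange ℂ) μ) := by
  set N : End ℂ (ℂ ⊗[ℝ] W) := f.baseChange ℂ - algebraMap ℂ (End ℂ (ℂ ⊗[ℝ] W)) μ with hN
  have hN' : (f.baseChange ℂ : End ℂ (ℂ ⊗[ℝ] W)) - μ • 1 = N := by
    rw [hN, Algebra.algebraMap_eq_smul_one]
  by_cases hx0 : x = 0
  · exact ⟨by rw [hx0, map_zero], fun h => absurd hx0 h⟩
  rw [End.mem_maxGenEigenspace, hN'] at hx
  classical
  have hfind := Nat.find_spec hx
  have hmin := fun {n} => Nat.find_min (H := hx) (m := n)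
  have hpos : Nat.find hx ≠ 0 := by
    intro h0
    rw [h0, pow_zero] at hfind
    exact hx0 hfind
  -- With the least exponent `k + 1` that kills `x`, the chain from `x` to `N^k x` is one of those
  -- that define `maxJordanBlockSize`, and `N^k x` is an eigenvector.
  obtain ⟨k, hk⟩ := Nat.exists_eq_succ_of_ne_zero hpos
  have h1 : (N ^ k) x ≠ 0 := hmin (by omega)
  have h2 : (N ^ (k + 1)) x = 0 := by rwa [hk] at hfind
  -- The supremum in `ℕ` is meaningful only because chains have length at most `dim W`.
  have hbdd : BddAbove {n : ℕ | ∃ (μ : ℂ) (x : ℂ ⊗[ℝ] W) (k : ℕ), n = k + 1 ∧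
      ((f.baseChange ℂ - algebraMap ℂ (End ℂ (ℂ ⊗[ℝ] W)) μ) ^ k) x ≠ 0 ∧
      ((f.baseChange ℂ - algebraMap ℂ (End ℂ (ℂ ⊗[ℝ] W)) μ) ^ (k + 1)) x = 0} := by
    refine ⟨finrank ℂ (ℂ ⊗[ℝ] W), ?_⟩
    rintro n ⟨μ', y, j, rfl, hj1, hj2⟩
    by_contra hlt
    apply hj1
    have h3 : y ∈ End.maxGenEigenspace (f.baseChange ℂ) μ' := by
      rw [End.mem_maxGenEigenspace]
      exact ⟨j + 1, by rwa [← Algebra.algebraMap_eq_smul_one]⟩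
    rw [End.maxGenEigenspace_eq_genEigenspace_finrank, End.mem_genEigenspace_nat,
      LinearMap.mem_ker, ← Algebra.algebraMap_eq_smul_one] at h3
    obtain ⟨i, hi⟩ := Nat.exists_eq_add_of_le (show finrank ℂ (ℂ ⊗[ℝ] W) ≤ j by omega)
    rw [hi, add_comm, pow_add, Module.End.mul_apply, h3, map_zero]
  have hle : k + 1 ≤ maxJordanBlockSize f := le_csSup hbdd ⟨μ, x, k, rfl, h1, h2⟩
  constructor
  · obtain ⟨i, hi⟩ := Nat.exists_eq_add_of_le hle
    rw [hi, add_comm, pow_add, Module.End.mul_apply, h2, map_zero]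
  · intro _
    refine End.hasEigenvalue_of_hasEigenvector (x := (N ^ k) x)
      (End.hasEigenvector_iff.2 ⟨?_, h1⟩)
    rw [End.mem_eigenspace_iff]
    have h3 : N ((N ^ k) x) = 0 := by rw [← Module.End.mul_apply, ← pow_succ', h2]
    rw [hN, LinearMap.sub_apply, Module.algebraMap_end_apply, sub_eq_zero] at h3
    exact h3

/-- The resolvent of a nilpotent perturbation of a scalar is a finite geometric series. -/
lemma sub_geometric_apply {E : Type*} [AddCommGroup E] [Module ℂ E] (N : End ℂ E) {z : ℂ}
    (hz : z ≠ 0) (x : E) (n : ℕ) :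
    z • (∑ j ∈ Finset.range n, (z⁻¹ ^ (j + 1)) • (N ^ j) x) -
      N (∑ j ∈ Finset.range n, (z⁻¹ ^ (j + 1)) • (N ^ j) x) = x - (z⁻¹ ^ n) • (N ^ n) x := by
  induction n with
  | zero => simp
  | succ n ih =>
    rw [Finset.sum_range_succ, smul_add, map_add, add_sub_add_comm, ih, map_smul,
      ← Module.End.mul_apply, ← pow_succ', smul_smul]
    have : z * z⁻¹ ^ (n + 1) = z⁻¹ ^ n := by
      rw [pow_succ, mul_comm, mul_assoc, inv_mul_cancel₀ hz, mul_one]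
    rw [this]
    abel

/-- The matrix of the resolvent `(s - f)⁻¹` in a real basis. -/
noncomputable def resolventMatrix {κ : Type*} [Fintype κ] [DecidableEq κ] (e : Basis κ ℝ W)
    (f : W →ₗ[ℝ] W) (s : ℂ) : Matrix κ κ ℂ :=
  (s • (1 : Matrix κ κ ℂ) - (LinearMap.toMatrix e e f).map (algebraMap ℝ ℂ))⁻¹

/-- The resolvent at distance at least `D⁻¹` from the spectrum is a polynomial in `D` whose degree is
the maximal size of the Jordan blocks. -/
lemma resolventMatrix_bound {κ : Type*} [Fintype κ] [DecidableEq κ] (e : Basis κ ℝ W)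
    (f : W →ₗ[ℝ] W) :
    ∃ K : ℝ, 0 ≤ K ∧ ∀ (s : ℂ) (D : ℝ), 0 ≤ D →
      (∀ μ, End.HasEigenvalue (f.baseChange ℂ) μ → s ≠ μ ∧ ‖s - μ‖⁻¹ ≤ D) →
      (s • (1 : Matrix κ κ ℂ) - (LinearMap.toMatrix e e f).map (algebraMap ℝ ℂ)) *
        resolventMatrix e f s = 1 ∧
      ∀ a b, ‖resolventMatrix e f s a b‖ ≤
        K * ∑ j ∈ Finset.range (maxJordanBlockSize f), D ^ (j + 1) := by
  set F : End ℂ (ℂ ⊗[ℝ] W) := f.baseChange ℂ with hF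
  set ν := maxJordanBlockSize f with hν
  set eC := Algebra.TensorProduct.basis ℂ e with heC
  -- Decompose each basis vector into generalized eigenvectors; on each of them the resolvent is a
  -- geometric series with at most `ν` terms.
  have hdec : ∀ b, ∃ φ : ℂ →₀ (ℂ ⊗[ℝ] W), (∀ μ, φ μ ∈ F.maxGenEigenspace μ) ∧
      (φ.sum fun _ y => y) = eC b := fun b => by
    rw [← Submodule.mem_iSup_iff_exists_finsupp, End.iSup_maxGenEigenspace_eq_top]
    trivial
  choose φ hφ hφs using hdec
  let N : ℂ → End ℂ (ℂ ⊗[ℝ] W) := fun μ => F - algebraMap ℂ (End ℂ (ℂ ⊗[ℝ] W)) μ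
  let K : ℝ := ∑ a, ∑ b, ∑ μ ∈ (φ b).support, ∑ j ∈ Finset.range ν,
    ‖eC.repr ((N μ ^ j) (φ b μ)) a‖
  refine ⟨K, by positivity, fun s D hD hs => ?_⟩
  let y : κ → ℂ ⊗[ℝ] W := fun b => ∑ μ ∈ (φ b).support, ∑ j ∈ Finset.range ν,
    ((s - μ)⁻¹ ^ (j + 1)) • (N μ ^ j) (φ b μ)
  have heig : ∀ b, ∀ μ ∈ (φ b).support, s ≠ μ ∧ ‖s - μ‖⁻¹ ≤ D := fun b μ hμ =>
    hs μ ((pow_maxJordanBlockSize_apply f (hφ b μ)).2 (Finsupp.mem_support_iff.1 hμ))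
  have hy : ∀ b, s • y b - F (y b) = eC b := by
    intro b
    rw [← hφs b, Finsupp.sum, Finset.smul_sum, map_sum, ← Finset.sum_sub_distrib]
    refine Finset.sum_congr rfl fun μ hμ => ?_
    have h1 := sub_geometric_apply (N μ) (sub_ne_zero.2 (heig b μ hμ).1) (φ b μ) ν
    have h2 : (N μ ^ ν) (φ b μ) = 0 := (pow_maxJordanBlockSize_apply f (hφ b μ)).1
    rw [h2, smul_zero, sub_zero] at h1
    refine Eq.trans ?_ h1
    generalize (∑ j ∈ Finset.range ν, ((s - μ)⁻¹ ^ (j + 1)) • (N μ ^ j) (φ b μ)) = z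
    have h3 : N μ z = F z - μ • z := rfl
    rw [h3, sub_smul]
    abel
  let Y : Matrix κ κ ℂ := fun a b => eC.repr (y b) a
  have hmat : (LinearMap.toMatrix e e f).map (algebraMap ℝ ℂ) = LinearMap.toMatrix eC eC F := by
    rw [← LinearMap.toMatrix_baseChange]
  have hY : (s • (1 : Matrix κ κ ℂ) - (LinearMap.toMatrix e e f).map (algebraMap ℝ ℂ)) * Y = 1 := by
    ext a b
    rw [hmat, sub_mul, Matrix.smul_mul, Matrix.one_mul, Matrix.sub_apply, Matrix.smul_apply]
    have h1 := congrFun (LinearMap.toMatrix_mulVec_repr eC eC F (y b)) a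
    have h2 : (LinearMap.toMatrix eC eC F * Y) a b = eC.repr (F (y b)) a := h1
    rw [h2, Matrix.one_apply]
    have h3 := congrArg (fun z => eC.repr z a) (hy b)
    simp only [map_sub, map_smul, Finsupp.sub_apply, Finsupp.smul_apply, Basis.repr_self,
      Finsupp.single_apply] at h3
    rw [show s • Y a b = s • eC.repr (y b) a from rfl, h3]
    simp only [eq_comm]
  have hinv : resolventMatrix e f s = Y := Matrix.inv_eq_right_inv hY
  rw [hinv]
  refine ⟨hY, fun a b => ?_⟩
  have hYab : Y a b = ∑ μ ∈ (φ b).support, ∑ j ∈ Finset.range ν,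
      (s - μ)⁻¹ ^ (j + 1) * eC.repr ((N μ ^ j) (φ b μ)) a := by
    simp only [Y, y, map_sum, Finsupp.finsetSum_apply, map_smul, Finsupp.smul_apply, smul_eq_mul]
  set S := ∑ j ∈ Finset.range ν, D ^ (j + 1) with hS
  have hle : ‖Y a b‖ ≤ (∑ μ ∈ (φ b).support, ∑ j ∈ Finset.range ν,
      ‖eC.repr ((N μ ^ j) (φ b μ)) a‖) * S := by
    rw [hYab, Finset.sum_mul]
    refine (norm_sum_le _ _).trans (Finset.sum_le_sum fun μ hμ => ?_)
    rw [Finset.sum_mul]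
    refine (norm_sum_le _ _).trans (Finset.sum_le_sum fun j hj => ?_)
    rw [norm_mul, mul_comm, norm_pow, norm_inv]
    refine mul_le_mul_of_nonneg_left ?_ (norm_nonneg _)
    exact (pow_le_pow_left₀ (by positivity) (heig b μ hμ).2 _).trans
      (Finset.single_le_sum (f := fun j => D ^ (j + 1)) (fun _ _ => by positivity) hj)
  refine hle.trans (mul_le_mul_of_nonneg_right ?_ (by positivity))
  refine le_trans ?_ (Finset.single_le_sum (f := fun a => ∑ b, ∑ μ ∈ (φ b).support,
    ∑ j ∈ Finset.range ν, ‖eC.repr ((N μ ^ j) (φ b μ)) a‖) (fun _ _ => by positivity)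
    (Finset.mem_univ a))
  exact Finset.single_le_sum (f := fun b => ∑ μ ∈ (φ b).support,
    ∑ j ∈ Finset.range ν, ‖eC.repr ((N μ ^ j) (φ b μ)) a‖) (fun _ _ => by positivity)
    (Finset.mem_univ b)

/-- The resolvent of a real operator commutes with complex conjugation. -/
lemma resolventMatrix_conj {κ : Type*} [Fintype κ] [DecidableEq κ] (e : Basis κ ℝ W)
    (f : W →ₗ[ℝ] W) {s : ℂ}
    (h : (s • (1 : Matrix κ κ ℂ) - (LinearMap.toMatrix e e f).map (algebraMap ℝ ℂ)) *
        resolventMatrix e f s = 1) (a b : κ) :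
    resolventMatrix e f ((starRingEnd ℂ) s) a b = (starRingEnd ℂ) (resolventMatrix e f s a b) := by
  have h1 := congrArg (fun M : Matrix κ κ ℂ => M.map (starRingEnd ℂ)) h
  simp only [Matrix.map_mul] at h1
  have h2 : (s • (1 : Matrix κ κ ℂ) - (LinearMap.toMatrix e e f).map (algebraMap ℝ ℂ)).map
      (starRingEnd ℂ) = (starRingEnd ℂ) s • (1 : Matrix κ κ ℂ) -
        (LinearMap.toMatrix e e f).map (algebraMap ℝ ℂ) := by
    ext i j
    simp [Matrix.one_apply, apply_ite (starRingEnd ℂ)]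
  have h3 : (1 : Matrix κ κ ℂ).map (starRingEnd ℂ) = 1 :=
    Matrix.map_one _ (map_zero _) (map_one _)
  rw [h2, h3] at h1
  exact congrFun (congrFun (Matrix.inv_eq_right_inv h1) a) b

end Resolvent

/-! ### Inverse of the homological operator on a Fourier mode -/

section SymbolBound

/-- The eigenvalue `⟨α, Λ⟩ + 2πik/T` of the operator `∂_t + D·L₀` on `X^α e^{2πikt/T}`. -/
noncomputable def freq {ι : Type*} [Fintype ι] (T : ℝ) (Λ : ι → ℂ) (α : ι →₀ ℕ) (k : ℤ) : ℂ :=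
  (∑ i, (α i : ℂ) * Λ i) + Complex.I * k * (2 * Real.pi / T)

lemma sum_pow_succ_le_of_one_le {D : ℝ} (hD : 1 ≤ D) (n : ℕ) :
    ∑ j ∈ Finset.range n, D ^ (j + 1) ≤ n * D ^ n := by
  refine (Finset.sum_le_card_nsmul _ _ (D ^ n) fun j hj => ?_).trans (le_of_eq (by simp))
  exact pow_le_pow_right₀ hD (Finset.mem_range.1 hj)

lemma sum_pow_succ_le_of_le_one {D : ℝ} (hD0 : 0 ≤ D) (hD : D ≤ 1) (n : ℕ) :
    ∑ j ∈ Finset.range n, D ^ (j + 1) ≤ n * D := by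
  refine (Finset.sum_le_card_nsmul _ _ D fun j _ => ?_).trans (le_of_eq (by simp))
  exact pow_le_of_le_one hD0 hD (Nat.succ_ne_zero j)

/-- Bounds for the inverse of the homological operator on polynomials of degree at most `p`. For
`|k| ≲ |α|` they come from the non-resonance condition; for larger `|k|` the operator is dominated by
`∂_t`, and inverting it gains a derivative. -/
lemma resolventMatrix_freq_bound {ι : Type*} [Fintype ι] {W : Type*} [AddCommGroup W] [Module ℝ W]
    [FiniteDimensional ℝ W] {κ : Type*} [Fintype κ] [DecidableEq κ] (e : Basis κ ℝ W)
    (f : W →ₗ[ℝ] W) {T : ℝ} (hT : 0 < T) (Λ : ι → ℂ) (P : (ι →₀ ℕ) → Prop) {τ γ : ℝ} (hτ : 0 < τ)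
    (hγ : 0 < γ) (hres : ∀ α, P α → α ≠ 0 → ∀ (k : ℤ) (μ : ℂ),
      End.HasEigenvalue (f.baseChange ℂ) μ →
      γ / ((α.degree : ℝ) + |(k : ℝ)|) ^ τ ≤ ‖freq T Λ α k - μ‖) :
    ∃ C : ℝ, 0 < C ∧ ∀ (p : ℕ) (α : ι →₀ ℕ), P α → 1 ≤ α.degree → α.degree ≤ p → ∀ k : ℤ,
      (freq T Λ α k • (1 : Matrix κ κ ℂ) - (LinearMap.toMatrix e e f).map (algebraMap ℝ ℂ)) *
        resolventMatrix e f (freq T Λ α k) = 1 ∧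
      ∀ a b, ‖resolventMatrix e f (freq T Λ α k) a b‖ ≤
          C * (p : ℝ) ^ (τ * (maxJordanBlockSize f : ℝ)) ∧
        |(k : ℝ)| * ‖resolventMatrix e f (freq T Λ α k) a b‖ ≤
          C * (p : ℝ) ^ (τ * (maxJordanBlockSize f : ℝ)) * p := by
  obtain ⟨K, hK, hbound⟩ := resolventMatrix_bound e f
  set ν := maxJordanBlockSize f with hν
  obtain ⟨μM, hμM⟩ : ∃ μM : ℝ, ∀ μ, End.HasEigenvalue (f.baseChange ℂ) μ → ‖μ‖ ≤ μM := by
    obtain ⟨M, hM⟩ := ((End.finite_hasEigenvalue (f.baseChange ℂ)).image fun μ => ‖μ‖).bddAbove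
    exact ⟨M, fun μ hμ => hM ⟨μ, hμ, rfl⟩⟩
  wlog hμ0 : 0 ≤ μM generalizing μM
  · exact this (max μM 0) (fun μ hμ => (hμM μ hμ).trans (le_max_left _ _)) (le_max_right _ _)
  set ΛM : ℝ := ∑ i, ‖Λ i‖ with hΛM
  have hΛ0 : 0 ≤ ΛM := Finset.sum_nonneg fun _ _ => norm_nonneg _
  have hpi := Real.pi_pos
  -- The threshold `|k| = A |α|` is chosen so that beyond it `2π|k|/T` is at least twice the size of
  -- all other contributions to `freq - μ`.
  set A : ℝ := T / Real.pi * (ΛM + μM + 1) with hA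
  have hA0 : 0 < A := by positivity
  set Γ : ℝ := max 1 γ⁻¹ with hΓ
  have hΓ1 : 1 ≤ Γ := le_max_left _ _
  set C₀ : ℝ := (Γ * (1 + A) ^ τ) ^ ν with hC₀
  have hC₀0 : 0 ≤ C₀ := by positivity
  refine ⟨K * ν * C₀ * (1 + A) + K * ν * (1 + T / Real.pi) + 1, by positivity, ?_⟩
  intro p α hPα h1 hp k
  have hαne : α ≠ 0 := by
    rintro rfl
    simp at h1
  have hn1 : (1 : ℝ) ≤ (α.degree : ℝ) := by exact_mod_cast h1
  have hnp : (α.degree : ℝ) ≤ (p : ℝ) := by exact_mod_cast hp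
  have hp1 : (1 : ℝ) ≤ (p : ℝ) := hn1.trans hnp
  set n : ℝ := (α.degree : ℝ) with hn
  have hP0 : (1 : ℝ) ≤ (p : ℝ) ^ (τ * (ν : ℝ)) := Real.one_le_rpow hp1 (by positivity)
  set P0 : ℝ := (p : ℝ) ^ (τ * (ν : ℝ)) with hP0def
  set s := freq T Λ α k with hs
  -- Below the threshold the small divisor is at least `γ ((1 + A) p)^{-τ}` and `|k| ≤ A p`.
  by_cases hk : |(k : ℝ)| ≤ A * n
  · set N : ℝ := n + |(k : ℝ)| with hN
    have hN1 : 1 ≤ N := by linarith [abs_nonneg (k : ℝ)]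
    have hNp : N ≤ (1 + A) * p := by nlinarith
    have hNτ : 0 < N ^ τ := Real.rpow_pos_of_pos (by linarith) τ
    have hNτ1 : 1 ≤ N ^ τ := Real.one_le_rpow hN1 hτ.le
    have hD1 : 1 ≤ Γ * N ^ τ := one_le_mul_of_one_le_of_one_le hΓ1 hNτ1
    obtain ⟨hinv, hb⟩ := hbound s (Γ * N ^ τ) (by positivity) fun μ hμ => by
      have h2 := hres α hPα hαne k μ hμ
      have h3 : 0 < γ / N ^ τ := by positivity
      have h4 : 0 < ‖s - μ‖ := h3.trans_le h2
      refine ⟨fun h => by rw [h, sub_self, norm_zero] at h4; exact lt_irrefl _ h4, ?_⟩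
      calc ‖s - μ‖⁻¹ ≤ (γ / N ^ τ)⁻¹ := inv_anti₀ h3 h2
        _ = γ⁻¹ * N ^ τ := by rw [inv_div, div_eq_inv_mul]
        _ ≤ Γ * N ^ τ := by gcongr; exact le_max_right _ _
    refine ⟨hinv, fun a b => ?_⟩
    have hDν : (Γ * N ^ τ) ^ ν ≤ C₀ * P0 := by
      have h5 : N ^ τ ≤ (1 + A) ^ τ * (p : ℝ) ^ τ := by
        rw [← Real.mul_rpow (by positivity) (by positivity)]
        exact Real.rpow_le_rpow (by linarith) hNp hτ.le
      calc (Γ * N ^ τ) ^ ν ≤ (Γ * ((1 + A) ^ τ * (p : ℝ) ^ τ)) ^ ν := by gcongr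
        _ = C₀ * P0 := by
            rw [hC₀, hP0def, Real.rpow_mul_natCast (by positivity)]
            rw [← mul_assoc, mul_pow]
    have h6 : ‖resolventMatrix e f s a b‖ ≤ K * ν * C₀ * P0 := by
      calc _ ≤ K * (ν * (Γ * N ^ τ) ^ ν) :=
            (hb a b).trans (mul_le_mul_of_nonneg_left (sum_pow_succ_le_of_one_le hD1 ν) hK)
        _ ≤ K * (ν * (C₀ * P0)) := by gcongr
        _ = _ := by ring
    have e1 : 0 ≤ K * ν * C₀ := by positivity
    have e2 : 0 ≤ K * ν * (1 + T / Real.pi) := by positivity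
    have e3 : 0 ≤ K * ν * C₀ * A := by positivity
    have e4 : K * ν * C₀ * (1 + A) = K * ν * C₀ + K * ν * C₀ * A := by ring
    constructor
    · refine h6.trans (mul_le_mul_of_nonneg_right ?_ (by positivity))
      linarith
    · have hkp : |(k : ℝ)| ≤ A * p := hk.trans (by gcongr)
      calc _ ≤ (A * p) * (K * ν * C₀ * P0) := by gcongr
        _ = (K * ν * C₀ * A) * P0 * p := by ring
        _ ≤ _ := by
            gcongr
            linarith
  · push Not at hk
    -- Above the threshold the distance to the spectrum is at least `π|k|/T ≥ 1`, so that the linear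
    -- term of the resolvent bound dominates and compensates the factor `|k|`.
    have hk0 : 0 < |(k : ℝ)| := lt_trans (by positivity) hk
    have hkey : n * (ΛM + μM + 1) ≤ Real.pi / T * |(k : ℝ)| := by
      have : n * (ΛM + μM + 1) = Real.pi / T * (A * n) := by
        rw [hA]; field_simp
      rw [this]
      gcongr
    have hsnorm : Real.pi / T * |(k : ℝ)| + μM + 1 ≤ ‖s‖ := by
      have h2 : ‖∑ i, (α i : ℂ) * Λ i‖ ≤ n * ΛM := by
        refine (norm_sum_le _ _).trans ?_
        rw [hΛM, Finset.mul_sum]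
        refine Finset.sum_le_sum fun i _ => ?_
        rw [norm_mul, Complex.norm_natCast]
        gcongr
        rw [hn]
        exact_mod_cast Finsupp.le_degree i α
      have h3 : ‖Complex.I * k * (2 * Real.pi / T)‖ = 2 * (Real.pi / T * |(k : ℝ)|) := by
        have : (Complex.I * k * (2 * Real.pi / T) : ℂ) =
            Complex.I * ((k * (2 * Real.pi / T) : ℝ) : ℂ) := by push_cast; ring
        rw [this, norm_mul, Complex.norm_I, one_mul, Complex.norm_real, norm_mul, Real.norm_eq_abs,
          Real.norm_of_nonneg (by positivity)]
        ring
      have h4 : ‖Complex.I * k * (2 * Real.pi / T)‖ ≤ ‖s‖ + ‖∑ i, (α i : ℂ) * Λ i‖ := by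
        have : Complex.I * k * (2 * Real.pi / T) = s - ∑ i, (α i : ℂ) * Λ i := by
          rw [hs, freq]; ring
        rw [this]; exact norm_sub_le _ _
      nlinarith
    have hpk1 : 1 ≤ Real.pi / T * |(k : ℝ)| := by nlinarith
    set D : ℝ := (Real.pi / T * |(k : ℝ)|)⁻¹ with hD
    have hD0 : 0 < D := by positivity
    have hD1 : D ≤ 1 := inv_le_one_of_one_le₀ hpk1
    obtain ⟨hinv, hb⟩ := hbound s D hD0.le fun μ hμ => by
      have h2 : Real.pi / T * |(k : ℝ)| ≤ ‖s - μ‖ := by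
        have := norm_sub_norm_le s μ
        linarith [hμM μ hμ]
      refine ⟨fun h => ?_, inv_anti₀ (by positivity) h2⟩
      rw [h, sub_self, norm_zero] at h2
      linarith
    refine ⟨hinv, fun a b => ?_⟩
    have h6 : ‖resolventMatrix e f s a b‖ ≤ K * (ν * D) :=
      (hb a b).trans (mul_le_mul_of_nonneg_left (sum_pow_succ_le_of_le_one hD0.le hD1 ν) hK)
    have e1 : 0 ≤ K * ν * C₀ * (1 + A) := by positivity
    have e3 : 0 ≤ K * ν := by positivity
    have e4 : 0 ≤ K * ν * (T / Real.pi) := by positivity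
    have e5 : K * ν * (1 + T / Real.pi) = K * ν + K * ν * (T / Real.pi) := by ring
    constructor
    · calc _ ≤ K * (ν * 1) := h6.trans (by gcongr)
        _ = K * ν := by ring
        _ ≤ (K * ν * C₀ * (1 + A) + K * ν * (1 + T / Real.pi) + 1) * 1 := by linarith
        _ ≤ _ := by gcongr
    · have hkD : |(k : ℝ)| * D = T / Real.pi := by
        rw [hD]; field_simp
      calc _ ≤ |(k : ℝ)| * (K * (ν * D)) := by gcongr
        _ = K * ν * (|(k : ℝ)| * D) := by ring
        _ = K * ν * (T / Real.pi) := by rw [hkD]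
        _ ≤ (K * ν * C₀ * (1 + A) + K * ν * (1 + T / Real.pi) + 1) * 1 * 1 := by linarith
        _ ≤ _ := by gcongr

end SymbolBound

/-! ### The truncated homological equation as a contraction -/

section FixedPoint

/-- Coordinates adapted to the splitting `ℝᵐ = E₀ ⊕ E₁`. The index set `I` labels complex coordinates
on `E₀` (in general more than `dim E₀` of them, so that together with a coordinate its complex
conjugate is available), and `J` labels a basis of `E₁`. -/
structure Frame (m : ℕ) (I J : Type*) where
  /-- The involution that pairs each coordinate of `E₀` with its complex conjugate. -/
  σ : Equiv.Perm I
  /-- The vector of `ℂᵐ` belonging to a coordinate of `E₀`. -/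
  vec₀ : Fin m → I → ℂ
  /-- The basis vectors of `E₁`. -/
  vec₁ : Fin m → J → ℝ
  /-- The coordinates of the projection to `E₀`. -/
  proj₀ : I → Fin m → ℂ
  /-- The coordinates of the projection to `E₁`. -/
  proj₁ : J → Fin m → ℝ
  vec₀_conj : ∀ j i, vec₀ j (σ i) = (starRingEnd ℂ) (vec₀ j i)
  proj₀_conj : ∀ i j, proj₀ (σ i) j = (starRingEnd ℂ) (proj₀ i j)

lemma norm_sum_smul_le {κ B : Type*} [Fintype κ] [SeminormedAddCommGroup B] [NormedSpace ℂ B]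
    (c : κ → ℂ) {x : κ → B} {M : ℝ} (hx : ∀ j, ‖x j‖ ≤ M) :
    ‖∑ j, c j • x j‖ ≤ (∑ j, ‖c j‖) * M := by
  rw [Finset.sum_mul]
  refine (norm_sum_le _ _).trans (Finset.sum_le_sum fun j _ => ?_)
  rw [norm_smul]
  exact mul_le_mul_of_nonneg_left (hx j) (norm_nonneg _)

namespace Frame

variable {m l : ℕ} {T : ℝ} {I J : Type*} [Fintype I] [Fintype J] [DecidableEq I] [DecidableEq J]
  (fr : Frame m I J)

/-- The pairing of variables extended to the real variables labelled by `J`. -/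
def perm : Equiv.Perm (I ⊕ J) := Equiv.sumCongr fr.σ (Equiv.refl J)

/-- A bound for `proj₀`. -/
noncomputable def bound₀ : ℝ := ∑ i, ∑ j, ‖fr.proj₀ i j‖

/-- A bound for `proj₁`. -/
noncomputable def bound₁ : ℝ := ∑ b, ∑ j, ‖((fr.proj₁ b j : ℝ) : ℂ)‖

lemma bound₀_nonneg : 0 ≤ fr.bound₀ := by unfold bound₀; positivity

lemma bound₁_nonneg : 0 ≤ fr.bound₁ := by unfold bound₁; positivity

variable [hT : Fact (0 < T)] [hl : Fact (1 ≤ l)]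

/-- The components of `u₀ + ∑_b Ψ_b e_b`, where `u₀` has the coordinates `r X_i`. -/
noncomputable def point (r : ℝ) (Ψ : J → PowAlg (I ⊕ J) (SobAlg T l)) (j : Fin m) :
    PowAlg (I ⊕ J) (SobAlg T l) :=
  (∑ i, (r * fr.vec₀ j i) • PowAlg.X (Sum.inl i)) + ∑ b, ((fr.vec₁ j b : ℝ) : ℂ) • Ψ b

/-- A bound for `vec₀` and `vec₁`. -/
noncomputable def boundVec (T : ℝ) (l : ℕ) [Fact (0 < T)] [Fact (1 ≤ l)] : ℝ :=
  (∑ j, ∑ i, ‖fr.vec₀ j i‖) * ‖(1 : SobAlg T l)‖ + ∑ j, ∑ b, ‖((fr.vec₁ j b : ℝ) : ℂ)‖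

lemma boundVec_nonneg : 0 ≤ fr.boundVec T l := by unfold boundVec; positivity

lemma sum_vec₁_le (j : Fin m) : ∑ b, ‖((fr.vec₁ j b : ℝ) : ℂ)‖ ≤ fr.boundVec T l := by
  have h := Finset.single_le_sum (f := fun j => ∑ b, ‖((fr.vec₁ j b : ℝ) : ℂ)‖)
    (fun _ _ => by positivity) (Finset.mem_univ j)
  have h2 : 0 ≤ (∑ j, ∑ i, ‖fr.vec₀ j i‖) * ‖(1 : SobAlg T l)‖ := by positivity
  rw [boundVec]
  exact h.trans (le_add_of_nonneg_left h2)

lemma norm_point_le {r s : ℝ} (hr : 0 ≤ r) (hrs : r ≤ s)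
    {Ψ : J → PowAlg (I ⊕ J) (SobAlg T l)} (hΨ : ∀ b, ‖Ψ b‖ ≤ s) (j : Fin m) :
    ‖fr.point r Ψ j‖ ≤ fr.boundVec T l * s := by
  have h1 : ‖∑ i, (r * fr.vec₀ j i) • (PowAlg.X (Sum.inl i) : PowAlg (I ⊕ J) (SobAlg T l))‖ ≤
      (∑ j, ∑ i, ‖fr.vec₀ j i‖) * ‖(1 : SobAlg T l)‖ * s := by
    refine (norm_sum_smul_le (fun i => r * fr.vec₀ j i) (M := ‖(1 : SobAlg T l)‖)
      fun i => (PowAlg.norm_X _).le).trans ?_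
    have h2 : ∑ i, ‖(r : ℂ) * fr.vec₀ j i‖ = r * ∑ i, ‖fr.vec₀ j i‖ := by
      rw [Finset.mul_sum]
      exact Finset.sum_congr rfl fun i _ => by
        rw [norm_mul, Complex.norm_real, Real.norm_of_nonneg hr]
    have h3 := Finset.single_le_sum (f := fun j => ∑ i, ‖fr.vec₀ j i‖)
      (fun _ _ => by positivity) (Finset.mem_univ j)
    rw [h2]
    calc r * (∑ i, ‖fr.vec₀ j i‖) * ‖(1 : SobAlg T l)‖
        ≤ s * (∑ j, ∑ i, ‖fr.vec₀ j i‖) * ‖(1 : SobAlg T l)‖ := by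
          gcongr
          · exact hr.trans hrs
      _ = _ := by ring
  have h4 : ‖∑ b, ((fr.vec₁ j b : ℝ) : ℂ) • Ψ b‖ ≤
      (∑ j, ∑ b, ‖((fr.vec₁ j b : ℝ) : ℂ)‖) * s := by
    refine (norm_sum_smul_le _ hΨ).trans ?_
    have h3 := Finset.single_le_sum (f := fun j => ∑ b, ‖((fr.vec₁ j b : ℝ) : ℂ)‖)
      (fun _ _ => by positivity) (Finset.mem_univ j)
    exact mul_le_mul_of_nonneg_right h3 (hr.trans hrs)
  rw [point, boundVec, add_mul]
  exact (norm_add_le _ _).trans (add_le_add h1 h4)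

lemma norm_point_sub_le {r d : ℝ} (hd : 0 ≤ d) {Ψ Ψ' : J → PowAlg (I ⊕ J) (SobAlg T l)}
    (h : ∀ b, ‖Ψ b - Ψ' b‖ ≤ d) (j : Fin m) :
    ‖fr.point r Ψ j - fr.point r Ψ' j‖ ≤ fr.boundVec T l * d := by
  rw [point, point, add_sub_add_left_eq_sub, ← Finset.sum_sub_distrib]
  simp only [← smul_sub]
  exact (norm_sum_smul_le _ h).trans (mul_le_mul_of_nonneg_right (fr.sum_vec₁_le j) hd)

/-- The nonlinear part `v₁ - DΦ·v₀` of the equation, where `v` has the components `v_j`, for the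
polynomials `Φ_b` of degree at most `p` in the scaled variables `X_i = z_i / r`. -/
noncomputable def field (p : ℕ) (r : ℝ) (Φ : J → PowAlg (I ⊕ J) (SobAlg T l))
    (v : Fin m → PowAlg (I ⊕ J) (SobAlg T l)) (b : J) : PowAlg (I ⊕ J) (SobAlg T l) :=
  (∑ j, ((fr.proj₁ b j : ℝ) : ℂ) • v j) -
    ∑ i, ((r⁻¹ : ℝ) : ℂ) • (PowAlg.pderiv p (Sum.inl i) (Φ b) * ∑ j, fr.proj₀ i j • v j)

lemma norm_sum_pderiv_le {p : ℕ} {r : ℝ} (hr : 0 < r) {x : PowAlg (I ⊕ J) (SobAlg T l)}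
    {v : Fin m → PowAlg (I ⊕ J) (SobAlg T l)} {d M : ℝ} (hd : 0 ≤ d) (hx : ‖x‖ ≤ d)
    (hv : ∀ j, ‖v j‖ ≤ M) :
    ‖∑ i, ((r⁻¹ : ℝ) : ℂ) • (PowAlg.pderiv p (Sum.inl i) x * ∑ j, fr.proj₀ i j • v j)‖ ≤
      r⁻¹ * (p * d) * (fr.bound₀ * M) := by
  have hr' : 0 ≤ r⁻¹ := by positivity
  rw [bound₀, Finset.sum_mul, Finset.mul_sum]
  refine (norm_sum_le _ _).trans (Finset.sum_le_sum fun i _ => ?_)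
  rw [norm_smul, Complex.norm_real, Real.norm_of_nonneg hr', mul_assoc]
  gcongr
  refine (norm_mul_le _ _).trans ?_
  gcongr
  · exact (PowAlg.norm_pderiv_le _ _ _).trans (by gcongr)
  · exact norm_sum_smul_le _ hv

lemma norm_sum_proj₁_le {B : Type*} [SeminormedAddCommGroup B] [NormedSpace ℂ B]
    {v : Fin m → B} {M : ℝ} (hM : 0 ≤ M) (hv : ∀ j, ‖v j‖ ≤ M) (b : J) :
    ‖∑ j, ((fr.proj₁ b j : ℝ) : ℂ) • v j‖ ≤ fr.bound₁ * M := by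
  refine (norm_sum_smul_le _ hv).trans (mul_le_mul_of_nonneg_right ?_ hM)
  exact Finset.single_le_sum (f := fun b => ∑ j, ‖((fr.proj₁ b j : ℝ) : ℂ)‖)
      (fun _ _ => by positivity) (Finset.mem_univ b)

lemma norm_field_le {p : ℕ} {r : ℝ} (hr : 0 < r) {Φ : J → PowAlg (I ⊕ J) (SobAlg T l)}
    {v : Fin m → PowAlg (I ⊕ J) (SobAlg T l)} {M : ℝ} (hM : 0 ≤ M) (hΦ : ∀ b, ‖Φ b‖ ≤ r)
    (hv : ∀ j, ‖v j‖ ≤ M) (hp : 1 ≤ p) (b : J) :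
    ‖fr.field p r Φ v b‖ ≤ (fr.bound₀ + fr.bound₁) * p * M := by
  have h1 := fr.norm_sum_proj₁_le hM hv b
  have h2 := fr.norm_sum_pderiv_le (p := p) hr hr.le (hΦ b) hv
  have hp' : (1 : ℝ) ≤ p := by exact_mod_cast hp
  have e : r⁻¹ * (p * r) * (fr.bound₀ * M) = p * (fr.bound₀ * M) := by
    field_simp
  rw [e] at h2
  have h3 := (norm_sub_le _ _).trans (add_le_add h1 h2)
  refine h3.trans ?_
  have h4 : 0 ≤ fr.bound₁ * M := mul_nonneg fr.bound₁_nonneg hM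
  nlinarith

lemma norm_field_sub_le {p : ℕ} {r : ℝ} (hr : 0 < r) {Φ Φ' : J → PowAlg (I ⊕ J) (SobAlg T l)}
    {v v' : Fin m → PowAlg (I ⊕ J) (SobAlg T l)} {M d M' : ℝ} (hM : 0 ≤ M) (hd : 0 ≤ d)
    (hM' : 0 ≤ M')
    (hΦ : ∀ b, ‖Φ b‖ ≤ r) (hΦ' : ∀ b, ‖Φ b - Φ' b‖ ≤ d) (hv' : ∀ j, ‖v' j‖ ≤ M)
    (hvv : ∀ j, ‖v j - v' j‖ ≤ M') (hp : 1 ≤ p) (b : J) :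
    ‖fr.field p r Φ v b - fr.field p r Φ' v' b‖ ≤
      (fr.bound₀ + fr.bound₁) * p * (M' + r⁻¹ * d * M) := by
  have h1 := fr.norm_field_le hr hM' hΦ hvv hp b
  have h2 := fr.norm_sum_pderiv_le (p := p) hr hd (hΦ' b) hv'
  -- The vector field is bilinear in `(1, DΦ)` and `v`, which gives a product rule for differences.
  have e : fr.field p r Φ v b - fr.field p r Φ' v' b = fr.field p r Φ (fun j => v j - v' j) b -
      ∑ i, ((r⁻¹ : ℝ) : ℂ) • (PowAlg.pderiv p (Sum.inl i) (Φ b - Φ' b) *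
        ∑ j, fr.proj₀ i j • v' j) := by
    simp only [field, PowAlg.pderiv_sub, smul_sub, Finset.sum_sub_distrib, mul_sub, sub_mul]
    abel
  rw [e]
  refine ((norm_sub_le _ _).trans (add_le_add h1 h2)).trans ?_
  have h3 : 0 ≤ fr.bound₁ * p * (r⁻¹ * d * M) := by
    have := fr.bound₁_nonneg
    positivity
  nlinarith

lemma conj_point (r : ℝ) {Ψ : J → PowAlg (I ⊕ J) (SobAlg T l)}
    (hΨ : ∀ b, PowAlg.conj fr.perm (Ψ b) = Ψ b) (j : Fin m) :
    PowAlg.conj fr.perm (fr.point r Ψ j) = fr.point r Ψ j := by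
  rw [← PowAlg.conjHom_apply, point, map_add, map_sum, map_sum]
  simp only [PowAlg.conjHom_apply, PowAlg.conj_smul, PowAlg.conj_X, hΨ, Complex.conj_ofReal,
    map_mul, ← fr.vec₀_conj]
  congr 1
  -- Conjugation permutes the terms of the sum over the paired coordinates.
  exact Equiv.sum_comp fr.σ fun i => ((r : ℂ) * fr.vec₀ j i) •
    (PowAlg.X (Sum.inl i) : PowAlg (I ⊕ J) (SobAlg T l))

lemma conj_field (p : ℕ) (r : ℝ) {Φ : J → PowAlg (I ⊕ J) (SobAlg T l)}
    {v : Fin m → PowAlg (I ⊕ J) (SobAlg T l)} (hΦ : ∀ b, PowAlg.conj fr.perm (Φ b) = Φ b)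
    (hv : ∀ j, PowAlg.conj fr.perm (v j) = v j) (b : J) :
    PowAlg.conj fr.perm (fr.field p r Φ v b) = fr.field p r Φ v b := by
  have hs : ∀ i, PowAlg.conj fr.perm (∑ j, fr.proj₀ i j • v j) =
      ∑ j, fr.proj₀ (fr.σ i) j • v j := by
    intro i
    rw [← PowAlg.conjHom_apply, map_sum]
    simp only [PowAlg.conjHom_apply, PowAlg.conj_smul, hv, ← fr.proj₀_conj]
  have hm : ∀ x y : PowAlg (I ⊕ J) (SobAlg T l), PowAlg.conj fr.perm (x * y) =
      PowAlg.conj fr.perm x * PowAlg.conj fr.perm y := map_mul (PowAlg.conjHom fr.perm)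
  let g : I → PowAlg (I ⊕ J) (SobAlg T l) := fun i => ((r⁻¹ : ℝ) : ℂ) •
    (PowAlg.pderiv p (Sum.inl i) (Φ b) * ∑ j, fr.proj₀ i j • v j)
  have hg : ∀ i, PowAlg.conj fr.perm (g i) = g (fr.σ i) := fun i => by
    show PowAlg.conj fr.perm (((r⁻¹ : ℝ) : ℂ) • _) = ((r⁻¹ : ℝ) : ℂ) • _
    rw [PowAlg.conj_smul, Complex.conj_ofReal, hm, hs, PowAlg.conj_pderiv, hΦ]
    rfl
  have h1 : PowAlg.conj fr.perm (∑ j, ((fr.proj₁ b j : ℝ) : ℂ) • v j) =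
      ∑ j, ((fr.proj₁ b j : ℝ) : ℂ) • v j := by
    rw [← PowAlg.conjHom_apply, map_sum]
    exact Finset.sum_congr rfl fun j _ => by
      rw [PowAlg.conjHom_apply, PowAlg.conj_smul, Complex.conj_ofReal, hv]
  have h2 : PowAlg.conj fr.perm (∑ i, g i) = ∑ i, g i := by
    rw [← PowAlg.conjHom_apply, map_sum, ← Equiv.sum_comp fr.σ g]
    exact Finset.sum_congr rfl fun i _ => hg i
  have h3 : fr.field p r Φ v b = (∑ j, ((fr.proj₁ b j : ℝ) : ℂ) • v j) - ∑ i, g i := rfl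
  rw [h3, ← PowAlg.conjHom_apply, map_sub, PowAlg.conjHom_apply, PowAlg.conjHom_apply, h1, h2]

/-- The power series with coefficients in `H^l`, evaluated in the algebra of power series. -/
noncomputable def series (a : Fin m → (q : ℕ) → (Fin q → Fin m) → SobAlg T l)
    (u : Fin m → PowAlg (I ⊕ J) (SobAlg T l)) (j : Fin m) : PowAlg (I ⊕ J) (SobAlg T l) :=
  wordSeries (fun q w => PowAlg.C (a j q w)) u

variable {a : Fin m → (q : ℕ) → (Fin q → Fin m) → SobAlg T l} {c ρ : ℝ}

omit [Fintype I] [Fintype J] in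
lemma wordBound_C (ha : ∀ j, WordBound (a j) c ρ) (j : Fin m) :
    WordBound (fun q w => (PowAlg.C (a j q w) : PowAlg (I ⊕ J) (SobAlg T l))) c ρ :=
  (ha j).comp_of_norm_le PowAlg.C fun x => (PowAlg.norm_C x).le

omit fr [Fintype I] [Fintype J] in
lemma conj_series (σ : Equiv.Perm (I ⊕ J)) (ha : ∀ j, WordBound (a j) c ρ) (hρ : 0 < ρ)
    (hreal : ∀ j q w, (a j q w).conj = a j q w) {u : Fin m → PowAlg (I ⊕ J) (SobAlg T l)} {s : ℝ}
    (hs0 : 0 ≤ s) (hs : 2 * m * s ≤ ρ) (hu : ∀ j, ‖u j‖ ≤ s)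
    (hc : ∀ j, PowAlg.conj σ (u j) = u j) (j : Fin m) :
    PowAlg.conj σ (series a u j) = series a u j := by
  have h := (wordBound_C ha j).map_wordSeries hρ hs0 hs hu (PowAlg.conjHom σ)
    (PowAlg.continuous_conjHom σ)
  simp only [PowAlg.conjHom_apply, PowAlg.conj_C, hreal, hc] at h
  exact h

/-- The constant in the contraction estimate. -/
noncomputable def contractionConst (fr : Frame m I J) (T : ℝ) (l : ℕ) [Fact (0 < T)]
    [Fact (1 ≤ l)] (c ρ : ℝ) : ℝ :=
  (fr.bound₀ + fr.bound₁) * (lipConst m c ρ * fr.boundVec T l ^ 2)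

lemma contractionConst_nonneg (hc : 0 ≤ c) : 0 ≤ fr.contractionConst T l c ρ := by
  have := fr.bound₀_nonneg
  have := fr.bound₁_nonneg
  unfold contractionConst lipConst
  positivity

lemma norm_series_point_le (ha : ∀ j, WordBound (a j) c ρ) (hρ : 0 < ρ) {r : ℝ} (hr : 0 ≤ r)
    (hrρ : 2 * m * (fr.boundVec T l * r) ≤ ρ) {Φ : J → PowAlg (I ⊕ J) (SobAlg T l)}
    (hΦ : ∀ b, ‖Φ b‖ ≤ r) (j : Fin m) :
    ‖series a (fr.point r Φ) j‖ ≤ lipConst m c ρ * fr.boundVec T l ^ 2 * r ^ 2 := by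
  have h := (wordBound_C ha j).norm_wordSeries_le hρ (mul_nonneg fr.boundVec_nonneg hr) hrρ
    (fr.norm_point_le hr le_rfl hΦ)
  exact h.trans (le_of_eq (by ring))

/-- The homological equation composed with the nonlinearity has a small real fixed point: truncated
to degree `p` in variables of size `r`, differentiation costs a factor `p / r` and the inverse `b` of
the homological operator a factor `Kb`, while the nonlinearity is quadratic, so that the map is a
contraction as soon as `Kb p r` is small. -/
theorem exists_fixedPoint (ha : ∀ j, WordBound (a j) c ρ) (hρ : 0 < ρ) (hc : 0 ≤ c)
    (hreal : ∀ j q w, (a j q w).conj = a j q w) {p : ℕ} (hp : 1 ≤ p) {r Kb : ℝ} (hr : 0 < r)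
    (hKb : 0 ≤ Kb) {s : J → J → ((I ⊕ J) →₀ ℕ) → ℤ → ℂ} (hs : ∀ b b' α k, ‖s b b' α k‖ ≤ Kb)
    (hsconj : ∀ b b' α k, s b b' α k =
      (starRingEnd ℂ) (s b b' (PowAlg.permIdx fr.perm α) (-k)))
    (hrρ : 2 * m * (fr.boundVec T l * r) ≤ ρ)
    (hsmall : 4 * Fintype.card J * Kb * fr.contractionConst T l c ρ * p * r ≤ 1) :
    ∃ Φ : J → PowAlg (I ⊕ J) (SobAlg T l), (∀ b, ‖Φ b‖ ≤ r) ∧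
      (∀ b, PowAlg.conj fr.perm (Φ b) = Φ b) ∧
      ∀ b, Φ b = ∑ b', PowAlg.symb (s b b')
        (fr.field p r Φ (series a (fr.point r Φ)) b') := by
  let G : (J → PowAlg (I ⊕ J) (SobAlg T l)) → (J → PowAlg (I ⊕ J) (SobAlg T l)) := fun Φ b =>
    ∑ b', PowAlg.symb (s b b') (fr.field p r Φ (series a (fr.point r Φ)) b')
  -- The real elements of the ball of radius `r`.
  let S : Set (J → PowAlg (I ⊕ J) (SobAlg T l)) :=
    {Φ | (∀ b, ‖Φ b‖ ≤ r) ∧ ∀ b, PowAlg.conj fr.perm (Φ b) = Φ b}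
  have hSc : IsClosed S := by
    have h1 : IsClosed {Φ : J → PowAlg (I ⊕ J) (SobAlg T l) | ∀ b, ‖Φ b‖ ≤ r} := by
      simp only [Set.ofPred_forall]
      exact isClosed_iInter fun b => isClosed_le (by fun_prop) continuous_const
    have h2 : IsClosed {Φ : J → PowAlg (I ⊕ J) (SobAlg T l) |
        ∀ b, PowAlg.conj fr.perm (Φ b) = Φ b} := by
      simp only [Set.ofPred_forall]
      exact isClosed_iInter fun b => isClosed_eq
        ((PowAlg.continuous_conjHom fr.perm).comp (continuous_apply b)) (continuous_apply b)
    exact h1.inter h2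
  have hbv := fr.boundVec_nonneg (T := T) (l := l)
  set Lv : ℝ := lipConst m c ρ * fr.boundVec T l ^ 2 with hLv
  have hLv0 : 0 ≤ Lv := by
    have : 0 ≤ lipConst m c ρ := by unfold lipConst; positivity
    positivity
  have hb01 : 0 ≤ fr.bound₀ + fr.bound₁ := add_nonneg fr.bound₀_nonneg fr.bound₁_nonneg
  -- `G` maps the ball of radius `r` to that of radius `Q r`, and has Lipschitz constant at most
  -- `2 Q`.
  set Q : ℝ := Fintype.card J * (Kb * ((fr.bound₀ + fr.bound₁) * p * (Lv * r))) with hQ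
  have hQ4 : 4 * Q ≤ 1 := by
    refine le_trans (le_of_eq ?_) hsmall
    rw [hQ, contractionConst]; ring
  have hQ0 : 0 ≤ Q := by positivity
  have hsum : ∀ (b : J) (x : J → PowAlg (I ⊕ J) (SobAlg T l)) (M : ℝ), (∀ b', ‖x b'‖ ≤ M) →
      ‖∑ b', PowAlg.symb (s b b') (x b')‖ ≤ Fintype.card J * (Kb * M) := by
    intro b x M hx
    refine (norm_sum_le _ _).trans ((Finset.sum_le_card_nsmul _ _ (Kb * M) fun b' _ => ?_).trans
      (le_of_eq (by simp)))
    exact (PowAlg.norm_symb_le (hs b b') _).trans (mul_le_mul_of_nonneg_left (hx b') hKb)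
  have hmaps : Set.MapsTo G S S := by
    rintro Φ ⟨hΦ, hΦc⟩
    refine ⟨fun b => ?_, fun b => ?_⟩
    · have h1 := hsum b _ _ fun b' => fr.norm_field_le hr (by positivity : 0 ≤ Lv * r ^ 2) hΦ
        (fr.norm_series_point_le ha hρ hr.le hrρ hΦ) hp b'
      refine h1.trans ?_
      have h2 : Fintype.card J * (Kb * ((fr.bound₀ + fr.bound₁) * p * (Lv * r ^ 2))) = Q * r := by
        rw [hQ]; ring
      rw [h2]
      nlinarith
    · have hv : ∀ j, PowAlg.conj fr.perm (series a (fr.point r Φ) j) =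
          series a (fr.point r Φ) j :=
        conj_series fr.perm ha hρ hreal (mul_nonneg hbv hr.le) hrρ
          (fr.norm_point_le hr.le le_rfl hΦ) (fr.conj_point r hΦc)
      show PowAlg.conj fr.perm (∑ b', _) = ∑ b', _
      rw [← PowAlg.conjHom_apply, map_sum]
      refine Finset.sum_congr rfl fun b' _ => ?_
      rw [PowAlg.conjHom_apply, PowAlg.conj_symb fr.perm (hs b b') (hsconj b b'),
        fr.conj_field p r hΦc hv]
  have hlip : ∀ Φ ∈ S, ∀ Φ' ∈ S, dist (G Φ) (G Φ') ≤ 1 / 2 * dist Φ Φ' := by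
    rintro Φ ⟨hΦ, -⟩ Φ' ⟨hΦ', -⟩
    have hd : ∀ b, ‖Φ b - Φ' b‖ ≤ dist Φ Φ' := fun b => by
      rw [← dist_eq_norm]; exact dist_le_pi_dist Φ Φ' b
    set d := dist Φ Φ' with hdd
    have hd0 : 0 ≤ d := dist_nonneg
    refine (dist_pi_le_iff (by positivity)).2 fun b => ?_
    have hpt : ∀ j, ‖series a (fr.point r Φ) j - series a (fr.point r Φ') j‖ ≤ Lv * r * d := by
      intro j
      have h := (wordBound_C ha j).norm_wordSeries_sub_le hρ (mul_nonneg hbv hr.le)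
        (mul_nonneg hbv hd0) hrρ (fr.norm_point_le hr.le le_rfl hΦ)
        (fr.norm_point_le hr.le le_rfl hΦ') (fr.norm_point_sub_le hd0 hd)
      exact h.trans (le_of_eq (by rw [hLv]; ring))
    have h1 := hsum b (fun b' => fr.field p r Φ (series a (fr.point r Φ)) b' -
      fr.field p r Φ' (series a (fr.point r Φ')) b') _ fun b' =>
        fr.norm_field_sub_le hr (by positivity : 0 ≤ Lv * r ^ 2) hd0
        (by positivity : 0 ≤ Lv * r * d) hΦ hd
        (fr.norm_series_point_le ha hρ hr.le hrρ hΦ') hpt hp b'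
    have h2 : Fintype.card J * (Kb * ((fr.bound₀ + fr.bound₁) * p *
        (Lv * r * d + r⁻¹ * d * (Lv * r ^ 2)))) = 2 * Q * d := by
      have : r⁻¹ * d * (Lv * r ^ 2) = Lv * r * d := by field_simp
      rw [this, hQ]; ring
    rw [h2] at h1
    rw [dist_eq_norm]
    show ‖∑ b', _ - ∑ b', _‖ ≤ _
    rw [← Finset.sum_sub_distrib]
    simp only [← PowAlg.symb_sub (hs b _)]
    refine h1.trans ?_
    nlinarith
  have hcontr : ContractingWith (1 / 2) (hmaps.restrict G S S) := by
    refine ⟨by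
      rw [← NNReal.coe_lt_coe]; norm_num, LipschitzWith.of_dist_le_mul fun x y => ?_⟩
    have := hlip x x.2 y y.2
    simpa [Subtype.dist_eq] using this
  have h0 : (0 : J → PowAlg (I ⊕ J) (SobAlg T l)) ∈ S :=
    ⟨fun b => by simpa using hr.le, fun b => map_zero (PowAlg.conjHom fr.perm)⟩
  obtain ⟨Φ, hΦS, hfix, -⟩ := hcontr.exists_fixedPoint' hSc.isComplete hmaps h0
    (edist_ne_top _ _)
  exact ⟨Φ, hΦS.1, hΦS.2, fun b => (congrFun hfix b).symm⟩

end Frame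
end FixedPoint

/-! ### From power series to analytic maps -/

section Analyticity

/-- The multi-index counting the letters of a word. -/
noncomputable def wordIdx {ι : Type*} {q : ℕ} (w : Fin q → ι) : ι →₀ ℕ :=
  ∑ k, Finsupp.single (w k) 1

lemma degree_wordIdx {ι : Type*} {q : ℕ} (w : Fin q → ι) : (wordIdx w).degree = q := by
  simp [wordIdx, map_sum, Finsupp.degree_single]

lemma wordIdx_comp_perm {ι : Type*} {q : ℕ} (w : Fin q → ι) (σ : Equiv.Perm (Fin q)) :
    wordIdx (w ∘ σ) = wordIdx w :=
  Equiv.sum_comp σ fun k => Finsupp.single (w k) 1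

lemma exists_wordIdx {ι : Type*} (q : ℕ) (α : ι →₀ ℕ) (h : α.degree = q) :
    ∃ w : Fin q → ι, wordIdx w = α := by
  induction q generalizing α with
  | zero =>
    refine ⟨Fin.elim0, ?_⟩
    rw [(Finsupp.degree_eq_zero_iff α).1 h]
    simp [wordIdx]
  | succ q ih =>
    have hα : α ≠ 0 := by
      rintro rfl
      simp at h
    obtain ⟨i, hi⟩ := Finsupp.ne_iff.1 hα
    have h1 : Finsupp.single i 1 ≤ α := by
      rw [Finsupp.single_le_iff]
      exact Nat.one_le_iff_ne_zero.2 hi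
    obtain ⟨β, rfl⟩ := exists_add_of_le h1
    rw [map_add, Finsupp.degree_single] at h
    obtain ⟨w, rfl⟩ := ih β (by omega)
    refine ⟨Fin.cons i w, ?_⟩
    simp [wordIdx, Fin.sum_univ_succ]

/-- The number of words with given letters. -/
noncomputable def wordCount {ι : Type*} (q : ℕ) (α : ι →₀ ℕ) : ℕ :=
  Nat.card {w : Fin q → ι // wordIdx w = α}

/-- Averaging over the words with given letters. -/
lemma sum_wordIdx_div {ι : Type*} [Fintype ι] [DecidableEq ι] {E : Type*} [AddCommGroup E]
    [Module ℂ E] (q : ℕ) (g : (ι →₀ ℕ) → E) :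
    ∑ w : Fin q → ι, ((wordCount q (wordIdx w) : ℂ))⁻¹ • g (wordIdx w) =
      ∑ α ∈ Finset.univ.image (wordIdx : (Fin q → ι) → ι →₀ ℕ), g α := by
  rw [← Finset.sum_fiberwise_of_maps_to (g := (wordIdx : (Fin q → ι) → ι →₀ ℕ))
    (t := Finset.univ.image wordIdx) fun w _ => Finset.mem_image_of_mem _ (Finset.mem_univ w)]
  refine Finset.sum_congr rfl fun α hα => ?_
  obtain ⟨w, -, rfl⟩ := Finset.mem_image.1 hα
  have h1 : ∀ w' ∈ Finset.univ.filter (fun w' : Fin q → ι => wordIdx w' = wordIdx w),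
      ((wordCount q (wordIdx w') : ℂ))⁻¹ • g (wordIdx w') =
      ((wordCount q (wordIdx w) : ℂ))⁻¹ • g (wordIdx w) := fun w' hw' => by
    rw [(Finset.mem_filter.1 hw').2]
  rw [Finset.sum_congr rfl h1, Finset.sum_const, ← Nat.cast_smul_eq_nsmul ℂ, smul_smul]
  have h2 : (Finset.univ.filter (fun w' : Fin q → ι => wordIdx w' = wordIdx w)).card =
      wordCount q (wordIdx w) := by
    rw [wordCount, Nat.card_eq_fintype_card, Fintype.card_subtype]
  have h3 : (wordCount q (wordIdx w) : ℂ) ≠ 0 := by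
    rw [← h2, Nat.cast_ne_zero, Finset.card_ne_zero]
    exact ⟨w, by simp⟩
  rw [h2, mul_inv_cancel₀ h3, one_smul]

lemma coe_image_wordIdx {ι : Type*} [Fintype ι] [DecidableEq ι] (q : ℕ) :
    ((Finset.univ.image (wordIdx : (Fin q → ι) → ι →₀ ℕ) : Finset (ι →₀ ℕ)) : Set (ι →₀ ℕ)) =
      Finsupp.degree ⁻¹' {q} := by
  ext α
  simp only [Finset.coe_image, Finset.coe_univ, Set.image_univ, Set.mem_range, Set.mem_preimage,
    Set.mem_singleton_iff]
  exact ⟨fun ⟨w, hw⟩ => hw ▸ degree_wordIdx w, fun h => exists_wordIdx q α h⟩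

namespace SobAlg

variable {T : ℝ} {l : ℕ} [hT : Fact (0 < T)] [hl : Fact (1 ≤ l)]

/-- The real part of an element of `H^l`. -/
noncomputable def realPart (x : SobAlg T l) : SobAlg T l := (1 / 2 : ℂ) • (x + x.conj)

lemma eval_realPart (t : AddCircle T) (x : SobAlg T l) :
    eval t x.realPart = (((eval t x).re : ℝ) : ℂ) := by
  rw [realPart, eval_smul, map_add, eval_conj, Complex.add_conj]
  push_cast; ring

lemma norm_realPart_le (x : SobAlg T l) : ‖x.realPart‖ ≤ ‖x‖ := by
  rw [realPart, norm_smul]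
  have h := norm_add_le x x.conj
  rw [norm_conj] at h
  have : ‖(1 / 2 : ℂ)‖ = 1 / 2 := by norm_num
  rw [this]
  linarith

end SobAlg

namespace PowAlg

variable {T : ℝ} {l m : ℕ} [hT : Fact (0 < T)] [hl : Fact (1 ≤ l)] {ι : Type*} [Fintype ι]
  [DecidableEq ι] {F : Type*} [NormedAddCommGroup F] [NormedSpace ℝ F]

/-- The coefficient, in the symmetric multilinear form of degree `q` of `f`, of the product of linear
forms belonging to the word `w`. -/
noncomputable def wordCoef (f : PowAlg ι (SobAlg T l)) {q : ℕ} (w : Fin q → ι) : SobAlg T l :=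
  ((wordCount q (wordIdx w) : ℂ))⁻¹ • f.coef (wordIdx w)

/-- The symmetric multilinear forms (real parts taken) of the power series `f_j` in the linear
forms `ζ_i`. -/
noncomputable def multilinear (ζ : ι → F →ₗ[ℝ] ℂ) (f : Fin m → PowAlg ι (SobAlg T l)) (q : ℕ)
    (t : AddCircle T) : MultilinearMap ℝ (fun _ : Fin q => F) (EuclideanSpace ℝ (Fin m)) :=
  (WithLp.linearEquiv 2 ℝ (Fin m → ℝ)).symm.toLinearMap.compMultilinearMap
    (MultilinearMap.pi fun j => ∑ w : Fin q → ι,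
      (Complex.reLm.comp (LinearMap.mulLeft ℝ (SobAlg.eval t ((f j).wordCoef w)))).compMultilinearMap
        ((MultilinearMap.mkPiAlgebra ℝ (Fin q) ℂ).compLinearMap fun k => ζ (w k)))

/-- The element of `H^l` whose real part is the component of `multilinear`. -/
noncomputable def multilinearSob (ζ : ι → F →ₗ[ℝ] ℂ) (f : PowAlg ι (SobAlg T l)) {q : ℕ}
    (x : Fin q → F) : SobAlg T l :=
  ∑ w : Fin q → ι, (∏ k, ζ (w k) (x k)) • f.wordCoef w

lemma multilinear_apply (ζ : ι → F →ₗ[ℝ] ℂ) (f : Fin m → PowAlg ι (SobAlg T l)) (q : ℕ)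
    (t : AddCircle T) (x : Fin q → F) (j : Fin m) :
    multilinear ζ f q t x j = (SobAlg.eval t (multilinearSob ζ (f j) x)).re := by
  have h : multilinear ζ f q t x j = (∑ w : Fin q → ι,
      (Complex.reLm.comp (LinearMap.mulLeft ℝ (SobAlg.eval t ((f j).wordCoef w)))).compMultilinearMap
        ((MultilinearMap.mkPiAlgebra ℝ (Fin q) ℂ).compLinearMap fun k => ζ (w k))) x := rfl
  rw [h, multilinearSob, map_sum, Complex.re_sum, sum_apply]
  refine Finset.sum_congr rfl fun w _ => ?_
  rw [SobAlg.eval_smul, mul_comm]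
  simp only [LinearMap.compMultilinearMap_apply, MultilinearMap.compLinearMap_apply,
    MultilinearMap.mkPiAlgebra_apply, LinearMap.comp_apply, LinearMap.mulLeft_apply,
    Complex.reLm_coe]

lemma multilinearSob_comp_perm (ζ : ι → F →ₗ[ℝ] ℂ) (f : PowAlg ι (SobAlg T l)) {q : ℕ}
    (σ : Equiv.Perm (Fin q)) (x : Fin q → F) :
    multilinearSob ζ f (x ∘ σ) = multilinearSob ζ f x := by
  rw [multilinearSob, multilinearSob, ← Equiv.sum_comp (Equiv.arrowCongr σ (Equiv.refl ι)).symm]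
  refine Finset.sum_congr rfl fun w _ => ?_
  have e : (Equiv.arrowCongr σ (Equiv.refl ι)).symm w = w ∘ σ := by
    ext k; simp
  rw [e, wordCoef, wordCoef, wordIdx_comp_perm]
  congr 1
  exact Equiv.prod_comp σ fun k => ζ (w k) (x k)

lemma norm_multilinearSob_le {ζ : ι → F →ₗ[ℝ] ℂ} {κ : ℝ} (hζ : ∀ i x, ‖ζ i x‖ ≤ κ * ‖x‖)
    (hκ : 0 ≤ κ) (f : PowAlg ι (SobAlg T l)) {q : ℕ} (x : Fin q → F) :
    ‖multilinearSob ζ f x‖ ≤ ‖f‖ * κ ^ q * ∏ k, ‖x k‖ := by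
  have hp : ∀ w : Fin q → ι, ‖∏ k, ζ (w k) (x k)‖ ≤ κ ^ q * ∏ k, ‖x k‖ := fun w => by
    rw [norm_prod]
    refine (Finset.prod_le_prod (fun _ _ => norm_nonneg _) fun k _ => hζ (w k) (x k)).trans ?_
    rw [Finset.prod_mul_distrib, Finset.prod_const, Finset.card_univ, Fintype.card_fin]
  -- The coefficients of degree `q` are spread evenly over the words, which preserves the `ℓ¹` norm.
  have hs : ∑ w : Fin q → ι, ‖f.wordCoef w‖ ≤ ‖f‖ := by
    have h1 := sum_wordIdx_div (ι := ι) q (fun α => ((‖f.coef α‖ : ℝ) : ℂ))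
    have h2 : ∑ w : Fin q → ι, ((‖f.wordCoef w‖ : ℝ) : ℂ) =
        ∑ α ∈ Finset.univ.image (wordIdx : (Fin q → ι) → ι →₀ ℕ), ((‖f.coef α‖ : ℝ) : ℂ) := by
      rw [← h1]
      refine Finset.sum_congr rfl fun w _ => ?_
      rw [wordCoef, norm_smul, norm_inv, Complex.norm_natCast, smul_eq_mul]
      push_cast; ring
    have h3 : ∑ w : Fin q → ι, ‖f.wordCoef w‖ =
        ∑ α ∈ Finset.univ.image (wordIdx : (Fin q → ι) → ι →₀ ℕ), ‖f.coef α‖ := by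
      exact_mod_cast h2
    rw [h3]
    exact sum_le_hasSum _ (fun _ _ => norm_nonneg _) f.hasSum_norm
  rw [multilinearSob]
  refine (norm_sum_le _ _).trans ?_
  calc ∑ w : Fin q → ι, ‖(∏ k, ζ (w k) (x k)) • f.wordCoef w‖
      ≤ ∑ w : Fin q → ι, (κ ^ q * ∏ k, ‖x k‖) * ‖f.wordCoef w‖ :=
        Finset.sum_le_sum fun w _ => by
          rw [norm_smul]; exact mul_le_mul_of_nonneg_right (hp w) (norm_nonneg _)
    _ ≤ (κ ^ q * ∏ k, ‖x k‖) * ‖f‖ := by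
        rw [← Finset.mul_sum]
        exact mul_le_mul_of_nonneg_left hs (by positivity)
    _ = _ := by ring

lemma hasSum_multilinearSob {ζ : ι → F →ₗ[ℝ] ℂ} {u : F} (hu : ∀ i, ‖ζ i u‖ ≤ 1)
    (f : PowAlg ι (SobAlg T l)) :
    HasSum (fun q : ℕ => multilinearSob ζ f fun _ : Fin q => u) (ev (fun i => ζ i u) f) := by
  -- Sum over the homogeneous components, then over the words instead of the multi-indices.
  have h := (hasSum_ev hu f).tsum_fiberwise (Finsupp.degree : (ι →₀ ℕ) → ℕ)
  refine h.congr_fun fun q => ?_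
  rw [← coe_image_wordIdx, Finset.tsum_subtype' _ fun α => mon (fun i => ζ i u) α • f.coef α,
    ← sum_wordIdx_div, multilinearSob]
  refine Finset.sum_congr rfl fun w _ => ?_
  rw [wordCoef, smul_comm]
  congr 2
  rw [mon]
  simp only [wordIdx, Finsupp.coe_finsetSum, Finset.sum_apply, ← Finset.prod_pow_eq_pow_sum]
  rw [Finset.prod_comm]
  refine Finset.prod_congr rfl fun k _ => ?_
  rw [Finset.prod_eq_single (w k)]
  · simp
  · intro i _ hi
    simp [hi.symm]
  · simp

/-- A map is analytic where it is given by absolutely convergent power series in linear forms. -/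
theorem isAnalyticSobolev {ζ : ι → F →ₗ[ℝ] ℂ} {κ : ℝ} (hκ : 0 < κ)
    (hζ : ∀ i x, ‖ζ i x‖ ≤ κ * ‖x‖) (f : Fin m → PowAlg ι (SobAlg T l)) {S : Set F}
    (hS : ∀ x ∈ S, ∀ i, ‖ζ i x‖ ≤ 1) {W : F → AddCircle T → EuclideanSpace ℝ (Fin m)}
    (hW : ∀ x ∈ S, ∀ t j, ((W x t j : ℝ) : ℂ) = SobAlg.eval t (ev (fun i => ζ i x) (f j))) :
    IsAnalyticSobolev l S W := by
  -- The summand `1` only makes the constant positive.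
  refine ⟨∑ j, ‖f j‖ + 1, by positivity, κ⁻¹, by positivity, multilinear ζ f, ?_, ?_, ?_⟩
  · intro q t σ x
    ext j
    rw [multilinear_apply, multilinear_apply, multilinearSob_comp_perm]
  · intro q x
    have h := SobAlg.sobolevNorm_le_of_eval (f := fun t => multilinear ζ f q t x)
      (x := fun j => (multilinearSob ζ (f j) x).realPart)
      (fun j t => by rw [SobAlg.eval_realPart, multilinear_apply])
    refine ⟨h.1, h.2.trans ?_⟩
    have h1 : ∀ j, ‖(multilinearSob ζ (f j) x).realPart‖ ≤ ‖f j‖ * (κ ^ q * ∏ k, ‖x k‖) :=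
      fun j => (SobAlg.norm_realPart_le _).trans
        ((norm_multilinearSob_le hζ hκ.le (f j) x).trans (le_of_eq (mul_assoc _ _ _)))
    refine (Finset.sum_le_sum fun j _ => h1 j).trans ?_
    rw [← Finset.sum_mul, inv_pow, div_inv_eq_mul, mul_assoc]
    exact mul_le_mul_of_nonneg_right (by linarith) (by positivity)
  · intro u hu t
    have hj : ∀ j, HasSum (fun q => multilinear ζ f q t (fun _ => u) j) (W u t j) := by
      intro j
      have h1 := (hasSum_multilinearSob (hS u hu) (f j)).map (SobAlg.eval t)
        (SobAlg.continuous_eval t)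
      rw [← hW u hu] at h1
      have h2 := Complex.hasSum_re h1
      rw [Complex.ofReal_re] at h2
      exact h2.congr_fun fun q => multilinear_apply ζ f q t _ j
    have h3 : HasSum (fun q => WithLp.ofLp (multilinear ζ f q t (fun _ => u)))
        (WithLp.ofLp (W u t)) := Pi.hasSum.2 hj
    exact h3.map (WithLp.linearEquiv 2 ℝ (Fin m → ℝ)).symm.toAddMonoidHom
      (PiLp.continuous_toLp 2 _)

end PowAlg
end Analyticity

/-! ### Time-dependent polynomials along curves -/

section PolynomialCurves

namespace PowAlg

variable {ι : Type*} [Fintype ι] [DecidableEq ι]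

/-- The partial derivative `∂_i` of the monomial `ζ^α`. -/
def dmon (ζ : ι → ℂ) (i : ι) (α : ι →₀ ℕ) : ℂ :=
  (∏ j ∈ Finset.univ.erase i, ζ j ^ α j) * (α i * ζ i ^ (α i - 1))

lemma mul_dmon (ζ : ι → ℂ) (i : ι) (α : ι →₀ ℕ) : ζ i * dmon ζ i α = α i * mon ζ α := by
  have h := Finset.mul_prod_erase Finset.univ (fun j => ζ j ^ α j) (Finset.mem_univ i)
  rw [mon, ← h, dmon]
  rcases hα : α i with _ | n
  · simp
  · simp only [Nat.add_sub_cancel, pow_succ]; ring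

lemma dmon_add_single (ζ : ι → ℂ) (i : ι) (α : ι →₀ ℕ) :
    dmon ζ i (α + Finsupp.single i 1) = ((α i + 1 : ℕ) : ℂ) * mon ζ α := by
  have h := Finset.mul_prod_erase Finset.univ (fun j => ζ j ^ α j) (Finset.mem_univ i)
  have h2 : ∏ j ∈ Finset.univ.erase i, ζ j ^ ((α + Finsupp.single i 1 : ι →₀ ℕ) j) =
      ∏ j ∈ Finset.univ.erase i, ζ j ^ α j := Finset.prod_congr rfl fun j hj => by
    rw [Finsupp.add_apply, Finsupp.single_eq_of_ne (Finset.ne_of_mem_erase hj), add_zero]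
  rw [mon, ← h, dmon, h2]
  simp only [Finsupp.add_apply, Finsupp.single_eq_same, Nat.add_sub_cancel]
  ring

lemma dmon_of_eq_zero (ζ : ι → ℂ) {i : ι} {α : ι →₀ ℕ} (h : α i = 0) : dmon ζ i α = 0 := by
  simp [dmon, h]

lemma hasDerivAt_mon {ζ : ℝ → ι → ℂ} {ζ' : ι → ℂ} {t : ℝ}
    (h : ∀ i, HasDerivAt (fun s => ζ s i) (ζ' i) t) (α : ι →₀ ℕ) :
    HasDerivAt (fun s => mon (ζ s) α) (∑ i, dmon (ζ t) i α * ζ' i) t := by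
  have h1 := HasDerivAt.fun_finsetProd (u := Finset.univ) (f := fun i s => ζ s i ^ α i)
    fun i _ => (h i).fun_pow (α i)
  refine h1.congr_deriv (Finset.sum_congr rfl fun i _ => ?_)
  rw [dmon, smul_eq_mul]; ring

/-- The multi-indices of degree at most `p`. -/
noncomputable def idxLe (ι : Type*) [Fintype ι] (p : ℕ) : Finset (ι →₀ ℕ) :=
  (Finsupp.finite_of_degree_le p).toFinset

omit [DecidableEq ι] in
lemma mem_idxLe {p : ℕ} {α : ι →₀ ℕ} : α ∈ idxLe ι p ↔ α.degree ≤ p := by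
  simp [idxLe]

section

variable {H : Type*} [NormedCommRing H] [NormedAlgebra ℂ H]

/-- The polynomials of degree at most `p` among the power series. -/
def DegreeLe (p : ℕ) (f : PowAlg ι H) : Prop := ∀ α : ι →₀ ℕ, p < α.degree → f.coef α = 0

omit [DecidableEq ι] in
lemma ev_eq_sum {p : ℕ} {f : PowAlg ι H} (hf : DegreeLe p f) (ζ : ι → ℂ) :
    ev ζ f = ∑ α ∈ idxLe ι p, mon ζ α • f.coef α :=
  tsum_eq_sum fun α hα => by
    rw [hf α (by simpa [mem_idxLe] using hα), smul_zero]

lemma ev_pderiv_eq_sum {p : ℕ} {f : PowAlg ι H} (hf : DegreeLe p f) (ζ : ι → ℂ) (i : ι) :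
    ev ζ (pderiv p i f) = ∑ α ∈ idxLe ι p, dmon ζ i α • f.coef α := by
  have h1 : ∑ α ∈ idxLe ι p, dmon ζ i α • f.coef α = ∑' α, dmon ζ i α • f.coef α :=
    (tsum_eq_sum fun α hα => by
      rw [hf α (by simpa [mem_idxLe] using hα), smul_zero]).symm
  -- The derivative shifts multi-indices by `single i 1`; those not in the range of the shift have
  -- `α i = 0` and do not contribute. The truncation in `pderiv` is harmless in degree at most `p`.
  rw [h1, ← (shift_injective i).tsum_eq, ev]
  · refine tsum_congr fun α => ?_
    rw [coef_pderiv, dmon_add_single, mul_smul, smul_comm]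
    split_ifs with h
    · rfl
    · rw [hf _ (by rw [map_add, Finsupp.degree_single]; omega), smul_zero, smul_zero, smul_zero]
  · intro α hα
    have h2 : α i ≠ 0 := fun h2 => hα (by
      show dmon ζ i α • f.coef α = 0
      rw [dmon_of_eq_zero ζ h2, zero_smul])
    have h3 : Finsupp.single i 1 ≤ α := by
      rw [Finsupp.single_le_iff]
      exact Nat.one_le_iff_ne_zero.2 h2
    obtain ⟨β, rfl⟩ := exists_add_of_le h3
    exact ⟨β, add_comm _ _⟩

end

variable {T : ℝ} {l : ℕ} [hT : Fact (0 < T)] [hl : Fact (1 ≤ l)]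

/-- The derivative of a polynomial with time dependent coefficients along a curve: if `g` is the
image of `f` under the operator `∂_t + D·Λ` with symbol `freq`, what remains is the effect of the
deviation of the curve from the linear flow. -/
theorem hasDerivAt_ev {p : ℕ} {f g : PowAlg ι (SobAlg T l)} (hf : DegreeLe p f) {Λ : ι → ℂ}
    (hg : ∀ α k, (g.coef α).coef k = freq T Λ α k * (f.coef α).coef k)
    {ζ : ℝ → ι → ℂ} {ζ' : ι → ℂ} {t : ℝ} (h : ∀ i, HasDerivAt (fun s => ζ s i) (ζ' i) t) :
    HasDerivAt (fun s : ℝ => SobAlg.eval (s : AddCircle T) (ev (ζ s) f))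
      (SobAlg.eval (t : AddCircle T) (ev (ζ t) g) + ∑ i, (ζ' i - Λ i * ζ t i) *
        SobAlg.eval (t : AddCircle T) (ev (ζ t) (pderiv p i f))) t := by
  have hgp : DegreeLe p g := fun α hα => SobAlg.ext fun k => by
    rw [hg, hf α hα, SobAlg.coef_zero, mul_zero]
  have e1 : (fun s : ℝ => SobAlg.eval (s : AddCircle T) (ev (ζ s) f)) =
      fun s : ℝ => ∑ α ∈ idxLe ι p, mon (ζ s) α * SobAlg.eval (s : AddCircle T) (f.coef α) := by
    funext s
    rw [ev_eq_sum hf, map_sum]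
    simp only [SobAlg.eval_smul]
  rw [e1, ev_eq_sum hgp, map_sum]
  simp only [ev_pderiv_eq_sum hf, map_sum, SobAlg.eval_smul]
  -- The symbol of `∂_t` alone is `freq` without the term `⟨α, Λ⟩`.
  have h2 : ∀ α, HasDerivAt (fun s : ℝ => SobAlg.eval (s : AddCircle T) (f.coef α))
      (SobAlg.eval (t : AddCircle T) (g.coef α) -
        (∑ i, (α i : ℂ) * Λ i) * SobAlg.eval (t : AddCircle T) (f.coef α)) t := by
    intro α
    refine (SobAlg.hasDerivAt_eval (y := g.coef α - (∑ i, (α i : ℂ) * Λ i) • f.coef α)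
      (fun k => ?_) t).congr_deriv ?_
    · have hsub : ∀ (x y : SobAlg T l) k, (x - y).coef k = x.coef k - y.coef k := fun x y k =>
        sub_div _ _ _
      rw [hsub, hg, SobAlg.coef_smul, freq]
      ring
    · rw [map_sub, SobAlg.eval_smul]
  refine (HasDerivAt.fun_sum fun α _ => (hasDerivAt_mon h α).mul (h2 α)).congr_deriv ?_
  simp only [Finset.mul_sum]
  rw [Finset.sum_comm, ← Finset.sum_add_distrib]
  refine Finset.sum_congr rfl fun α _ => ?_
  -- By Euler's identity `ζ_i ∂_i ζ^α = α_i ζ^α` the linear part of the flow multiplies `ζ^α` by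
  -- `⟨α, Λ⟩`.
  have e2 : ∑ i, (ζ' i - Λ i * ζ t i) * (dmon (ζ t) i α *
      SobAlg.eval (t : AddCircle T) (f.coef α)) =
      ((∑ i, dmon (ζ t) i α * ζ' i) - (∑ i, (α i : ℂ) * Λ i) * mon (ζ t) α) *
        SobAlg.eval (t : AddCircle T) (f.coef α) := by
    rw [Finset.sum_mul (f := fun i => (α i : ℂ) * Λ i), ← Finset.sum_sub_distrib, Finset.sum_mul]
    refine Finset.sum_congr rfl fun i _ => ?_
    have := mul_dmon (ζ t) i α
    linear_combination (-Λ i * SobAlg.eval (t : AddCircle T) (f.coef α)) * this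
  rw [e2]
  ring

end PowAlg
end PolynomialCurves

/-! ### Polynomials with Sobolev coefficients in real coordinates -/

section SobolevPolynomials

lemma mvPolynomial_eval_eq_sum {n p : ℕ} {Q : MvPolynomial (Fin n) ℂ} (hQ : Q.totalDegree ≤ p)
    (y : Fin n → ℂ) :
    MvPolynomial.eval y Q = ∑ d ∈ Finset.range (p + 1), ∑ β ∈ Finset.piAntidiag Finset.univ d,
      (∏ i, y i ^ β i) * Q.coeff (Finsupp.equivFunOnFinite.symm β) := by
  have hdeg : ∀ β : Fin n →₀ ℕ, β ∈ Q.support → ∑ i, β i ≤ p := fun β hβ => by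
    have := MvPolynomial.le_totalDegree hβ
    rw [Finsupp.sum_fintype _ _ fun _ => rfl] at this
    omega
  rw [MvPolynomial.eval_eq', ← Finset.sum_biUnion fun d _ d' _ h =>
    Finset.disjoint_left.2 fun β hβ hβ' =>
      h ((Finset.mem_piAntidiag.1 hβ).1.symm.trans (Finset.mem_piAntidiag.1 hβ').1)]
  have e : ∀ β : Fin n → ℕ, (∏ i, y i ^ β i) * Q.coeff (Finsupp.equivFunOnFinite.symm β) =
      (fun d : Fin n →₀ ℕ => Q.coeff d * ∏ i, y i ^ d i) (Finsupp.equivFunOnFinite.symm β) :=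
    fun β => mul_comm _ _
  simp only [e]
  refine Eq.trans ?_ (Finset.sum_map _ Finsupp.equivFunOnFinite.symm.toEmbedding
    (fun d : Fin n →₀ ℕ => Q.coeff d * ∏ i, y i ^ d i))
  refine Finset.sum_subset (fun β hβ => ?_) fun β _ hβ => ?_
  · rw [Finset.mem_map]
    refine ⟨β, ?_, by simp⟩
    simp only [Finset.mem_biUnion, Finset.mem_range, Finset.mem_piAntidiag]
    exact ⟨∑ i, β i, Nat.lt_succ_of_le (hdeg β hβ), rfl, fun _ _ => Finset.mem_univ _⟩
  · rw [MvPolynomial.notMem_support_iff.1 hβ, zero_mul]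

namespace SobAlg

variable {T : ℝ} {l : ℕ} [hT : Fact (0 < T)] [hl : Fact (1 ≤ l)]

/-- The elements of `H^l` that belong to `H^n`. -/
def MemHigher (n : ℕ) (x : SobAlg T l) : Prop :=
  Summable fun k => sobWeight n k ^ 2 * ‖x.coef k‖ ^ 2

lemma MemHigher.zero {n : ℕ} : MemHigher n (0 : SobAlg T l) := by
  simp [MemHigher, coef_zero, summable_zero]

lemma MemHigher.smul {n : ℕ} {x : SobAlg T l} (hx : MemHigher n x) (c : ℂ) :
    MemHigher n (c • x) := by
  refine (Summable.mul_left (‖c‖ ^ 2) hx).congr fun k => ?_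
  rw [coef_smul, norm_mul]; ring

lemma MemHigher.add {n : ℕ} {x y : SobAlg T l} (hx : MemHigher n x) (hy : MemHigher n y) :
    MemHigher n (x + y) := by
  refine Summable.of_nonneg_of_le (fun k => by positivity) (fun k => ?_)
    ((Summable.add hx hy).mul_left 2)
  have h1 := norm_add_le (x.coef k) (y.coef k)
  have h2 : ‖x.coef k + y.coef k‖ ^ 2 ≤ 2 * (‖x.coef k‖ ^ 2 + ‖y.coef k‖ ^ 2) := by
    nlinarith [norm_nonneg (x.coef k + y.coef k), sq_nonneg (‖x.coef k‖ - ‖y.coef k‖),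
      norm_nonneg (x.coef k), norm_nonneg (y.coef k)]
  rw [coef_add]
  nlinarith [sq_nonneg (sobWeight n k)]

lemma MemHigher.sum {n : ℕ} {κ : Type*} {s : Finset κ} {x : κ → SobAlg T l}
    (hx : ∀ i ∈ s, MemHigher n (x i)) : MemHigher n (∑ i ∈ s, x i) :=
  Finset.sum_induction _ _ (fun _ _ => MemHigher.add) MemHigher.zero hx

lemma MemHigher.conj {n : ℕ} {x : SobAlg T l} (hx : MemHigher n x) : MemHigher n x.conj := by
  refine ((Equiv.neg ℤ).summable_iff.2 hx).congr fun k => ?_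
  simp only [Function.comp_apply, Equiv.neg_apply, coef_conj, RCLike.norm_conj, sobWeight_neg]

lemma MemHigher.realPart {n : ℕ} {x : SobAlg T l} (hx : MemHigher n x) :
    MemHigher n x.realPart := (hx.add hx.conj).smul _

end SobAlg

variable {T : ℝ} {l m : ℕ} [hT : Fact (0 < T)] [hl : Fact (1 ≤ l)] {ι J : Type*} [Fintype ι]
  [Fintype J] {E₀ E₁ : Submodule ℝ (EuclideanSpace ℝ (Fin m))}

/-- The polynomial in the coordinates `y` of a basis of `E₀` obtained from the monomial `ζ^α` by
inserting the linear forms `ζ_i = ∑_a ζ_i(e_a) y_a`. -/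
noncomputable def coordPolynomial (ζ : ι → E₀ →ₗ[ℝ] ℂ) (α : ι →₀ ℕ) :
    MvPolynomial (Fin (finrank ℝ E₀)) ℂ :=
  ∏ i, (∑ a, MvPolynomial.C (ζ i (finBasis ℝ E₀ a)) * MvPolynomial.X a) ^ α i

lemma totalDegree_coordPolynomial_le (ζ : ι → E₀ →ₗ[ℝ] ℂ) (α : ι →₀ ℕ) :
    (coordPolynomial ζ α).totalDegree ≤ α.degree := by
  rw [coordPolynomial, Finsupp.degree_eq_sum]
  refine (MvPolynomial.totalDegree_finsetProd _ _).trans (Finset.sum_le_sum fun i _ => ?_)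
  refine (MvPolynomial.totalDegree_pow _ _).trans (mul_le_of_le_one_right (Nat.zero_le _) ?_)
  refine (MvPolynomial.totalDegree_finsetSum _ _).trans (Finset.sup_le fun a _ => ?_)
  refine (MvPolynomial.totalDegree_mul _ _).trans ?_
  rw [MvPolynomial.totalDegree_C, MvPolynomial.totalDegree_X, zero_add]

lemma eval_coordPolynomial (ζ : ι → E₀ →ₗ[ℝ] ℂ) (α : ι →₀ ℕ) (u : E₀) :
    MvPolynomial.eval (fun a => (((finBasis ℝ E₀).repr u a : ℝ) : ℂ)) (coordPolynomial ζ α) =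
      PowAlg.mon (fun i => ζ i u) α := by
  simp only [coordPolynomial, map_prod, map_pow, map_sum, map_mul, MvPolynomial.eval_C,
    MvPolynomial.eval_X, PowAlg.mon]
  refine Finset.prod_congr rfl fun i _ => ?_
  congr 1
  conv_rhs => rw [← (finBasis ℝ E₀).sum_repr u, map_sum]
  refine Finset.sum_congr rfl fun a _ => ?_
  rw [map_smul, Complex.real_smul, mul_comm]

/-- Polynomials in complex linear forms with coefficients in `H^n` are polynomials in real
coordinates. -/
theorem isSobolevPolynomial_of_ev (e : Basis J ℝ E₁) (ζ : ι → E₀ →ₗ[ℝ] ℂ) {n p : ℕ}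
    {f : J → PowAlg ι (SobAlg T l)} (hf : ∀ b, PowAlg.DegreeLe p (f b))
    (hn : ∀ b α, SobAlg.MemHigher n ((f b).coef α)) :
    IsSobolevPolynomial n p fun u (t : AddCircle T) =>
      ∑ b, (SobAlg.eval t (PowAlg.ev (fun i => ζ i u) (f b))).re • e b := by
  -- The coefficient at `y^β` collects those of all monomials in the linear forms; real parts are
  -- taken at the end, the coordinates `y` being real.
  let x : (Fin (finrank ℝ E₀) → ℕ) → J → SobAlg T l := fun β b =>
    ∑ α ∈ PowAlg.idxLe ι p, (coordPolynomial ζ α).coeff (Finsupp.equivFunOnFinite.symm β) •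
      (f b).coef α
  refine ⟨fun β t => ∑ b, (SobAlg.eval t (x β b)).re • e b, fun β => ?_, fun u t => ?_⟩
  · refine SobAlg.memSobolev_of_eval (x := fun j => ∑ b, (((e b : EuclideanSpace ℝ (Fin m)) j : ℝ) :
      ℂ) • (x β b).realPart) (fun j t => ?_) fun j => ?_
    · rw [map_sum]
      simp only [SobAlg.eval_smul, SobAlg.eval_realPart, Submodule.coe_sum, Submodule.coe_smul]
      rw [WithLp.ofLp_sum, Finset.sum_apply]
      push_cast
      exact Finset.sum_congr rfl fun b _ => by
        rw [PiLp.smul_apply, smul_eq_mul]; push_cast; ring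
    · exact SobAlg.MemHigher.sum fun b _ => (SobAlg.MemHigher.sum fun α _ =>
        (hn b α).smul _).realPart.smul _
  · have hb : ∀ b, (SobAlg.eval t (PowAlg.ev (fun i => ζ i u) (f b))).re =
        ∑ d ∈ Finset.range (p + 1), ∑ β ∈ Finset.piAntidiag Finset.univ d,
          (∏ i, (finBasis ℝ E₀).repr u i ^ β i) * (SobAlg.eval t (x β b)).re := by
      intro b
      have h1 : SobAlg.eval t (PowAlg.ev (fun i => ζ i u) (f b)) =
          ∑ d ∈ Finset.range (p + 1), ∑ β ∈ Finset.piAntidiag Finset.univ d,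
          ((∏ i, (finBasis ℝ E₀).repr u i ^ β i : ℝ) : ℂ) * SobAlg.eval t (x β b) := by
        rw [PowAlg.ev_eq_sum (hf b), map_sum]
        have h2 : ∀ α ∈ PowAlg.idxLe ι p, SobAlg.eval t (PowAlg.mon (fun i => ζ i u) α •
            (f b).coef α) = ∑ d ∈ Finset.range (p + 1), ∑ β ∈ Finset.piAntidiag Finset.univ d,
            ((∏ i, (finBasis ℝ E₀).repr u i ^ β i : ℝ) : ℂ) *
              ((coordPolynomial ζ α).coeff (Finsupp.equivFunOnFinite.symm β) *
                SobAlg.eval t ((f b).coef α)) := by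
          intro α hα
          rw [SobAlg.eval_smul, ← eval_coordPolynomial, mvPolynomial_eval_eq_sum
            ((totalDegree_coordPolynomial_le ζ α).trans (PowAlg.mem_idxLe.1 hα)), Finset.sum_mul]
          refine Finset.sum_congr rfl fun d _ => ?_
          rw [Finset.sum_mul]
          refine Finset.sum_congr rfl fun β _ => ?_
          push_cast; ring
        rw [Finset.sum_congr rfl h2, Finset.sum_comm]
        refine Finset.sum_congr rfl fun d _ => ?_
        rw [Finset.sum_comm]
        refine Finset.sum_congr rfl fun β _ => ?_
        simp only [x, map_sum, SobAlg.eval_smul, Finset.mul_sum]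
      rw [h1, Complex.re_sum]
      refine Finset.sum_congr rfl fun d _ => ?_
      rw [Complex.re_sum]
      exact Finset.sum_congr rfl fun β _ => Complex.re_ofReal_mul _ _
    simp only [hb, Finset.sum_smul, Finset.smul_sum, mul_smul]
    rw [Finset.sum_comm]
    refine Finset.sum_congr rfl fun d _ => ?_
    rw [Finset.sum_comm]

end SobolevPolynomials

/-! ### Coordinates adapted to the splitting -/

section AdaptedFrames

/-- A frame together with the linear coordinates `ξ_i` on `E₀` and the basis of `E₁` it belongs to. -/
structure AdaptedFrame {m : ℕ} {E₀ E₁ : Submodule ℝ (EuclideanSpace ℝ (Fin m))}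
    (hE : IsCompl E₀ E₁) (I J : Type*) [Fintype I] [Fintype J] extends Frame m I J where
  /-- The coordinates on `E₀`. -/
  ξ : I → E₀ →ₗ[ℝ] ℂ
  /-- The basis of `E₁`. -/
  e : Basis J ℝ E₁
  ξ_conj : ∀ i u, ξ (σ i) u = (starRingEnd ℂ) (ξ i u)
  coe₀ : ∀ (u : E₀) j, (((u : EuclideanSpace ℝ (Fin m)) j : ℝ) : ℂ) = ∑ i, vec₀ j i * ξ i u
  vec₁_eq : ∀ j b, vec₁ j b = (e b : EuclideanSpace ℝ (Fin m)) j
  proj₀_eq : ∀ i v, ξ i (E₀.projectionOnto E₁ hE v) = ∑ j, proj₀ i j * ((v j : ℝ) : ℂ)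
  proj₁_eq : ∀ b v, e.repr (E₁.projectionOnto E₀ hE.symm v) b = ∑ j, proj₁ b j * v j

lemma linearMap_euclidean_apply {m : ℕ} {F : Type*} [AddCommGroup F] [Module ℝ F]
    (g : EuclideanSpace ℝ (Fin m) →ₗ[ℝ] F) (v : EuclideanSpace ℝ (Fin m)) :
    g v = ∑ j, v j • g (EuclideanSpace.single j 1) := by
  conv_lhs => rw [← (EuclideanSpace.basisFun (Fin m) ℝ).sum_repr v, map_sum]
  simp

/-- The eigenvalues of `L₀` and their complex conjugates. -/
noncomputable def pairedEigenvalue {n : ℕ} (lam : Fin n → ℂ) : Fin n ⊕ Fin n → ℂ :=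
  Sum.elim lam fun i => (starRingEnd ℂ) (lam i)

/-- Eigencoordinates of `L₀` and their conjugates, with a basis of `E₁`, form an adapted frame. -/
theorem exists_adaptedFrame {m : ℕ} {E₀ E₁ : Submodule ℝ (EuclideanSpace ℝ (Fin m))}
    (hE : IsCompl E₀ E₁) {L₀ : E₀ →ₗ[ℝ] E₀} {lam : Fin (finrank ℝ E₀) → ℂ}
    (h : IsDiagonalizedBy L₀ lam) :
    ∃ A : AdaptedFrame hE (Fin (finrank ℝ E₀) ⊕ Fin (finrank ℝ E₀)) (Fin (finrank ℝ E₁)),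
      A.σ = Equiv.sumComm _ _ ∧
      ∀ i u, A.ξ i (L₀ u) = pairedEigenvalue lam i * A.ξ i u := by
  obtain ⟨x, hx, hspan, -⟩ := exists_eigenCoordinates h
  choose v hv using fun j : Fin m => hspan
    (Complex.ofRealCLM.toLinearMap.comp ((EuclideanSpace.proj j).toLinearMap.comp E₀.subtype))
  let ξ : Fin (finrank ℝ E₀) ⊕ Fin (finrank ℝ E₀) → E₀ →ₗ[ℝ] ℂ :=
    Sum.elim x fun i => Complex.conjAe.toLinearMap.comp (x i)
  have hv' : ∀ (u : E₀) j, (((u : EuclideanSpace ℝ (Fin m)) j : ℝ) : ℂ) = ∑ i, v j i * x i u :=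
    fun u j => hv j u
  have hξl : ∀ i u, ξ (Sum.inl i) u = x i u := fun _ _ => rfl
  have hξr : ∀ i u, ξ (Sum.inr i) u = (starRingEnd ℂ) (x i u) := fun _ _ => rfl
  have hξc : ∀ i u, ξ (Sum.swap i) u = (starRingEnd ℂ) (ξ i u) := by
    rintro (i | i) u
    · exact hξr i u
    · rw [hξr, Complex.conj_conj]; rfl
  -- A vector of `E₀` is recovered half from its coordinates and half from their conjugates, which
  -- makes the representation invariant under conjugation.
  let w : Fin m → Fin (finrank ℝ E₀) ⊕ Fin (finrank ℝ E₀) → ℂ := fun j =>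
    Sum.elim (fun i => (1 / 2) * v j i) fun i => (starRingEnd ℂ) ((1 / 2) * v j i)
  refine ⟨{
    σ := Equiv.sumComm _ _
    vec₀ := w
    vec₁ := fun j b => (finBasis ℝ E₁ b : EuclideanSpace ℝ (Fin m)) j
    proj₀ := fun i j => ξ i (E₀.projectionOnto E₁ hE (EuclideanSpace.single j 1))
    proj₁ := fun b j => (finBasis ℝ E₁).repr
      (E₁.projectionOnto E₀ hE.symm (EuclideanSpace.single j 1)) b
    vec₀_conj := ?_
    proj₀_conj := fun i j => hξc i _
    ξ := ξ
    e := finBasis ℝ E₁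
    ξ_conj := hξc
    coe₀ := ?_
    vec₁_eq := fun _ _ => rfl
    proj₀_eq := ?_
    proj₁_eq := ?_ }, rfl, ?_⟩
  · rintro j (i | i)
    · rfl
    · exact (Complex.conj_conj _).symm
  · intro u j
    rw [Fintype.sum_sum_type]
    have h2 : ∑ i, w j (Sum.inr i) * ξ (Sum.inr i) u =
        (starRingEnd ℂ) (∑ i, w j (Sum.inl i) * ξ (Sum.inl i) u) := by
      rw [map_sum]
      exact Finset.sum_congr rfl fun i _ => (map_mul _ _ _).symm
    have h1 : ∑ i, w j (Sum.inl i) * ξ (Sum.inl i) u =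
        (((1 / 2) * (u : EuclideanSpace ℝ (Fin m)) j : ℝ) : ℂ) := by
      push_cast
      rw [hv', Finset.mul_sum]
      exact Finset.sum_congr rfl fun i _ => mul_assoc _ _ _
    rw [h2, h1, Complex.conj_ofReal]
    push_cast; ring
  · intro i v
    have := linearMap_euclidean_apply ((ξ i).comp (E₀.projectionOnto E₁ hE)) v
    simp only [LinearMap.comp_apply, Complex.real_smul] at this
    rw [this]
    exact Finset.sum_congr rfl fun j _ => mul_comm _ _
  · intro b v
    have := linearMap_euclidean_apply (((finBasis ℝ E₁).coord b).comp
      (E₁.projectionOnto E₀ hE.symm)) v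
    simp only [LinearMap.comp_apply, Basis.coord_apply, smul_eq_mul] at this
    rw [this]
    exact Finset.sum_congr rfl fun j _ => mul_comm _ _
  · rintro (i | i) u
    · exact hx i u
    · show (starRingEnd ℂ) (x i (L₀ u)) = (starRingEnd ℂ) (lam i) * (starRingEnd ℂ) (x i u)
      rw [hx, map_mul]

end AdaptedFrames

/-! ### The truncated inverse of the homological operator -/

section TruncatedSymbol

variable {I J : Type*} [Fintype I] [Fintype J]

/-- The multi-indices that do not involve the variables labelled by `J`. -/
def IsFree (α : (I ⊕ J) →₀ ℕ) : Prop := ∀ b, α (Sum.inr b) = 0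

/-- The multi-indices on which the homological equation is solved. -/
def InRange (p : ℕ) (α : (I ⊕ J) →₀ ℕ) : Prop := IsFree α ∧ 2 ≤ α.degree ∧ α.degree ≤ p

variable {m : ℕ} [DecidableEq J] {W : Type*} [AddCommGroup W] [Module ℝ W]

open scoped Classical in
/-- The inverse of the homological operator, truncated. -/
noncomputable def truncatedResolvent (e : Basis J ℝ W) (f : W →ₗ[ℝ] W) (T : ℝ) (Λ : I → ℂ) (p : ℕ)
    (b b' : J) (α : (I ⊕ J) →₀ ℕ) (k : ℤ) : ℂ :=
  if InRange p α then resolventMatrix e f (freq T (Sum.elim Λ 0) α k) b b' else 0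

lemma freq_permIdx (fr : Frame m I J) {T : ℝ} {Λ : I → ℂ}
    (hΛ : ∀ i, Λ (fr.σ i) = (starRingEnd ℂ) (Λ i)) (α : (I ⊕ J) →₀ ℕ) (k : ℤ) :
    freq T (Sum.elim Λ 0) (PowAlg.permIdx fr.perm α) (-k) =
      (starRingEnd ℂ) (freq T (Sum.elim Λ 0) α k) := by
  have h1 : (starRingEnd ℂ) (Complex.I * k * (2 * Real.pi / T)) =
      Complex.I * ((-k : ℤ) : ℂ) * (2 * Real.pi / T) := by
    simp only [map_mul, map_div₀, Complex.conj_I, Complex.conj_ofReal, map_intCast]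
    rw [show (starRingEnd ℂ) (2 : ℂ) = 2 from Complex.conj_ofNat 2]
    push_cast; ring
  rw [freq, freq, map_add, h1, map_sum]
  congr 1
  have h2 := Equiv.sum_comp fr.perm fun i => (starRingEnd ℂ) ((α i : ℂ) * Sum.elim Λ 0 i)
  rw [← h2]
  refine Finset.sum_congr rfl fun i _ => ?_
  rw [PowAlg.permIdx_apply, map_mul, Complex.conj_natCast]
  congr 1
  rcases i with i | b
  · show Λ i = (starRingEnd ℂ) (Λ (fr.σ i))
    rw [hΛ, Complex.conj_conj]
  · exact (map_zero _).symm

lemma inRange_permIdx (fr : Frame m I J) {p : ℕ} {α : (I ⊕ J) →₀ ℕ} :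
    InRange p (PowAlg.permIdx fr.perm α) ↔ InRange p α := by
  rw [InRange, InRange, PowAlg.degree_permIdx]
  exact Iff.rfl

/-- The non-resonance condition in the doubled set of coordinates. -/
lemma NonResonant.freq_bound {T : ℝ} {n : ℕ} {lam : Fin n → ℂ} {f : W →ₗ[ℝ] W} {τ : ℝ}
    (hlam : ∀ i, ∃ j, lam j = (starRingEnd ℂ) (lam i)) {γ : ℝ}
    (hres : ∀ (a : Fin n → ℕ) (k : ℤ) (μ : ℂ), (a ≠ 0 ∨ k ≠ 0) →
      End.HasEigenvalue (f.baseChange ℂ) μ →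
      γ / ((∑ j, (a j : ℝ)) + |(k : ℝ)|) ^ τ ≤
        ‖(∑ j, (a j : ℂ) * lam j) + Complex.I * k * (2 * Real.pi / T) - μ‖)
    {α : ((Fin n ⊕ Fin n) ⊕ J) →₀ ℕ} (hα : IsFree α) (hα0 : α ≠ 0) (k : ℤ) {μ : ℂ}
    (hμ : End.HasEigenvalue (f.baseChange ℂ) μ) :
    γ / ((α.degree : ℝ) + |(k : ℝ)|) ^ τ ≤
      ‖freq T (Sum.elim (pairedEigenvalue lam) 0) α k - μ‖ := by
  -- The conjugate of `lam i` is `lam (π i)`: move the exponents of the conjugate coordinates along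
  -- `π`. The total degree and the frequency do not change.
  choose π hπ using hlam
  let a : Fin n → ℕ := fun j => α (Sum.inl (Sum.inl j)) +
    ∑ i, if π i = j then α (Sum.inl (Sum.inr i)) else 0
  have hdeg : ∑ j, a j = α.degree := by
    rw [Finsupp.degree_eq_sum, Fintype.sum_sum_type, Fintype.sum_sum_type]
    simp only [a, Finset.sum_add_distrib]
    rw [Finset.sum_comm]
    have : ∑ b, α (Sum.inr b) = 0 := Finset.sum_eq_zero fun b _ => hα b
    simp [this]
  have hsum : ∑ j, (a j : ℂ) * lam j =
      ∑ i, (α i : ℂ) * (Sum.elim (pairedEigenvalue lam) 0 : _ → ℂ) i := by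
    rw [Fintype.sum_sum_type, Fintype.sum_sum_type]
    have h1 : ∀ j, (a j : ℂ) * lam j = (α (Sum.inl (Sum.inl j)) : ℂ) * lam j +
        ∑ i, if π i = j then (α (Sum.inl (Sum.inr i)) : ℂ) * lam j else 0 := fun j => by
      simp only [a]
      push_cast
      rw [add_mul, Finset.sum_mul]
      simp only [ite_mul, zero_mul]
    simp only [h1, Finset.sum_add_distrib]
    rw [Finset.sum_comm]
    simp [hπ, pairedEigenvalue]
  have ha : a ≠ 0 := by
    intro h
    rw [h] at hdeg
    simp only [Pi.zero_apply, Finset.sum_const_zero] at hdeg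
    exact hα0 ((Finsupp.degree_eq_zero_iff α).1 hdeg.symm)
  have h := hres a k μ (Or.inl ha) hμ
  rw [freq, ← hsum, ← hdeg]
  push_cast
  exact h

end TruncatedSymbol

/-! ### Values of the formal objects at points -/

section Evaluation

variable {m l : ℕ} {T : ℝ} [hT : Fact (0 < T)] [hl : Fact (1 ≤ l)] {I J : Type*} [Fintype I]
  [Fintype J] [DecidableEq I] [DecidableEq J]

namespace PowAlg

omit [DecidableEq I] [DecidableEq J] in
lemma ev_congr_of_free {H : Type*} [NormedCommRing H] [NormedAlgebra ℂ H] {f : PowAlg (I ⊕ J) H}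
    (hf : ∀ α, ¬ IsFree α → f.coef α = 0) {ζ ζ' : I ⊕ J → ℂ}
    (h : ∀ i, ζ (Sum.inl i) = ζ' (Sum.inl i)) : ev ζ f = ev ζ' f := by
  refine tsum_congr fun α => ?_
  by_cases hα : IsFree α
  · have : mon ζ α = mon ζ' α := by
      rw [mon, mon, Fintype.prod_sum_type, Fintype.prod_sum_type]
      simp only [h, hα _, pow_zero]
    rw [this]
  · rw [hf α hα, smul_zero, smul_zero]

omit hT in
lemma ev_sub {H : Type*} [NormedCommRing H] [NormedAlgebra ℂ H] [CompleteSpace H]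
    {ζ : I → ℂ} (hζ : ∀ i, ‖ζ i‖ ≤ 1) (f g : PowAlg I H) :
    ev ζ (f - g) = ev ζ f - ev ζ g := map_sub (evHom ζ hζ) f g

omit hT in
lemma ev_add {H : Type*} [NormedCommRing H] [NormedAlgebra ℂ H] [CompleteSpace H]
    {ζ : I → ℂ} (hζ : ∀ i, ‖ζ i‖ ≤ 1) (f g : PowAlg I H) :
    ev ζ (f + g) = ev ζ f + ev ζ g := map_add (evHom ζ hζ) f g

omit hT in
lemma ev_mul {H : Type*} [NormedCommRing H] [NormedAlgebra ℂ H] [CompleteSpace H]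
    {ζ : I → ℂ} (hζ : ∀ i, ‖ζ i‖ ≤ 1) (f g : PowAlg I H) :
    ev ζ (f * g) = ev ζ f * ev ζ g := map_mul (evHom ζ hζ) f g

omit hT in
lemma ev_sum {H : Type*} [NormedCommRing H] [NormedAlgebra ℂ H] [CompleteSpace H]
    {ζ : I → ℂ} (hζ : ∀ i, ‖ζ i‖ ≤ 1) {κ : Type*} (s : Finset κ) (f : κ → PowAlg I H) :
    ev ζ (∑ k ∈ s, f k) = ∑ k ∈ s, ev ζ (f k) := map_sum (evHom ζ hζ) f s

/-- Invariant power series take real values at conjugation invariant points. -/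
lemma eval_ev_eq_re (σ : Equiv.Perm I) {ζ : I → ℂ} (hζ : ∀ i, ‖ζ i‖ ≤ 1)
    (hσ : ∀ i, ζ (σ i) = (starRingEnd ℂ) (ζ i)) (t : AddCircle T) {f : PowAlg I (SobAlg T l)}
    (hf : conj σ f = f) :
    SobAlg.eval t (ev ζ f) = (((SobAlg.eval t (ev ζ f)).re : ℝ) : ℂ) := by
  have h := eval_ev_conj σ hζ hσ t f
  rw [hf] at h
  exact (Complex.conj_eq_iff_re.1 h.symm).symm

end PowAlg

namespace Frame

variable (fr : Frame m I J)

lemma ev_point {ζ : I ⊕ J → ℂ} (hζ : ∀ i, ‖ζ i‖ ≤ 1) (r : ℝ)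
    (Ψ : J → PowAlg (I ⊕ J) (SobAlg T l)) (j : Fin m) :
    PowAlg.ev ζ (fr.point r Ψ j) = (∑ i, fr.vec₀ j i * (r * ζ (Sum.inl i))) • (1 : SobAlg T l) +
      ∑ b, ((fr.vec₁ j b : ℝ) : ℂ) • PowAlg.ev ζ (Ψ b) := by
  rw [point, PowAlg.ev_add hζ, PowAlg.ev_sum hζ, PowAlg.ev_sum hζ]
  simp only [PowAlg.ev_smul, PowAlg.ev_X]
  rw [Finset.sum_smul]
  congr 1
  refine Finset.sum_congr rfl fun i _ => ?_
  rw [smul_smul]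
  congr 1
  ring

lemma ev_field {ζ : I ⊕ J → ℂ} (hζ : ∀ i, ‖ζ i‖ ≤ 1) (p : ℕ) (r : ℝ)
    (Φ : J → PowAlg (I ⊕ J) (SobAlg T l)) (v : Fin m → PowAlg (I ⊕ J) (SobAlg T l)) (b : J) :
    PowAlg.ev ζ (fr.field p r Φ v b) = (∑ j, ((fr.proj₁ b j : ℝ) : ℂ) • PowAlg.ev ζ (v j)) -
      ∑ i, ((r⁻¹ : ℝ) : ℂ) • (PowAlg.ev ζ (PowAlg.pderiv p (Sum.inl i) (Φ b)) *
        ∑ j, fr.proj₀ i j • PowAlg.ev ζ (v j)) := by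
  rw [field, PowAlg.ev_sub hζ, PowAlg.ev_sum hζ, PowAlg.ev_sum hζ]
  simp only [PowAlg.ev_smul, PowAlg.ev_mul hζ, PowAlg.ev_sum hζ]

end Frame

namespace AdaptedFrame

variable {E₀ E₁ : Submodule ℝ (EuclideanSpace ℝ (Fin m))} {hE : IsCompl E₀ E₁}
  (A : AdaptedFrame hE I J)

omit [DecidableEq I] [DecidableEq J] in
lemma coe₁ (w : E₁) (j : Fin m) :
    (w : EuclideanSpace ℝ (Fin m)) j = ∑ b, A.vec₁ j b * A.e.repr w b := by
  conv_lhs => rw [← A.e.sum_repr w]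
  rw [Submodule.coe_sum, WithLp.ofLp_sum, Finset.sum_apply]
  refine Finset.sum_congr rfl fun b _ => ?_
  rw [A.vec₁_eq, Submodule.coe_smul, PiLp.smul_apply, smul_eq_mul, mul_comm]

lemma eval_ev_point {ζ : I ⊕ J → ℂ} (hζ : ∀ i, ‖ζ i‖ ≤ 1) {r : ℝ} (hr : r ≠ 0) {u : E₀}
    (hu : ∀ i, ζ (Sum.inl i) = ((r⁻¹ : ℝ) : ℂ) * A.ξ i u) {t : AddCircle T}
    {Ψ : J → PowAlg (I ⊕ J) (SobAlg T l)} {w : E₁}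
    (hw : ∀ b, SobAlg.eval t (PowAlg.ev ζ (Ψ b)) = ((A.e.repr w b : ℝ) : ℂ)) (j : Fin m) :
    SobAlg.eval t (PowAlg.ev ζ (A.point r Ψ j)) =
      ((((u : EuclideanSpace ℝ (Fin m)) + (w : EuclideanSpace ℝ (Fin m))) j : ℝ) : ℂ) := by
  have hr' : (r : ℂ) ≠ 0 := Complex.ofReal_ne_zero.2 hr
  rw [Frame.ev_point _ hζ, map_add, SobAlg.eval_smul, map_one, mul_one, map_sum]
  simp only [SobAlg.eval_smul, hw, hu]
  rw [PiLp.add_apply, Complex.ofReal_add, A.coe₀, A.coe₁]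
  push_cast
  congr 1
  refine Finset.sum_congr rfl fun i _ => ?_
  rw [← mul_assoc (r : ℂ), mul_inv_cancel₀ hr', one_mul]

variable {a : Fin m → (q : ℕ) → (Fin q → Fin m) → SobAlg T l} {c ρ : ℝ}

lemma eval_ev_series (ha : ∀ j, WordBound (a j) c ρ) (hρ : 0 < ρ) {r s : ℝ} (hr : 0 < r)
    (hrs : r ≤ s) (hs : 2 * m * (A.boundVec T l * s) ≤ ρ) {ζ : I ⊕ J → ℂ} (hζ : ∀ i, ‖ζ i‖ ≤ 1)
    {u : E₀} (hu : ∀ i, ζ (Sum.inl i) = ((r⁻¹ : ℝ) : ℂ) * A.ξ i u) {t : AddCircle T}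
    {Ψ : J → PowAlg (I ⊕ J) (SobAlg T l)} (hΨ : ∀ b, ‖Ψ b‖ ≤ s) {w : E₁}
    (hw : ∀ b, SobAlg.eval t (PowAlg.ev ζ (Ψ b)) = ((A.e.repr w b : ℝ) : ℂ)) {x : ℝ} {j : Fin m}
    (hx : (x : ℂ) = wordSeries (fun q J => SobAlg.eval t (a j q J)) fun k =>
      ((((u : EuclideanSpace ℝ (Fin m)) + (w : EuclideanSpace ℝ (Fin m))) k : ℝ) : ℂ)) :
    SobAlg.eval t (PowAlg.ev ζ (Frame.series a (A.point r Ψ) j)) = (x : ℂ) := by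
  have h := (Frame.wordBound_C (I := I) (J := J) ha j).map_wordSeries hρ
    (mul_nonneg A.boundVec_nonneg (hr.le.trans hrs)) hs
    (A.norm_point_le hr.le hrs hΨ) ((SobAlg.eval t).comp (PowAlg.evHom ζ hζ).toRingHom)
    ((SobAlg.continuous_eval t).comp (PowAlg.continuous_evHom ζ hζ))
  rw [hx]
  refine h.trans ?_
  congr 1
  · funext q w
    exact congrArg (SobAlg.eval t) (PowAlg.ev_C ζ _)
  · funext k
    exact A.eval_ev_point hζ hr.ne' hu hw k

lemma eval_ev_field {ζ : I ⊕ J → ℂ} (hζ : ∀ i, ‖ζ i‖ ≤ 1) (p : ℕ) (r : ℝ) {t : AddCircle T}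
    (Φ : J → PowAlg (I ⊕ J) (SobAlg T l)) {v : Fin m → PowAlg (I ⊕ J) (SobAlg T l)}
    {x : EuclideanSpace ℝ (Fin m)}
    (hv : ∀ j, SobAlg.eval t (PowAlg.ev ζ (v j)) = ((x j : ℝ) : ℂ)) (b : J) :
    SobAlg.eval t (PowAlg.ev ζ (A.field p r Φ v b)) =
      ((A.e.repr (E₁.projectionOnto E₀ hE.symm x) b : ℝ) : ℂ) -
      ∑ i, ((r⁻¹ : ℝ) : ℂ) * A.ξ i (E₀.projectionOnto E₁ hE x) *
        SobAlg.eval t (PowAlg.ev ζ (PowAlg.pderiv p (Sum.inl i) (Φ b))) := by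
  rw [Frame.ev_field _ hζ, map_sub, map_sum, map_sum, A.proj₁_eq]
  simp only [SobAlg.eval_smul, map_mul, map_sum, hv, A.proj₀_eq]
  push_cast
  congr 1
  refine Finset.sum_congr rfl fun i _ => ?_
  ring

end AdaptedFrame
end Evaluation

/-! ### Solutions of the homological equation -/

section HomologicalEquation

variable {m l : ℕ} {T : ℝ} [hT : Fact (0 < T)] [hl : Fact (1 ≤ l)] {I J : Type*} [Fintype I]
  [Fintype J] [DecidableEq I] [DecidableEq J]

open scoped Classical in
/-- The part of a power series with multi-indices in a set. -/
noncomputable def PowAlg.part (P : Set ((I ⊕ J) →₀ ℕ)) (f : PowAlg (I ⊕ J) (SobAlg T l)) :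
    PowAlg (I ⊕ J) (SobAlg T l) :=
  PowAlg.symb (fun α _ => if α ∈ P then 1 else 0) f

open scoped Classical in
lemma PowAlg.coef_part (P : Set ((I ⊕ J) →₀ ℕ)) (f : PowAlg (I ⊕ J) (SobAlg T l))
    (α : (I ⊕ J) →₀ ℕ) : (part P f).coef α = if α ∈ P then f.coef α else 0 := by
  have h : ∀ (α : (I ⊕ J) →₀ ℕ) (_ : ℤ), ‖(if α ∈ P then 1 else 0 : ℂ)‖ ≤ 1 := fun α _ => by
    split_ifs <;> simp
  refine SobAlg.ext fun k => ?_
  rw [part, coef_symb h]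
  split_ifs
  · rw [one_mul]
  · rw [zero_mul, SobAlg.coef_zero]

lemma PowAlg.norm_part_le (P : Set ((I ⊕ J) →₀ ℕ)) (f : PowAlg (I ⊕ J) (SobAlg T l)) :
    ‖part P f‖ ≤ ‖f‖ := by
  classical
  have h : ∀ (α : (I ⊕ J) →₀ ℕ) (_ : ℤ), ‖(if α ∈ P then 1 else 0 : ℂ)‖ ≤ 1 := fun α _ => by
    split_ifs <;> simp
  refine (norm_symb_le (b := fun α _ => if α ∈ P then 1 else 0) h f).trans_eq (one_mul _)

variable {W : Type*} [AddCommGroup W] [Module ℝ W] {e : Basis J ℝ W} {f : W →ₗ[ℝ] W} {Λ : I → ℂ}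
  {p : ℕ} {Φ F : J → PowAlg (I ⊕ J) (SobAlg T l)} {Kb : ℝ}

/-- The image of the solution of the homological equation under `∂_t + D·Λ`. -/
noncomputable def transport (e : Basis J ℝ W) (f : W →ₗ[ℝ] W) (p : ℕ)
    (Φ F : J → PowAlg (I ⊕ J) (SobAlg T l)) (b : J) : PowAlg (I ⊕ J) (SobAlg T l) :=
  (∑ b', ((LinearMap.toMatrix e e f b b' : ℝ) : ℂ) • Φ b') + PowAlg.part {α : (I ⊕ J) →₀ ℕ | InRange p α} (F b)

lemma coef_solution (hK : ∀ b b' α k, ‖truncatedResolvent e f T Λ p b b' α k‖ ≤ Kb)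
    (hΦ : ∀ b, Φ b = ∑ b', PowAlg.symb (truncatedResolvent e f T Λ p b b') (F b')) (b : J)
    (α : (I ⊕ J) →₀ ℕ) (k : ℤ) :
    ((Φ b).coef α).coef k = ∑ b', truncatedResolvent e f T Λ p b b' α k *
      ((F b').coef α).coef k := by
  have hs : ∀ (s : Finset J) (x : J → SobAlg T l), (∑ j ∈ s, x j).coef k = ∑ j ∈ s, (x j).coef k :=
    fun s x => map_sum (AddMonoidHom.mk' (fun y : SobAlg T l => y.coef k)
      fun y z => SobAlg.coef_add y z k) x s
  rw [hΦ, PowAlg.coef_sum, hs]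
  exact Finset.sum_congr rfl fun b' _ => PowAlg.coef_symb (hK b b') _ _ _

lemma coef_solution_of_not_inRange
    (hK : ∀ b b' α k, ‖truncatedResolvent e f T Λ p b b' α k‖ ≤ Kb)
    (hΦ : ∀ b, Φ b = ∑ b', PowAlg.symb (truncatedResolvent e f T Λ p b b') (F b')) (b : J)
    {α : (I ⊕ J) →₀ ℕ} (hα : ¬ InRange p α) : (Φ b).coef α = 0 := by
  refine SobAlg.ext fun k => ?_
  rw [coef_solution hK hΦ, SobAlg.coef_zero]
  refine Finset.sum_eq_zero fun b' _ => ?_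
  rw [truncatedResolvent, if_neg hα, zero_mul]

/-- The homological equation `(∂_t + D·Λ) Φ = L₁ Φ + F` up to degree `p`. -/
theorem coef_transport (hK : ∀ b b' α k, ‖truncatedResolvent e f T Λ p b b' α k‖ ≤ Kb)
    (hinv : ∀ α : (I ⊕ J) →₀ ℕ, InRange p α → ∀ k : ℤ,
      (freq T (Sum.elim Λ 0) α k • (1 : Matrix J J ℂ) -
        (LinearMap.toMatrix e e f).map (algebraMap ℝ ℂ)) *
        resolventMatrix e f (freq T (Sum.elim Λ 0) α k) = 1)
    (hΦ : ∀ b, Φ b = ∑ b', PowAlg.symb (truncatedResolvent e f T Λ p b b') (F b')) (b : J)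
    (α : (I ⊕ J) →₀ ℕ) (k : ℤ) :
    ((transport e f p Φ F b).coef α).coef k =
      freq T (Sum.elim Λ 0) α k * ((Φ b).coef α).coef k := by
  have hs : ∀ (s : Finset J) (x : J → SobAlg T l), (∑ j ∈ s, x j).coef k = ∑ j ∈ s, (x j).coef k :=
    fun s x => map_sum (AddMonoidHom.mk' (fun y : SobAlg T l => y.coef k)
      fun y z => SobAlg.coef_add y z k) x s
  rw [transport, PowAlg.coef_add, SobAlg.coef_add, PowAlg.coef_sum, hs, PowAlg.coef_part]
  simp only [PowAlg.coef_smul, SobAlg.coef_smul]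
  by_cases hα : InRange p α
  · rw [if_pos (show α ∈ {α : (I ⊕ J) →₀ ℕ | InRange p α} from hα)]
    set s := freq T (Sum.elim Λ 0) α k with hsdef
    let y : J → ℂ := fun b => ((F b).coef α).coef k
    -- On each Fourier mode of each monomial, the equation says that `Φ` is the resolvent matrix
    -- applied to `F`.
    have hx : (fun b => ((Φ b).coef α).coef k) = (resolventMatrix e f s).mulVec y := by
      funext b
      rw [coef_solution hK hΦ]
      refine Finset.sum_congr rfl fun b' _ => ?_
      rw [truncatedResolvent, if_pos hα]
    have h1 := congrArg (fun M : Matrix J J ℂ => M.mulVec y) (hinv α hα k)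
    simp only [Matrix.one_mulVec, ← Matrix.mulVec_mulVec, ← hsdef, ← hx] at h1
    have h2 := congrFun h1 b
    rw [Matrix.sub_mulVec, Matrix.smul_mulVec, Matrix.one_mulVec, Pi.sub_apply, Pi.smul_apply,
      smul_eq_mul] at h2
    have h3 : ((LinearMap.toMatrix e e f).map (algebraMap ℝ ℂ)).mulVec
        (fun b => ((Φ b).coef α).coef k) b =
        ∑ j, ((LinearMap.toMatrix e e f b j : ℝ) : ℂ) * ((Φ j).coef α).coef k := rfl
    rw [h3] at h2
    linear_combination -h2
  · rw [if_neg (show α ∉ {α : (I ⊕ J) →₀ ℕ | InRange p α} from hα)]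
    simp only [coef_solution_of_not_inRange hK hΦ _ hα, SobAlg.coef_zero, mul_zero,
      Finset.sum_const_zero, add_zero]

/-- The solution of the homological equation has one more derivative in time. -/
theorem memHigher_solution (hK : ∀ b b' α k, ‖truncatedResolvent e f T Λ p b b' α k‖ ≤ Kb)
    {K' : ℝ} (hK' : ∀ b b' α (k : ℤ), |(k : ℝ)| * ‖truncatedResolvent e f T Λ p b b' α k‖ ≤ K')
    (hΦ : ∀ b, Φ b = ∑ b', PowAlg.symb (truncatedResolvent e f T Λ p b b') (F b')) (b : J)
    (α : (I ⊕ J) →₀ ℕ) : SobAlg.MemHigher (l + 1) ((Φ b).coef α) := by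
  rw [hΦ, PowAlg.coef_sum]
  refine SobAlg.MemHigher.sum fun b' _ => ?_
  refine Summable.of_nonneg_of_le (fun k => by positivity) (fun k => ?_)
    (((F b').coef α).hasSum_coef.summable.mul_left (Kb ^ 2 + K' ^ 2))
  rw [PowAlg.coef_symb (hK b b'), norm_mul, sobWeight_sq, sobWeight_sq]
  set x := ‖truncatedResolvent e f T Λ p b b' α k‖
  -- Split the additional weight `1 + k²` between the two bounds for the symbol.
  have h1 : x ^ 2 ≤ Kb ^ 2 := pow_le_pow_left₀ (norm_nonneg _) (hK b b' α k) 2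
  have h2 : (|(k : ℝ)| * x) ^ 2 ≤ K' ^ 2 :=
    pow_le_pow_left₀ (mul_nonneg (abs_nonneg _) (norm_nonneg _)) (hK' b b' α k) 2
  rw [mul_pow, sq_abs] at h2
  have h3 : 0 ≤ (1 + (k : ℝ) ^ 2) ^ l * ‖((F b').coef α).coef k‖ ^ 2 := by positivity
  calc (1 + (k : ℝ) ^ 2) ^ (l + 1) * (x * ‖((F b').coef α).coef k‖) ^ 2
      = (x ^ 2 + k ^ 2 * x ^ 2) * ((1 + (k : ℝ) ^ 2) ^ l * ‖((F b').coef α).coef k‖ ^ 2) := by ring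
    _ ≤ _ := mul_le_mul_of_nonneg_right (add_le_add h1 h2) h3

end HomologicalEquation

/-! ### The normal form and its remainder -/

section NormalForm

variable {m l : ℕ} {T : ℝ} [hT : Fact (0 < T)] [hl : Fact (1 ≤ l)] {I J : Type*} [Fintype I]
  [Fintype J] [DecidableEq I] [DecidableEq J]
  {E₀ E₁ : Submodule ℝ (EuclideanSpace ℝ (Fin m))} {hE : IsCompl E₀ E₁}

namespace AdaptedFrame

variable (A : AdaptedFrame hE I J)

/-- The scaled coordinates on `E₀ × E₁` that are substituted for the variables. -/
noncomputable def coords (r δ₁ : ℝ) : I ⊕ J → (E₀ × E₁) →ₗ[ℝ] ℂ :=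
  Sum.elim (fun i => (r⁻¹ : ℝ) • (A.ξ i).comp (LinearMap.fst ℝ E₀ E₁)) fun b =>
    (δ₁⁻¹ : ℝ) • Complex.ofRealCLM.toLinearMap.comp ((A.e.coord b).comp (LinearMap.snd ℝ E₀ E₁))

omit [DecidableEq I] [DecidableEq J] in
lemma coords_inl (r δ₁ : ℝ) (i : I) (x : E₀ × E₁) :
    A.coords r δ₁ (Sum.inl i) x = ((r⁻¹ : ℝ) : ℂ) * A.ξ i x.1 := rfl

omit [DecidableEq I] [DecidableEq J] in
lemma coords_inr (r δ₁ : ℝ) (b : J) (x : E₀ × E₁) :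
    A.coords r δ₁ (Sum.inr b) x = ((δ₁⁻¹ : ℝ) : ℂ) * ((A.e.repr x.2 b : ℝ) : ℂ) := rfl

omit [DecidableEq I] [DecidableEq J] in
lemma coords_perm (r δ₁ : ℝ) (i : I ⊕ J) (x : E₀ × E₁) :
    A.coords r δ₁ (A.perm i) x = (starRingEnd ℂ) (A.coords r δ₁ i x) := by
  rcases i with i | b
  · have h : A.perm (Sum.inl i : I ⊕ J) = Sum.inl (A.σ i) := rfl
    rw [h, coords_inl, coords_inl, map_mul, Complex.conj_ofReal, A.ξ_conj]
  · have h : A.perm (Sum.inr b : I ⊕ J) = Sum.inr b := rfl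
    rw [h, coords_inr, map_mul, Complex.conj_ofReal, Complex.conj_ofReal]

/-- The vector of `E₁` whose components are the (real parts of the) values at `x` and `t` of given
power series. -/
noncomputable def value (r δ₁ : ℝ) (f : J → PowAlg (I ⊕ J) (SobAlg T l)) (x : E₀ × E₁)
    (t : AddCircle T) : E₁ :=
  ∑ b, (SobAlg.eval t (PowAlg.ev (fun i => A.coords r δ₁ i x) (f b))).re • A.e b

lemma repr_value (r δ₁ : ℝ) (f : J → PowAlg (I ⊕ J) (SobAlg T l)) (x : E₀ × E₁)
    (t : AddCircle T) (b : J) : A.e.repr (A.value r δ₁ f x t) b =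
      (SobAlg.eval t (PowAlg.ev (fun i => A.coords r δ₁ i x) (f b))).re := by
  rw [value, Basis.repr_sum_self]

lemma repr_value_of_conj {r δ₁ : ℝ} {f : J → PowAlg (I ⊕ J) (SobAlg T l)} {x : E₀ × E₁}
    (hx : ∀ i, ‖A.coords r δ₁ i x‖ ≤ 1) (t : AddCircle T) {b : J}
    (hf : PowAlg.conj A.perm (f b) = f b) :
    SobAlg.eval t (PowAlg.ev (fun i => A.coords r δ₁ i x) (f b)) =
      ((A.e.repr (A.value r δ₁ f x t) b : ℝ) : ℂ) := by
  rw [repr_value]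
  exact PowAlg.eval_ev_eq_re A.perm hx (fun i => A.coords_perm r δ₁ i x) t hf

/-- The components in `ℝᵐ` of the vector of `E₁` given by power series. -/
lemma coe_value {r δ₁ : ℝ} {f : J → PowAlg (I ⊕ J) (SobAlg T l)} {x : E₀ × E₁}
    (hx : ∀ i, ‖A.coords r δ₁ i x‖ ≤ 1) (t : AddCircle T)
    (hf : ∀ b, PowAlg.conj A.perm (f b) = f b) (j : Fin m) :
    (((A.value r δ₁ f x t : EuclideanSpace ℝ (Fin m)) j : ℝ) : ℂ) =
      SobAlg.eval t (PowAlg.ev (fun i => A.coords r δ₁ i x)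
        (∑ b, ((A.vec₁ j b : ℝ) : ℂ) • f b)) := by
  rw [PowAlg.ev_sum hx, map_sum, A.coe₁]
  push_cast
  refine Finset.sum_congr rfl fun b _ => ?_
  rw [PowAlg.ev_smul, SobAlg.eval_smul, A.repr_value_of_conj hx t (hf b)]

lemma norm_vec₁_sum_le {B : Type*} [SeminormedAddCommGroup B] [NormedSpace ℂ B] {f : J → B} {M : ℝ}
    (hM : 0 ≤ M) (hf : ∀ b, ‖f b‖ ≤ M) :
    ∑ j, ‖∑ b, ((A.vec₁ j b : ℝ) : ℂ) • f b‖ ≤ m * (A.boundVec T l * M) := by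
  refine (Finset.sum_le_card_nsmul _ _ (A.boundVec T l * M) fun j _ => ?_).trans
    (le_of_eq (by simp))
  exact (norm_sum_smul_le _ hf).trans
    (mul_le_mul_of_nonneg_right (A.sum_vec₁_le j) hM)

/-- The vector field along `Φ`. -/
noncomputable abbrev rhs (a : Fin m → (q : ℕ) → (Fin q → Fin m) → SobAlg T l) (p : ℕ) (r : ℝ)
    (Φ : J → PowAlg (I ⊕ J) (SobAlg T l)) : J → PowAlg (I ⊕ J) (SobAlg T l) :=
  A.field p r Φ (Frame.series a (A.point r Φ))

/-- The components of `v₁ + Φ`. -/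
noncomputable def shifted (δ₁ : ℝ) (Φ : J → PowAlg (I ⊕ J) (SobAlg T l)) (b : J) :
    PowAlg (I ⊕ J) (SobAlg T l) :=
  Φ b + (δ₁ : ℂ) • PowAlg.X (Sum.inr b)

/-- The difference of the nonlinearity at `u₀ + v₁ + Φ` and at `u₀ + Φ`. -/
noncomputable def increment (a : Fin m → (q : ℕ) → (Fin q → Fin m) → SobAlg T l) (r δ₁ : ℝ)
    (Φ : J → PowAlg (I ⊕ J) (SobAlg T l)) (j : Fin m) : PowAlg (I ⊕ J) (SobAlg T l) :=
  Frame.series a (A.point r (shifted δ₁ Φ)) j - Frame.series a (A.point r Φ) j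

end AdaptedFrame

/-- Power series `Φ_b` in the scaled coordinates that solve the homological equation up to degree `p`
for the nonlinearity with coefficients `a`. -/
structure IsNormalizer (A : AdaptedFrame hE I J) (L₁ : E₁ →ₗ[ℝ] E₁) (Λ : I → ℂ)
    (a : Fin m → (q : ℕ) → (Fin q → Fin m) → SobAlg T l) (c ρ : ℝ) (p : ℕ) (r δ₁ : ℝ)
    (Φ : J → PowAlg (I ⊕ J) (SobAlg T l)) : Prop where
  one_le : 1 ≤ p
  r_pos : 0 < r
  δ₁_pos : 0 < δ₁
  ρ_pos : 0 < ρ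
  wordBound : ∀ j, WordBound (a j) c ρ
  real : ∀ j q w, (a j q w).conj = a j q w
  small : 2 * m * (A.boundVec T l * (r + δ₁ * ‖(1 : SobAlg T l)‖)) ≤ ρ
  norm_le : ∀ b, ‖Φ b‖ ≤ r
  conj_eq : ∀ b, PowAlg.conj A.perm (Φ b) = Φ b
  support : ∀ b α, ¬ InRange p α → (Φ b).coef α = 0
  equation : ∀ b α k, ((transport A.e L₁ p Φ (A.rhs a p r Φ) b).coef α).coef k =
    freq T (Sum.elim Λ 0) α k * ((Φ b).coef α).coef k

namespace IsNormalizer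

variable {A : AdaptedFrame hE I J} {L₁ : E₁ →ₗ[ℝ] E₁} {Λ : I → ℂ}
  {a : Fin m → (q : ℕ) → (Fin q → Fin m) → SobAlg T l} {c ρ : ℝ} {p : ℕ} {r δ₁ : ℝ}
  {Φ : J → PowAlg (I ⊕ J) (SobAlg T l)}

lemma free (h : IsNormalizer A L₁ Λ a c ρ p r δ₁ Φ) (b : J) (α : (I ⊕ J) →₀ ℕ)
    (hα : ¬ IsFree α) : (Φ b).coef α = 0 := h.support b α fun h' => hα h'.1

lemma degreeLe (h : IsNormalizer A L₁ Λ a c ρ p r δ₁ Φ) (b : J) : PowAlg.DegreeLe p (Φ b) :=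
  fun α hα => h.support b α fun h' => absurd h'.2.2 (not_le.2 hα)

lemma orderGe (h : IsNormalizer A L₁ Λ a c ρ p r δ₁ Φ) (b : J) : PowAlg.OrderGe 2 (Φ b) :=
  fun α hα => h.support b α fun h' => absurd h'.2.1 (not_le.2 hα)

lemma pderiv_free (h : IsNormalizer A L₁ Λ a c ρ p r δ₁ Φ) (b : J) (i : I) (α : (I ⊕ J) →₀ ℕ)
    (hα : ¬ IsFree α) : (PowAlg.pderiv p (Sum.inl i) (Φ b)).coef α = 0 := by
  rw [PowAlg.coef_pderiv]
  split_ifs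
  · rw [h.free b _ fun h' => hα fun b' => by
      have := h' b'
      rw [Finsupp.add_apply] at this
      omega, smul_zero]
  · rfl

lemma norm_shifted_le (h : IsNormalizer A L₁ Λ a c ρ p r δ₁ Φ) (b : J) :
    ‖AdaptedFrame.shifted δ₁ Φ b‖ ≤ r + δ₁ * ‖(1 : SobAlg T l)‖ := by
  refine (norm_add_le _ _).trans (add_le_add (h.norm_le b) ?_)
  rw [norm_smul, PowAlg.norm_X, Complex.norm_real, Real.norm_of_nonneg h.δ₁_pos.le]

lemma le_radius (h : IsNormalizer A L₁ Λ a c ρ p r δ₁ Φ) : r ≤ r + δ₁ * ‖(1 : SobAlg T l)‖ :=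
  le_add_of_nonneg_right (mul_nonneg h.δ₁_pos.le (norm_nonneg _))

lemma small' (h : IsNormalizer A L₁ Λ a c ρ p r δ₁ Φ) : 2 * m * (A.boundVec T l * r) ≤ ρ :=
  le_trans (by have := A.boundVec_nonneg (T := T) (l := l); have := h.le_radius; gcongr) h.small

lemma conj_shifted (h : IsNormalizer A L₁ Λ a c ρ p r δ₁ Φ) (b : J) :
    PowAlg.conj A.perm (AdaptedFrame.shifted δ₁ Φ b) = AdaptedFrame.shifted δ₁ Φ b := by
  have hperm : A.perm (Sum.inr b : I ⊕ J) = Sum.inr b := rfl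
  rw [← PowAlg.conjHom_apply, AdaptedFrame.shifted, map_add, PowAlg.conjHom_apply,
    PowAlg.conjHom_apply, h.conj_eq, PowAlg.conj_smul, PowAlg.conj_X, Complex.conj_ofReal]
  rw [hperm]

lemma conj_series (h : IsNormalizer A L₁ Λ a c ρ p r δ₁ Φ) (j : Fin m) :
    PowAlg.conj A.perm (Frame.series a (A.point r Φ) j) = Frame.series a (A.point r Φ) j :=
  Frame.conj_series A.perm h.wordBound h.ρ_pos h.real (mul_nonneg A.boundVec_nonneg h.r_pos.le)
    h.small' (A.norm_point_le h.r_pos.le le_rfl h.norm_le) (A.conj_point r h.conj_eq) j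

lemma conj_series_shifted (h : IsNormalizer A L₁ Λ a c ρ p r δ₁ Φ) (j : Fin m) :
    PowAlg.conj A.perm (Frame.series a (A.point r (AdaptedFrame.shifted δ₁ Φ)) j) =
      Frame.series a (A.point r (AdaptedFrame.shifted δ₁ Φ)) j :=
  Frame.conj_series A.perm h.wordBound h.ρ_pos h.real
    (mul_nonneg A.boundVec_nonneg (h.r_pos.le.trans h.le_radius))
    h.small (A.norm_point_le h.r_pos.le h.le_radius h.norm_shifted_le)
    (A.conj_point r h.conj_shifted) j

lemma conj_increment (h : IsNormalizer A L₁ Λ a c ρ p r δ₁ Φ) (j : Fin m) :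
    PowAlg.conj A.perm (A.increment a r δ₁ Φ j) = A.increment a r δ₁ Φ j := by
  rw [← PowAlg.conjHom_apply, AdaptedFrame.increment, map_sub, PowAlg.conjHom_apply,
    PowAlg.conjHom_apply, h.conj_series, h.conj_series_shifted]

lemma conj_rhs (h : IsNormalizer A L₁ Λ a c ρ p r δ₁ Φ) (b : J) :
    PowAlg.conj A.perm (A.rhs a p r Φ b) = A.rhs a p r Φ b :=
  A.conj_field p r h.conj_eq h.conj_series b

lemma conj_field_increment (h : IsNormalizer A L₁ Λ a c ρ p r δ₁ Φ) (b : J) :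
    PowAlg.conj A.perm (A.field p r Φ (A.increment a r δ₁ Φ) b) =
      A.field p r Φ (A.increment a r δ₁ Φ) b :=
  A.conj_field p r h.conj_eq h.conj_increment b

end IsNormalizer

lemma PowAlg.conj_part (σ : Equiv.Perm (I ⊕ J)) {P : Set ((I ⊕ J) →₀ ℕ)}
    (hP : ∀ α, PowAlg.permIdx σ α ∈ P ↔ α ∈ P) (f : PowAlg (I ⊕ J) (SobAlg T l)) :
    PowAlg.conj σ (PowAlg.part P f) = PowAlg.part P (PowAlg.conj σ f) := by
  refine PowAlg.ext fun α => ?_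
  rw [PowAlg.coef_conj, PowAlg.coef_part, PowAlg.coef_part, PowAlg.coef_conj]
  by_cases hα : α ∈ P
  · rw [if_pos hα, if_pos ((hP α).2 hα)]
  · rw [if_neg hα, if_neg (mt (hP α).1 hα)]
    exact map_zero SobAlg.conjHom

/-- The remainder: the part of the vector field of degree greater than `p`. -/
noncomputable def AdaptedFrame.remainder (A : AdaptedFrame hE I J)
    (a : Fin m → (q : ℕ) → (Fin q → Fin m) → SobAlg T l) (p : ℕ) (r : ℝ)
    (Φ : J → PowAlg (I ⊕ J) (SobAlg T l)) (b : J) : PowAlg (I ⊕ J) (SobAlg T l) :=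
  PowAlg.part {α : (I ⊕ J) →₀ ℕ | p < α.degree} (A.rhs a p r Φ b)

namespace IsNormalizer

variable {A : AdaptedFrame hE I J} {L₁ : E₁ →ₗ[ℝ] E₁} {Λ : I → ℂ}
  {a : Fin m → (q : ℕ) → (Fin q → Fin m) → SobAlg T l} {c ρ : ℝ} {p : ℕ} {r δ₁ : ℝ}
  {Φ : J → PowAlg (I ⊕ J) (SobAlg T l)}

lemma conj_remainder (h : IsNormalizer A L₁ Λ a c ρ p r δ₁ Φ) (b : J) :
    PowAlg.conj A.perm (A.remainder a p r Φ b) = A.remainder a p r Φ b := by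
  rw [AdaptedFrame.remainder, PowAlg.conj_part, h.conj_rhs]
  intro α
  show p < _ ↔ p < _
  rw [PowAlg.degree_permIdx]

lemma orderGe_remainder (b : J) : PowAlg.OrderGe (p + 1) (A.remainder a p r Φ b) := by
  classical
  intro α hα
  rw [AdaptedFrame.remainder, PowAlg.coef_part]
  exact if_neg (fun h : p < α.degree => by omega)

lemma orderGe_series (h : IsNormalizer A L₁ Λ a c ρ p r δ₁ Φ) (j : Fin m) :
    PowAlg.OrderGe 2 (Frame.series a (A.point r Φ) j) := by
  refine PowAlg.OrderGe.wordSeries (Frame.wordBound_C h.wordBound j) h.ρ_pos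
    (mul_nonneg A.boundVec_nonneg h.r_pos.le) h.small'
    (A.norm_point_le h.r_pos.le le_rfl h.norm_le) fun k => ?_
  exact (PowAlg.OrderGe.sum fun i _ => (PowAlg.orderGe_X _).smul _).add
    (PowAlg.OrderGe.sum fun b _ => ((h.orderGe b).mono one_le_two).smul _)

lemma orderGe_rhs (h : IsNormalizer A L₁ Λ a c ρ p r δ₁ Φ) (b : J) :
    PowAlg.OrderGe 2 (A.rhs a p r Φ b) := by
  refine (PowAlg.OrderGe.sum fun j _ => (h.orderGe_series j).smul _).sub
    (PowAlg.OrderGe.sum fun i _ => ?_)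
  refine (PowAlg.OrderGe.mono ?_ (by omega : 2 ≤ 0 + 2)).smul _
  exact (PowAlg.orderGe_zero _).mul (PowAlg.OrderGe.sum fun j _ => (h.orderGe_series j).smul _)

/-- On `E₀`, the vector field along `Φ` consists of the part that the homological equation takes into
account and the remainder. -/
lemma ev_rhs (h : IsNormalizer A L₁ Λ a c ρ p r δ₁ Φ) {ζ : I ⊕ J → ℂ} (hζ : ∀ i, ‖ζ i‖ ≤ 1)
    (h0 : ∀ b, ζ (Sum.inr b) = 0) (b : J) :
    PowAlg.ev ζ (PowAlg.part {α : (I ⊕ J) →₀ ℕ | InRange p α} (A.rhs a p r Φ b)) +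
      PowAlg.ev ζ (A.remainder a p r Φ b) = PowAlg.ev ζ (A.rhs a p r Φ b) := by
  classical
  rw [← PowAlg.ev_add hζ]
  refine tsum_congr fun α => ?_
  rw [PowAlg.coef_add, AdaptedFrame.remainder, PowAlg.coef_part, PowAlg.coef_part]
  by_cases hα : IsFree α
  · congr 1
    -- Degrees `< 2` do not occur, degrees `2, …, p` belong to the first part, the others to the
    -- second.
    by_cases h2 : α.degree < 2
    · rw [h.orderGe_rhs b α h2]
      simp
    · by_cases hp : p < α.degree
      · rw [if_neg (show α ∉ {α : (I ⊕ J) →₀ ℕ | InRange p α} from fun h' =>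
          absurd h'.2.2 (not_le.2 hp)), if_pos (show α ∈ {α : (I ⊕ J) →₀ ℕ | p < α.degree} from hp),
          zero_add]
      · rw [if_pos (show α ∈ {α : (I ⊕ J) →₀ ℕ | InRange p α} from
          ⟨hα, not_lt.1 h2, not_lt.1 hp⟩),
          if_neg (show α ∉ {α : (I ⊕ J) →₀ ℕ | p < α.degree} from hp), add_zero]
  -- Monomials containing a variable of `E₁` vanish on `E₀`.
  · have : PowAlg.mon ζ α = 0 := by
      simp only [IsFree, not_forall] at hα
      obtain ⟨b', hb'⟩ := hα
      exact Finset.prod_eq_zero (Finset.mem_univ (Sum.inr b')) (by rw [h0, zero_pow hb'])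
    rw [this, zero_smul, zero_smul]

end IsNormalizer
end NormalForm

/-! ### Conjugation of the two systems -/

section ChangeOfVariables

variable {m l : ℕ} {T : ℝ} [hT : Fact (0 < T)] [hl : Fact (1 ≤ l)] {I J : Type*} [Fintype I]
  [Fintype J] [DecidableEq I] [DecidableEq J]
  {E₀ E₁ : Submodule ℝ (EuclideanSpace ℝ (Fin m))} {hE : IsCompl E₀ E₁}

namespace IsNormalizer

variable {A : AdaptedFrame hE I J} {L₁ : E₁ →ₗ[ℝ] E₁} {Λ : I → ℂ}
  {a : Fin m → (q : ℕ) → (Fin q → Fin m) → SobAlg T l} {c ρ : ℝ} {p : ℕ} {r δ₁ : ℝ}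
  {Φ : J → PowAlg (I ⊕ J) (SobAlg T l)} {Ω : Set (EuclideanSpace ℝ (Fin m))}
  {V : EuclideanSpace ℝ (Fin m) → AddCircle T → EuclideanSpace ℝ (Fin m)}

omit [DecidableEq I] [DecidableEq J] in
lemma coords_zero_le {u : E₀} {v : E₁} {θ : ℝ} (hθ : 0 ≤ θ)
    (hx : ∀ i, ‖A.coords r δ₁ i (u, v)‖ ≤ θ) (i : I ⊕ J) : ‖A.coords r δ₁ i (u, 0)‖ ≤ θ := by
  rcases i with i | b
  · exact hx (Sum.inl i)
  · simpa [AdaptedFrame.coords_inr] using hθ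

lemma ev_eq (h : IsNormalizer A L₁ Λ a c ρ p r δ₁ Φ) (u : E₀) (v : E₁) (b : J) :
    PowAlg.ev (fun i => A.coords r δ₁ i (u, v)) (Φ b) =
      PowAlg.ev (fun i => A.coords r δ₁ i (u, 0)) (Φ b) :=
  PowAlg.ev_congr_of_free (h.free b) fun _ => rfl

lemma ev_pderiv_eq (h : IsNormalizer A L₁ Λ a c ρ p r δ₁ Φ) (u : E₀) (v : E₁) (i : I) (b : J) :
    PowAlg.ev (fun i => A.coords r δ₁ i (u, v)) (PowAlg.pderiv p (Sum.inl i) (Φ b)) =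
      PowAlg.ev (fun i => A.coords r δ₁ i (u, 0)) (PowAlg.pderiv p (Sum.inl i) (Φ b)) :=
  PowAlg.ev_congr_of_free (h.pderiv_free b i) fun _ => rfl

variable {u : E₀} {v : E₁}

lemma eval_ev_self (h : IsNormalizer A L₁ Λ a c ρ p r δ₁ Φ)
    (hx : ∀ i, ‖A.coords r δ₁ i (u, v)‖ ≤ 1) (t : AddCircle T) (b : J) :
    SobAlg.eval t (PowAlg.ev (fun i => A.coords r δ₁ i (u, v)) (Φ b)) =
      ((A.e.repr (A.value r δ₁ Φ (u, 0) t) b : ℝ) : ℂ) := by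
  rw [h.ev_eq]
  exact A.repr_value_of_conj (coords_zero_le zero_le_one hx) t (h.conj_eq b)

lemma ev_shifted (h : IsNormalizer A L₁ Λ a c ρ p r δ₁ Φ)
    (hx : ∀ i, ‖A.coords r δ₁ i (u, v)‖ ≤ 1) (b : J) :
    PowAlg.ev (fun i => A.coords r δ₁ i (u, v)) (AdaptedFrame.shifted δ₁ Φ b) =
      PowAlg.ev (fun i => A.coords r δ₁ i (u, 0)) (Φ b) +
        ((A.e.repr v b : ℝ) : ℂ) • (1 : SobAlg T l) := by
  have hδ : (δ₁ : ℂ) ≠ 0 := Complex.ofReal_ne_zero.2 h.δ₁_pos.ne'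
  rw [AdaptedFrame.shifted, PowAlg.ev_add hx, h.ev_eq, PowAlg.ev_smul, PowAlg.ev_X,
    AdaptedFrame.coords_inr, smul_smul, ← mul_assoc, Complex.ofReal_inv, mul_inv_cancel₀ hδ,
    one_mul]

lemma eval_ev_shifted (h : IsNormalizer A L₁ Λ a c ρ p r δ₁ Φ)
    (hx : ∀ i, ‖A.coords r δ₁ i (u, v)‖ ≤ 1) (t : AddCircle T) (b : J) :
    SobAlg.eval t (PowAlg.ev (fun i => A.coords r δ₁ i (u, v)) (AdaptedFrame.shifted δ₁ Φ b)) =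
      ((A.e.repr (v + A.value r δ₁ Φ (u, 0) t) b : ℝ) : ℂ) := by
  rw [h.ev_shifted hx, ← h.ev_eq u v, map_add, h.eval_ev_self hx, SobAlg.eval_smul, map_one, mul_one, map_add,
    Finsupp.add_apply]
  push_cast; ring

lemma eval_ev_series (h : IsNormalizer A L₁ Λ a c ρ p r δ₁ Φ)
    (hV : ∀ u ∈ Ω, ∀ t i, ((V u t i : ℝ) : ℂ) =
      wordSeries (fun q J => SobAlg.eval t (a i q J)) fun j => ((u j : ℝ) : ℂ))
    (hx : ∀ i, ‖A.coords r δ₁ i (u, v)‖ ≤ 1) {t : AddCircle T}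
    (hΩ : (u : EuclideanSpace ℝ (Fin m)) + (A.value r δ₁ Φ (u, 0) t : E₁) ∈ Ω) (j : Fin m) :
    SobAlg.eval t (PowAlg.ev (fun i => A.coords r δ₁ i (u, v))
      (Frame.series a (A.point r Φ) j)) =
      ((V ((u : EuclideanSpace ℝ (Fin m)) + (A.value r δ₁ Φ (u, 0) t : E₁)) t j : ℝ) : ℂ) :=
  A.eval_ev_series h.wordBound h.ρ_pos h.r_pos le_rfl h.small' hx (fun _ => rfl) h.norm_le
    (h.eval_ev_self hx t) (hV _ hΩ t j)

lemma eval_ev_series_shifted (h : IsNormalizer A L₁ Λ a c ρ p r δ₁ Φ)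
    (hV : ∀ u ∈ Ω, ∀ t i, ((V u t i : ℝ) : ℂ) =
      wordSeries (fun q J => SobAlg.eval t (a i q J)) fun j => ((u j : ℝ) : ℂ))
    (hx : ∀ i, ‖A.coords r δ₁ i (u, v)‖ ≤ 1) {t : AddCircle T}
    (hΩ : (u : EuclideanSpace ℝ (Fin m)) + (v + A.value r δ₁ Φ (u, 0) t : E₁) ∈ Ω) (j : Fin m) :
    SobAlg.eval t (PowAlg.ev (fun i => A.coords r δ₁ i (u, v))
      (Frame.series a (A.point r (AdaptedFrame.shifted δ₁ Φ)) j)) =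
      ((V ((u : EuclideanSpace ℝ (Fin m)) + (v + A.value r δ₁ Φ (u, 0) t : E₁)) t j : ℝ) : ℂ) :=
  A.eval_ev_series h.wordBound h.ρ_pos h.r_pos h.le_radius h.small hx (fun _ => rfl)
    h.norm_shifted_le (h.eval_ev_shifted hx t) (hV _ hΩ t j)

/-- The algebraic identity behind the change of variables: the deviation of the flow from the linear
one, inserted in `DΦ`, together with the homological equation. -/
lemma key_identity (h : IsNormalizer A L₁ Λ a c ρ p r δ₁ Φ)
    (hV : ∀ u ∈ Ω, ∀ t i, ((V u t i : ℝ) : ℂ) =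
      wordSeries (fun q J => SobAlg.eval t (a i q J)) fun j => ((u j : ℝ) : ℂ))
    (hx : ∀ i, ‖A.coords r δ₁ i (u, v)‖ ≤ 1) {t : AddCircle T}
    (hΩ₀ : (u : EuclideanSpace ℝ (Fin m)) + (A.value r δ₁ Φ (u, 0) t : E₁) ∈ Ω)
    (hΩ : (u : EuclideanSpace ℝ (Fin m)) + (v + A.value r δ₁ Φ (u, 0) t : E₁) ∈ Ω) (b : J) :
    SobAlg.eval t (PowAlg.ev (fun i => A.coords r δ₁ i (u, 0))
      (transport A.e L₁ p Φ (A.rhs a p r Φ) b)) +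
      ∑ i, ((r⁻¹ : ℝ) : ℂ) * A.ξ i (E₀.projectionOnto E₁ hE
        (V ((u : EuclideanSpace ℝ (Fin m)) + (v + A.value r δ₁ Φ (u, 0) t : E₁)) t)) *
        SobAlg.eval t (PowAlg.ev (fun i => A.coords r δ₁ i (u, 0))
          (PowAlg.pderiv p (Sum.inl i) (Φ b))) =
      ((A.e.repr (L₁ (A.value r δ₁ Φ (u, 0) t) + E₁.projectionOnto E₀ hE.symm
        (V ((u : EuclideanSpace ℝ (Fin m)) + (v + A.value r δ₁ Φ (u, 0) t : E₁)) t) -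
        A.value r δ₁ (A.field p r Φ (A.increment a r δ₁ Φ)) (u, v) t -
        A.value r δ₁ (A.remainder a p r Φ) (u, 0) t) b : ℝ) : ℂ) := by
  have hx0 := coords_zero_le zero_le_one hx
  set φ := A.value r δ₁ Φ (u, 0) t with hφ
  set V₁ := V ((u : EuclideanSpace ℝ (Fin m)) + (v + φ : E₁)) t with hV₁
  set V₀ := V ((u : EuclideanSpace ℝ (Fin m)) + (φ : E₁)) t with hV₀
  -- The values at the given point of the field of the increment (`hW`), of the field along `Φ`
  -- (`hF`), of its decomposition by degree (`hR`) and of the transport term (`hT`).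
  have hinc : ∀ j, SobAlg.eval t (PowAlg.ev (fun i => A.coords r δ₁ i (u, v))
      (A.increment a r δ₁ Φ j)) = (((V₁ - V₀) j : ℝ) : ℂ) := fun j => by
    rw [AdaptedFrame.increment, PowAlg.ev_sub hx, map_sub, h.eval_ev_series hV hx hΩ₀,
      h.eval_ev_series_shifted hV hx hΩ, PiLp.sub_apply, Complex.ofReal_sub]
  have hW := A.eval_ev_field hx p r Φ hinc b
  have hF := A.eval_ev_field hx0 p r Φ (fun j => h.eval_ev_series hV hx0 hΩ₀ j) b
  have hR := congrArg (SobAlg.eval t) (h.ev_rhs hx0 (fun b => by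
    simp [AdaptedFrame.coords_inr]) b)
  rw [map_add] at hR
  simp only [h.ev_pderiv_eq u v] at hW
  have hWv := A.repr_value_of_conj hx t (h.conj_field_increment b)
  have hRv := A.repr_value_of_conj hx0 t (h.conj_remainder b)
  have hL : ((A.e.repr (L₁ φ) b : ℝ) : ℂ) =
      ∑ b', ((LinearMap.toMatrix A.e A.e L₁ b b' : ℝ) : ℂ) * ((A.e.repr φ b' : ℝ) : ℂ) := by
    rw [← LinearMap.toMatrix_mulVec_repr A.e A.e L₁ φ]
    simp [Matrix.mulVec, dotProduct]
  have hT : SobAlg.eval t (PowAlg.ev (fun i => A.coords r δ₁ i (u, 0))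
      (transport A.e L₁ p Φ (A.rhs a p r Φ) b)) = ((A.e.repr (L₁ φ) b : ℝ) : ℂ) +
      SobAlg.eval t (PowAlg.ev (fun i => A.coords r δ₁ i (u, 0))
        (PowAlg.part {α : (I ⊕ J) →₀ ℕ | InRange p α} (A.rhs a p r Φ b))) := by
    rw [transport, PowAlg.ev_add hx0, map_add, PowAlg.ev_sum hx0, map_sum, hL]
    congr 1
    refine Finset.sum_congr rfl fun b' _ => ?_
    rw [PowAlg.ev_smul, SobAlg.eval_smul, h.eval_ev_self hx0]
  rw [hT]
  simp only [map_sub, map_add, Finsupp.sub_apply, Finsupp.add_apply, Complex.ofReal_sub,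
    Complex.ofReal_add] at hW hF ⊢
  rw [← hWv, ← hRv, hW]
  have hF' : SobAlg.eval t (PowAlg.ev (fun i => A.coords r δ₁ i (u, 0)) (A.rhs a p r Φ b)) = _ := hF
  rw [hF'] at hR
  simp only [mul_sub, sub_mul, Finset.sum_sub_distrib] at hR ⊢
  linear_combination hR

omit hT hl [DecidableEq I] [DecidableEq J] in
lemma hasDerivAt_linearMap {F G : Type*} [NormedAddCommGroup F] [NormedSpace ℝ F]
    [FiniteDimensional ℝ F] [NormedAddCommGroup G] [NormedSpace ℝ G] (g : F →ₗ[ℝ] G) {x : ℝ → F}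
    {x' : F} {t : ℝ} (hx : HasDerivAt x x' t) : HasDerivAt (fun s => g (x s)) (g x') t :=
  (LinearMap.toContinuousLinearMap g).hasFDerivAt.comp_hasDerivAt t hx

/-- The derivative of `Φ(u₀(t), t)` along solutions of the first equation. -/
theorem hasDerivAt_value (h : IsNormalizer A L₁ Λ a c ρ p r δ₁ Φ) {L₀ : E₀ →ₗ[ℝ] E₀}
    (hL₀ : ∀ i u, A.ξ i (L₀ u) = Λ i * A.ξ i u)
    (hV : ∀ u ∈ Ω, ∀ t i, ((V u t i : ℝ) : ℂ) =
      wordSeries (fun q J => SobAlg.eval t (a i q J)) fun j => ((u j : ℝ) : ℂ))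
    {u₀ : ℝ → E₀} {t : ℝ} (hx : ∀ i, ‖A.coords r δ₁ i (u₀ t, v)‖ ≤ 1)
    (hΩ₀ : (u₀ t : EuclideanSpace ℝ (Fin m)) + (A.value r δ₁ Φ (u₀ t, 0) t : E₁) ∈ Ω)
    (hΩ : (u₀ t : EuclideanSpace ℝ (Fin m)) + (v + A.value r δ₁ Φ (u₀ t, 0) t : E₁) ∈ Ω)
    (hu : HasDerivAt u₀ (L₀ (u₀ t) + E₀.projectionOnto E₁ hE
      (V ((u₀ t : EuclideanSpace ℝ (Fin m)) + (v + A.value r δ₁ Φ (u₀ t, 0) t : E₁)) t)) t) :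
    HasDerivAt (fun s : ℝ => A.value r δ₁ Φ (u₀ s, 0) s)
      (L₁ (A.value r δ₁ Φ (u₀ t, 0) t) + E₁.projectionOnto E₀ hE.symm
        (V ((u₀ t : EuclideanSpace ℝ (Fin m)) + (v + A.value r δ₁ Φ (u₀ t, 0) t : E₁)) t) -
        A.value r δ₁ (A.field p r Φ (A.increment a r δ₁ Φ)) (u₀ t, v) t -
        A.value r δ₁ (A.remainder a p r Φ) (u₀ t, 0) t) t := by
  set D := L₁ (A.value r δ₁ Φ (u₀ t, 0) t) + E₁.projectionOnto E₀ hE.symm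
        (V ((u₀ t : EuclideanSpace ℝ (Fin m)) + (v + A.value r δ₁ Φ (u₀ t, 0) t : E₁)) t) -
        A.value r δ₁ (A.field p r Φ (A.increment a r δ₁ Φ)) (u₀ t, v) t -
        A.value r δ₁ (A.remainder a p r Φ) (u₀ t, 0) t with hD
  set X := E₀.projectionOnto E₁ hE
      (V ((u₀ t : EuclideanSpace ℝ (Fin m)) + (v + A.value r δ₁ Φ (u₀ t, 0) t : E₁)) t) with hX
  have hpt : HasDerivAt (fun s => (u₀ s, (0 : E₁))) (L₀ (u₀ t) + X, (0 : E₁)) t :=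
    hu.prodMk (hasDerivAt_const t 0)
  have hcoord : ∀ b, HasDerivAt (fun s : ℝ => SobAlg.eval (s : AddCircle T)
      (PowAlg.ev (fun i => A.coords r δ₁ i (u₀ s, 0)) (Φ b))) ((A.e.repr D b : ℝ) : ℂ) t := by
    intro b
    refine (PowAlg.hasDerivAt_ev (h.degreeLe b) (h.equation b)
      (ζ := fun s i => A.coords r δ₁ i (u₀ s, 0))
      fun i => hasDerivAt_linearMap (A.coords r δ₁ i) hpt).congr_deriv ?_
    rw [← h.key_identity hV hx hΩ₀ hΩ b, Fintype.sum_sum_type]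
    -- The variables of `E₁` are frozen at `0`; those of `E₀` deviate from the linear flow by the
    -- nonlinearity `X`.
    have h2 : ∀ b' : J, A.coords r δ₁ (Sum.inr b') (L₀ (u₀ t) + X, (0 : E₁)) -
        Sum.elim Λ 0 (Sum.inr b' : I ⊕ J) * A.coords r δ₁ (Sum.inr b') (u₀ t, 0) = 0 := fun b' => by
      rw [AdaptedFrame.coords_inr, AdaptedFrame.coords_inr, map_zero, Finsupp.zero_apply,
        Complex.ofReal_zero, mul_zero, mul_zero, sub_zero]
    have h3 : ∀ i : I, A.coords r δ₁ (Sum.inl i) (L₀ (u₀ t) + X, (0 : E₁)) -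
        Sum.elim Λ 0 (Sum.inl i : I ⊕ J) * A.coords r δ₁ (Sum.inl i) (u₀ t, 0) =
        ((r⁻¹ : ℝ) : ℂ) * A.ξ i X := fun i => by
      rw [AdaptedFrame.coords_inl, AdaptedFrame.coords_inl, map_add, hL₀, Sum.elim_inl]
      ring
    simp only [h2, h3, zero_mul, Finset.sum_const_zero, add_zero, ← hX]
  have hsum := HasDerivAt.fun_sum (u := Finset.univ) fun b _ =>
    (Complex.reCLM.hasFDerivAt.comp_hasDerivAt t (hcoord b)).smul_const (A.e b)
  refine hsum.congr_deriv ?_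
  conv_rhs => rw [← A.e.sum_repr D]
  rfl

/-- The change of variables transforms the system into its normal form. -/
theorem transformsOn (h : IsNormalizer A L₁ Λ a c ρ p r δ₁ Φ) {L₀ : E₀ →ₗ[ℝ] E₀}
    (hL₀ : ∀ i u, A.ξ i (L₀ u) = Λ i * A.ξ i u)
    (hV : ∀ u ∈ Ω, ∀ t i, ((V u t i : ℝ) : ℂ) =
      wordSeries (fun q J => SobAlg.eval t (a i q J)) fun j => ((u j : ℝ) : ℂ))
    {S : Set (E₀ × E₁)} (hx : ∀ x ∈ S, ∀ i, ‖A.coords r δ₁ i x‖ ≤ 1)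
    (hΩ₀ : ∀ x ∈ S, ∀ t, (x.1 : EuclideanSpace ℝ (Fin m)) +
      (A.value r δ₁ Φ (x.1, 0) t : E₁) ∈ Ω)
    (hΩ : ∀ x ∈ S, ∀ t, (x.1 : EuclideanSpace ℝ (Fin m)) +
      (x.2 + A.value r δ₁ Φ (x.1, 0) t : E₁) ∈ Ω) :
    TransformsOn S (fun u t => A.value r δ₁ Φ (u, 0) t)
      (fun u₀ u₁ (t : AddCircle T) => L₀ u₀ + E₀.projectionOnto E₁ hE (V (u₀ + u₁) t))
      (fun u₀ u₁ t => L₁ u₁ + E₁.projectionOnto E₀ hE.symm (V (u₀ + u₁) t))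
      (fun u₀ v₁ t => L₀ u₀ + E₀.projectionOnto E₁ hE
        (V ((u₀ : EuclideanSpace ℝ (Fin m)) + (v₁ + A.value r δ₁ Φ (u₀, 0) t : E₁)) t))
      (fun u₀ v₁ t => L₁ v₁ +
        A.value r δ₁ (A.field p r Φ (A.increment a r δ₁ Φ)) (u₀, v₁) t +
        A.value r δ₁ (A.remainder a p r Φ) (u₀, 0) t) := by
  intro u₀ v₁ t hS
  -- The first equations coincide; given them, the second ones differ by the derivative of
  -- `Φ(u₀, t)`.
  refine and_congr_right fun hu => ?_
  have hd := h.hasDerivAt_value hL₀ hV (hx _ hS) (hΩ₀ _ hS t) (hΩ _ hS t) hu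
  constructor
  · intro hv
    have h1 := hv.sub hd
    have e1 : ((fun s : ℝ => v₁ s + A.value r δ₁ Φ (u₀ s, 0) s) -
        fun s : ℝ => A.value r δ₁ Φ (u₀ s, 0) s) = v₁ := by
      funext s
      exact add_sub_cancel_right _ _
    rw [e1] at h1
    refine h1.congr_deriv ?_
    simp only [map_add]
    abel
  · intro hv
    refine (hv.add hd).congr_deriv ?_
    simp only [map_add]
    abel

end IsNormalizer
end ChangeOfVariables

/-! ### Estimates at points -/

section Estimates

variable {m l : ℕ} {T : ℝ} [hT : Fact (0 < T)] [hl : Fact (1 ≤ l)] {I J : Type*} [Fintype I]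
  [Fintype J] [DecidableEq I] [DecidableEq J]
  {E₀ E₁ : Submodule ℝ (EuclideanSpace ℝ (Fin m))} {hE : IsCompl E₀ E₁}

namespace AdaptedFrame

variable (A : AdaptedFrame hE I J)

/-- A common bound for the coordinates on `E₀` and `E₁`. -/
structure CoordBound (κ : ℝ) : Prop where
  pos : 0 < κ
  norm_ξ_le : ∀ i u, ‖A.ξ i u‖ ≤ κ * ‖u‖
  norm_repr_le : ∀ b v, ‖A.e.repr v b‖ ≤ κ * ‖v‖

omit [DecidableEq I] [DecidableEq J] in
lemma exists_coordBound : ∃ κ, A.CoordBound κ := by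
  let F : I → (E₀ →L[ℝ] ℂ) := fun i => LinearMap.toContinuousLinearMap (A.ξ i)
  let G : J → (E₁ →L[ℝ] ℝ) := fun b => LinearMap.toContinuousLinearMap (A.e.coord b)
  refine ⟨1 + ∑ i, ‖F i‖ + ∑ b, ‖G b‖, by positivity, fun i u => ?_, fun b v => ?_⟩
  · refine ((F i).le_opNorm u).trans (mul_le_mul_of_nonneg_right ?_ (norm_nonneg _))
    have h1 := Finset.single_le_sum (f := fun i => ‖F i‖) (fun i _ => norm_nonneg (F i))
      (Finset.mem_univ i)
    have h2 : 0 ≤ ∑ b, ‖G b‖ := by positivity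
    have h3 : ‖F i‖ ≤ ∑ i, ‖F i‖ := h1
    linarith
  · refine ((G b).le_opNorm v).trans (mul_le_mul_of_nonneg_right ?_ (norm_nonneg _))
    have h1 := Finset.single_le_sum (f := fun b => ‖G b‖) (fun b _ => norm_nonneg (G b))
      (Finset.mem_univ b)
    have h2 : 0 ≤ ∑ i, ‖F i‖ := by positivity
    have h3 : ‖G b‖ ≤ ∑ b, ‖G b‖ := h1
    linarith

variable {A} {κ : ℝ} {r δ₁ : ℝ}

omit [DecidableEq I] [DecidableEq J] in
lemma CoordBound.norm_coords_inl_le (hκ : A.CoordBound κ) (hr : 0 < r) (i : I) (x : E₀ × E₁) :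
    ‖A.coords r δ₁ (Sum.inl i) x‖ ≤ r⁻¹ * (κ * ‖x.1‖) := by
  rw [coords_inl, norm_mul, Complex.norm_real, Real.norm_of_nonneg (by positivity)]
  exact mul_le_mul_of_nonneg_left (hκ.norm_ξ_le i _) (by positivity)

omit [DecidableEq I] [DecidableEq J] in
lemma CoordBound.norm_coords_inr_le (hκ : A.CoordBound κ) (hδ₁ : 0 < δ₁) (b : J) (x : E₀ × E₁) :
    ‖A.coords r δ₁ (Sum.inr b) x‖ ≤ δ₁⁻¹ * (κ * ‖x.2‖) := by
  rw [coords_inr, norm_mul, Complex.norm_real, Complex.norm_real,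
    Real.norm_of_nonneg (by positivity)]
  exact mul_le_mul_of_nonneg_left (hκ.norm_repr_le b _) (by positivity)

omit [DecidableEq I] [DecidableEq J] in
lemma CoordBound.norm_coords_zero_le (hκ : A.CoordBound κ) (hr : 0 < r) (i : I ⊕ J) (u : E₀) :
    ‖A.coords r δ₁ i (u, 0)‖ ≤ r⁻¹ * (κ * ‖u‖) := by
  have := hκ.pos
  rcases i with i | b
  · exact hκ.norm_coords_inl_le hr i (u, 0)
  · rw [coords_inr, map_zero, Finsupp.zero_apply, Complex.ofReal_zero, mul_zero, norm_zero]
    positivity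

omit [DecidableEq I] [DecidableEq J] in
lemma CoordBound.norm_coords_le (hκ : A.CoordBound κ) (hr : 0 < r) (hδ₁ : 0 < δ₁) (i : I ⊕ J)
    (x : E₀ × E₁) : ‖A.coords r δ₁ i x‖ ≤ (r⁻¹ + δ₁⁻¹) * κ * ‖x‖ := by
  have := hκ.pos
  have h0 : 0 ≤ κ * ‖x‖ := by positivity
  have e : (r⁻¹ + δ₁⁻¹) * κ * ‖x‖ = r⁻¹ * (κ * ‖x‖) + δ₁⁻¹ * (κ * ‖x‖) := by ring
  rw [e]
  rcases i with i | b
  · refine (hκ.norm_coords_inl_le hr i x).trans (le_trans ?_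
      (le_add_of_nonneg_right (by positivity)))
    gcongr
    exact norm_fst_le x
  · refine (hκ.norm_coords_inr_le hδ₁ b x).trans (le_trans ?_
      (le_add_of_nonneg_left (by positivity)))
    gcongr
    exact norm_snd_le x

lemma norm_value_le {f : J → PowAlg (I ⊕ J) (SobAlg T l)} {x : E₀ × E₁} {M : ℝ}
    (hM : ∀ b, ‖PowAlg.ev (fun i => A.coords r δ₁ i x) (f b)‖ ≤ M) (t : AddCircle T) :
    ‖A.value r δ₁ f x t‖ ≤ (SobAlg.embConst l * ∑ b, ‖A.e b‖) * M := by
  rw [mul_assoc, Finset.sum_mul, Finset.mul_sum]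
  refine (norm_sum_le _ _).trans (Finset.sum_le_sum fun b _ => ?_)
  rw [norm_smul]
  have h1 : ‖(SobAlg.eval t (PowAlg.ev (fun i => A.coords r δ₁ i x) (f b))).re‖ ≤
      SobAlg.embConst l * M := by
    refine (Complex.abs_re_le_norm _).trans ((SobAlg.norm_eval_le t _).trans ?_)
    exact mul_le_mul_of_nonneg_left (hM b) (Real.sqrt_nonneg _)
  calc _ ≤ SobAlg.embConst l * M * ‖A.e b‖ := mul_le_mul_of_nonneg_right h1 (norm_nonneg _)
    _ = _ := by ring

/-- Sobolev norm of the map given by power series. -/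
lemma sobolevNorm_value_le {f : J → PowAlg (I ⊕ J) (SobAlg T l)} {x : E₀ × E₁}
    (hx : ∀ i, ‖A.coords r δ₁ i x‖ ≤ 1) (hf : ∀ b, PowAlg.conj A.perm (f b) = f b) {M : ℝ}
    (hM0 : 0 ≤ M) (hM : ∀ b, ‖PowAlg.ev (fun i => A.coords r δ₁ i x) (f b)‖ ≤ M) :
    MemSobolev l (fun t : AddCircle T => (A.value r δ₁ f x t : EuclideanSpace ℝ (Fin m))) ∧
      sobolevNorm l (fun t : AddCircle T => (A.value r δ₁ f x t : EuclideanSpace ℝ (Fin m))) ≤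
        m * (A.boundVec T l * M) := by
  have h := SobAlg.sobolevNorm_le_of_eval
    (f := fun t : AddCircle T => (A.value r δ₁ f x t : EuclideanSpace ℝ (Fin m)))
    (x := fun j => PowAlg.ev (fun i => A.coords r δ₁ i x) (∑ b, ((A.vec₁ j b : ℝ) : ℂ) • f b))
    fun j t => (A.coe_value hx t hf j).symm
  refine ⟨h.1, h.2.trans ?_⟩
  have e : ∀ j, PowAlg.ev (fun i => A.coords r δ₁ i x) (∑ b, ((A.vec₁ j b : ℝ) : ℂ) • f b) =
      ∑ b, ((A.vec₁ j b : ℝ) : ℂ) • PowAlg.ev (fun i => A.coords r δ₁ i x) (f b) := fun j => by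
    rw [PowAlg.ev_sum hx]
    simp only [PowAlg.ev_smul]
  simp only [e]
  exact A.norm_vec₁_sum_le hM0 hM

/-- Analyticity of the maps given by power series, composed with a linear map. -/
lemma isAnalyticSobolev_value {F : Type*} [NormedAddCommGroup F] [NormedSpace ℝ F]
    (g : F →ₗ[ℝ] E₀ × E₁) {κ' : ℝ} (hκ' : 0 < κ')
    (hg : ∀ i x, ‖A.coords r δ₁ i (g x)‖ ≤ κ' * ‖x‖) {f : J → PowAlg (I ⊕ J) (SobAlg T l)}
    (hf : ∀ b, PowAlg.conj A.perm (f b) = f b) {S : Set F}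
    (hx : ∀ x ∈ S, ∀ i, ‖A.coords r δ₁ i (g x)‖ ≤ 1) :
    IsAnalyticSobolev l S fun x (t : AddCircle T) =>
      (A.value r δ₁ f (g x) t : EuclideanSpace ℝ (Fin m)) :=
  PowAlg.isAnalyticSobolev (ζ := fun i => (A.coords r δ₁ i).comp g) hκ' hg
    (fun j => ∑ b, ((A.vec₁ j b : ℝ) : ℂ) • f b) hx fun x hxS t j =>
      A.coe_value (hx x hxS) t hf j

end AdaptedFrame

namespace IsNormalizer

variable {A : AdaptedFrame hE I J} {L₁ : E₁ →ₗ[ℝ] E₁} {Λ : I → ℂ}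
  {a : Fin m → (q : ℕ) → (Fin q → Fin m) → SobAlg T l} {c ρ : ℝ} {p : ℕ} {r δ₁ : ℝ}
  {Φ : J → PowAlg (I ⊕ J) (SobAlg T l)} {κ : ℝ} {u : E₀} {v : E₁}

lemma norm_ev_le_sq (h : IsNormalizer A L₁ Λ a c ρ p r δ₁ Φ) (hκ : A.CoordBound κ)
    (hu : r⁻¹ * (κ * ‖u‖) ≤ 1) (b : J) :
    ‖PowAlg.ev (fun i => A.coords r δ₁ i (u, 0)) (Φ b)‖ ≤ r⁻¹ * κ ^ 2 * ‖u‖ ^ 2 := by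
  have hr := h.r_pos
  have := hκ.pos
  refine (PowAlg.norm_ev_le (fun i => hκ.norm_coords_zero_le hr i u) (by positivity) hu
    (h.orderGe b)).trans ?_
  calc (r⁻¹ * (κ * ‖u‖)) ^ 2 * ‖Φ b‖ ≤ (r⁻¹ * (κ * ‖u‖)) ^ 2 * r := by
        gcongr; exact h.norm_le b
    _ = _ := by field_simp

lemma norm_ev_le (h : IsNormalizer A L₁ Λ a c ρ p r δ₁ Φ) (hκ : A.CoordBound κ)
    (hu : r⁻¹ * (κ * ‖u‖) ≤ 1) (b : J) :
    ‖PowAlg.ev (fun i => A.coords r δ₁ i (u, 0)) (Φ b)‖ ≤ κ * ‖u‖ := by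
  have := hκ.pos
  refine (h.norm_ev_le_sq hκ hu b).trans ?_
  calc r⁻¹ * κ ^ 2 * ‖u‖ ^ 2 = r⁻¹ * (κ * ‖u‖) * (κ * ‖u‖) := by ring
    _ ≤ 1 * (κ * ‖u‖) := by gcongr
    _ = _ := one_mul _

lemma norm_ev_point_le (h : IsNormalizer A L₁ Λ a c ρ p r δ₁ Φ) (hκ : A.CoordBound κ)
    (hx : ∀ i, ‖A.coords r δ₁ i (u, v)‖ ≤ 1) {Ψ : J → PowAlg (I ⊕ J) (SobAlg T l)} {s : ℝ}
    (hus : κ * ‖u‖ ≤ s)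
    (hΨ : ∀ b, ‖PowAlg.ev (fun i => A.coords r δ₁ i (u, v)) (Ψ b)‖ ≤ s) (j : Fin m) :
    ‖PowAlg.ev (fun i => A.coords r δ₁ i (u, v)) (A.point r Ψ j)‖ ≤ A.boundVec T l * s := by
  have hr : (r : ℂ) ≠ 0 := Complex.ofReal_ne_zero.2 h.r_pos.ne'
  have hs0 : 0 ≤ s := le_trans (mul_nonneg hκ.pos.le (norm_nonneg _)) hus
  rw [Frame.ev_point _ hx, Frame.boundVec, add_mul]
  refine (norm_add_le _ _).trans (add_le_add ?_ ?_)
  · have h1 : ‖∑ i, A.vec₀ j i * (r * A.coords r δ₁ (Sum.inl i) (u, v))‖ ≤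
        (∑ i, ‖A.vec₀ j i‖) * s := by
      rw [Finset.sum_mul]
      refine (norm_sum_le _ _).trans (Finset.sum_le_sum fun i _ => ?_)
      rw [norm_mul, AdaptedFrame.coords_inl, ← mul_assoc (r : ℂ), Complex.ofReal_inv,
        mul_inv_cancel₀ hr, one_mul]
      exact mul_le_mul_of_nonneg_left ((hκ.norm_ξ_le i u).trans hus) (norm_nonneg _)
    have h3 : ∑ i, ‖A.vec₀ j i‖ ≤ ∑ j, ∑ i, ‖A.vec₀ j i‖ :=
      Finset.single_le_sum (f := fun j => ∑ i, ‖A.vec₀ j i‖)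
        (fun _ _ => by positivity) (Finset.mem_univ j)
    rw [norm_smul]
    calc _ ≤ (∑ i, ‖A.vec₀ j i‖) * s * ‖(1 : SobAlg T l)‖ :=
          mul_le_mul_of_nonneg_right h1 (norm_nonneg _)
      _ ≤ (∑ j, ∑ i, ‖A.vec₀ j i‖) * s * ‖(1 : SobAlg T l)‖ := by gcongr
      _ = _ := by ring
  · refine (norm_sum_smul_le _ hΨ).trans (mul_le_mul_of_nonneg_right ?_ hs0)
    exact Finset.single_le_sum (f := fun j => ∑ b, ‖((A.vec₁ j b : ℝ) : ℂ)‖)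
      (fun _ _ => by positivity) (Finset.mem_univ j)

/-- The constant in the bound for `u₀ + v₁ + Φ` at points of `E₀ × E₁`. -/
noncomputable def pointConst (A : AdaptedFrame hE I J) (T : ℝ) (l : ℕ) [Fact (0 < T)]
    [Fact (1 ≤ l)] (κ : ℝ) : ℝ :=
  A.boundVec T l * (κ * (1 + ‖(1 : SobAlg T l)‖))

lemma norm_ev_increment_le (h : IsNormalizer A L₁ Λ a c ρ p r δ₁ Φ) (hκ : A.CoordBound κ)
    (hx : ∀ i, ‖A.coords r δ₁ i (u, v)‖ ≤ 1) (hu : r⁻¹ * (κ * ‖u‖) ≤ 1)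
    (hsmall : 2 * m * (pointConst A T l κ * (‖u‖ + ‖v‖)) ≤ ρ) (j : Fin m) :
    ‖PowAlg.ev (fun i => A.coords r δ₁ i (u, v)) (A.increment a r δ₁ Φ j)‖ ≤
      lipConst m c ρ * pointConst A T l κ ^ 2 * (‖v‖ * (‖u‖ + ‖v‖)) := by
  have hκ0 := hκ.pos
  have hbv := A.boundVec_nonneg (T := T) (l := l)
  have h1 : 0 ≤ ‖(1 : SobAlg T l)‖ := norm_nonneg _
  set N := ‖(1 : SobAlg T l)‖ with hN
  set ζ : I ⊕ J → ℂ := fun i => A.coords r δ₁ i (u, v) with hζ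
  set s : ℝ := κ * (1 + N) * (‖u‖ + ‖v‖) with hs
  have hs0 : 0 ≤ s := by positivity
  have hus : κ * ‖u‖ ≤ s := by
    have : 0 ≤ κ * ‖v‖ + κ * N * (‖u‖ + ‖v‖) := by positivity
    rw [hs]; nlinarith
  have hv : ∀ b, ‖((A.e.repr v b : ℝ) : ℂ) • (1 : SobAlg T l)‖ ≤ κ * ‖v‖ * N := fun b => by
    rw [norm_smul, Complex.norm_real]
    exact mul_le_mul_of_nonneg_right (hκ.norm_repr_le b v) h1
  have hΦ1 : ∀ b, ‖PowAlg.ev ζ (Φ b)‖ ≤ s := fun b => by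
    rw [hζ, h.ev_eq]; exact (h.norm_ev_le hκ hu b).trans hus
  have hΦ2 : ∀ b, ‖PowAlg.ev ζ (AdaptedFrame.shifted δ₁ Φ b)‖ ≤ s := fun b => by
    rw [hζ, h.ev_shifted hx]
    refine (norm_add_le _ _).trans ((add_le_add (h.norm_ev_le hκ hu b) (hv b)).trans ?_)
    have : 0 ≤ κ * ‖v‖ + κ * N * ‖u‖ := by positivity
    rw [hs]; nlinarith
  have hdiff : ∀ k, ‖PowAlg.ev ζ (A.point r (AdaptedFrame.shifted δ₁ Φ) k) -
      PowAlg.ev ζ (A.point r Φ k)‖ ≤ A.boundVec T l * (κ * ‖v‖ * N) := fun k => by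
    rw [Frame.ev_point _ hx, Frame.ev_point _ hx, add_sub_add_left_eq_sub,
      ← Finset.sum_sub_distrib]
    have e : ∀ b, ((A.vec₁ k b : ℝ) : ℂ) • PowAlg.ev ζ (AdaptedFrame.shifted δ₁ Φ b) -
        ((A.vec₁ k b : ℝ) : ℂ) • PowAlg.ev ζ (Φ b) =
        ((A.vec₁ k b : ℝ) : ℂ) • (((A.e.repr v b : ℝ) : ℂ) • (1 : SobAlg T l)) := fun b => by
      rw [← smul_sub, hζ, h.ev_shifted hx, h.ev_eq u v, add_sub_cancel_left]
    rw [Finset.sum_congr rfl fun b _ => e b]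
    exact (norm_sum_smul_le _ hv).trans
      (mul_le_mul_of_nonneg_right (A.sum_vec₁_le k) (by positivity))
  -- The norm of the increment in the power series algebra does not depend on `v`. At a point, the
  -- series becomes one in `H^l`, with arguments of size `‖u‖ + ‖v‖`.
  have hser : ∀ (Ψ : J → PowAlg (I ⊕ J) (SobAlg T l)) (s' : ℝ), r ≤ s' →
      2 * m * (A.boundVec T l * s') ≤ ρ → (∀ b, ‖Ψ b‖ ≤ s') →
      PowAlg.ev ζ (Frame.series a (A.point r Ψ) j) =
        wordSeries (a j) fun k => PowAlg.ev ζ (A.point r Ψ k) := by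
    intro Ψ s' hrs' hs' hΨ
    have := (Frame.wordBound_C (I := I) (J := J) h.wordBound j).map_wordSeries h.ρ_pos
      (mul_nonneg hbv (h.r_pos.le.trans hrs')) hs'
      (A.norm_point_le h.r_pos.le hrs' hΨ) (PowAlg.evHom ζ hx).toRingHom
      (PowAlg.continuous_evHom ζ hx)
    refine this.trans ?_
    congr 1
    funext q w
    exact PowAlg.ev_C ζ _
  rw [AdaptedFrame.increment, PowAlg.ev_sub hx,
    hser _ _ h.le_radius h.small h.norm_shifted_le, hser _ _ le_rfl h.small' h.norm_le]
  have e1 : pointConst A T l κ * (‖u‖ + ‖v‖) = A.boundVec T l * s := by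
    rw [pointConst, hs]; ring
  rw [e1] at hsmall
  refine ((h.wordBound j).norm_wordSeries_sub_le h.ρ_pos (mul_nonneg hbv hs0)
    (by positivity : 0 ≤ A.boundVec T l * (κ * ‖v‖ * N)) hsmall
    (h.norm_ev_point_le hκ hx hus hΦ2) (h.norm_ev_point_le hκ hx hus hΦ1) hdiff).trans ?_
  have hlip : 0 ≤ lipConst m c ρ := by
    have := (h.wordBound j).const_nonneg
    unfold lipConst; positivity
  calc lipConst m c ρ * (A.boundVec T l * s) * (A.boundVec T l * (κ * ‖v‖ * N))
      ≤ lipConst m c ρ * (A.boundVec T l * s) * (A.boundVec T l * (κ * ‖v‖ * (1 + N))) := by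
        gcongr
        linarith
    _ = _ := by rw [pointConst, hs]; ring

/-- The new nonlinearity in the second equation vanishes for `v₁ = 0`. -/
theorem norm_ev_field_increment_le (h : IsNormalizer A L₁ Λ a c ρ p r δ₁ Φ)
    (hκ : A.CoordBound κ) (hx : ∀ i, ‖A.coords r δ₁ i (u, v)‖ ≤ 1)
    (hu : r⁻¹ * (κ * ‖u‖) ≤ 1 / 2) (hc : 0 ≤ c)
    (hsmall : 2 * m * (pointConst A T l κ * (‖u‖ + ‖v‖)) ≤ ρ) (b : J) :
    ‖PowAlg.ev (fun i => A.coords r δ₁ i (u, v)) (A.field p r Φ (A.increment a r δ₁ Φ) b)‖ ≤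
      (A.bound₀ + A.bound₁) *
        (lipConst m c ρ * pointConst A T l κ ^ 2 * (‖v‖ * (‖u‖ + ‖v‖))) := by
  have hr := h.r_pos
  have hinc := h.norm_ev_increment_le hκ hx (hu.trans (by norm_num)) hsmall
  set M := lipConst m c ρ * pointConst A T l κ ^ 2 * (‖v‖ * (‖u‖ + ‖v‖)) with hM
  have hM0 : 0 ≤ M := by
    have : 0 ≤ lipConst m c ρ := by unfold lipConst; positivity
    positivity
  -- Because the scaled coordinates are at most `1 / 2`, differentiation costs no power of `p` here.
  have hpd : ∀ i, ‖PowAlg.ev (fun i => A.coords r δ₁ i (u, v))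
      (PowAlg.pderiv p (Sum.inl i) (Φ b))‖ ≤ r := fun i => by
    rw [h.ev_pderiv_eq]
    exact (PowAlg.norm_ev_pderiv_le (fun i => (hκ.norm_coords_zero_le hr i u).trans hu) p _
      _).trans (h.norm_le b)
  rw [Frame.ev_field _ hx, add_mul, add_comm (A.bound₀ * M)]
  refine (norm_sub_le _ _).trans (add_le_add (A.norm_sum_proj₁_le hM0 hinc b) ?_)
  rw [Frame.bound₀, Finset.sum_mul]
  refine (norm_sum_le _ _).trans (Finset.sum_le_sum fun i _ => ?_)
  rw [norm_smul, Complex.norm_real, Real.norm_of_nonneg (by positivity)]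
  have h1 := norm_sum_smul_le (A.proj₀ i) hinc
  calc r⁻¹ * ‖PowAlg.ev (fun i => A.coords r δ₁ i (u, v)) (PowAlg.pderiv p (Sum.inl i) (Φ b)) *
        ∑ j, A.proj₀ i j • PowAlg.ev (fun i => A.coords r δ₁ i (u, v)) (A.increment a r δ₁ Φ j)‖
      ≤ r⁻¹ * (r * ((∑ j, ‖A.proj₀ i j‖) * M)) := by
        gcongr
        exact (norm_mul_le _ _).trans (mul_le_mul (hpd i) h1 (norm_nonneg _) hr.le)
    _ = _ := by rw [← mul_assoc, inv_mul_cancel₀ hr.ne', one_mul]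

/-- The remainder is exponentially small where the scaled coordinates are at most `1/e`. -/
theorem norm_ev_remainder_le (h : IsNormalizer A L₁ Λ a c ρ p r δ₁ Φ) (hκ : A.CoordBound κ)
    (hc : 0 ≤ c) (hu : r⁻¹ * (κ * ‖u‖) ≤ Real.exp (-1)) (b : J) :
    ‖PowAlg.ev (fun i => A.coords r δ₁ i (u, 0)) (A.remainder a p r Φ b)‖ ≤
      A.contractionConst T l c ρ * (p * r ^ 2) * Real.exp (-(p + 1 : ℝ)) := by
  have hr := h.r_pos
  have hlip : 0 ≤ lipConst m c ρ := by unfold lipConst; positivity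
  have hcc := A.contractionConst_nonneg (T := T) (l := l) (ρ := ρ) hc
  have h1 : ‖A.remainder a p r Φ b‖ ≤ A.contractionConst T l c ρ * (p * r ^ 2) := by
    refine (PowAlg.norm_part_le _ _).trans ((A.norm_field_le hr
      (M := lipConst m c ρ * A.boundVec T l ^ 2 * r ^ 2) (by positivity) h.norm_le
      (A.norm_series_point_le h.wordBound h.ρ_pos hr.le h.small' h.norm_le) h.one_le b).trans
      (le_of_eq ?_))
    rw [Frame.contractionConst]; ring
  have h2 := PowAlg.norm_ev_le (fun i => (hκ.norm_coords_zero_le (δ₁ := δ₁) hr i u).trans hu)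
    (Real.exp_pos _).le (Real.exp_le_one_iff.2 (by norm_num))
    (orderGe_remainder (A := A) (a := a) (p := p) (r := r) (Φ := Φ) b)
  refine h2.trans ?_
  have e : Real.exp (-1) ^ (p + 1) = Real.exp (-(p + 1 : ℝ)) := by
    rw [← Real.exp_nat_mul]; push_cast; ring_nf
  rw [e, mul_comm]
  gcongr

end IsNormalizer
end Estimates

/-! ### Existence of the normal form and choice of the degree -/

section Existence

variable {m l : ℕ} {T : ℝ} [hT : Fact (0 < T)] [hl : Fact (1 ≤ l)] {I J : Type*} [Fintype I]
  [Fintype J] [DecidableEq I] [DecidableEq J]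
  {E₀ E₁ : Submodule ℝ (EuclideanSpace ℝ (Fin m))} {hE : IsCompl E₀ E₁}

/-- The homological equation has an approximate solution in variables of size `r = c₀ p^{-μ}`. -/
theorem exists_isNormalizer (A : AdaptedFrame hE I J) {L₁ : E₁ →ₗ[ℝ] E₁} {Λ : I → ℂ}
    (hΛ : ∀ i, Λ (A.σ i) = (starRingEnd ℂ) (Λ i)) {C η : ℝ} (hC : 0 < C)
    (hres : ∀ (p : ℕ) (α : (I ⊕ J) →₀ ℕ), IsFree α → 1 ≤ α.degree → α.degree ≤ p → ∀ k : ℤ,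
      (freq T (Sum.elim Λ 0) α k • (1 : Matrix J J ℂ) -
        (LinearMap.toMatrix A.e A.e L₁).map (algebraMap ℝ ℂ)) *
        resolventMatrix A.e L₁ (freq T (Sum.elim Λ 0) α k) = 1 ∧
      ∀ b b', ‖resolventMatrix A.e L₁ (freq T (Sum.elim Λ 0) α k) b b'‖ ≤ C * (p : ℝ) ^ η ∧
        |(k : ℝ)| * ‖resolventMatrix A.e L₁ (freq T (Sum.elim Λ 0) α k) b b'‖ ≤
          C * (p : ℝ) ^ η * p)
    {a : Fin m → (q : ℕ) → (Fin q → Fin m) → SobAlg T l} {c ρ : ℝ}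
    (ha : ∀ j, WordBound (a j) c ρ) (hρ : 0 < ρ) (hc : 0 ≤ c)
    (hreal : ∀ j q w, (a j q w).conj = a j q w) {p : ℕ} (hp : 1 ≤ p) {μ c₀ : ℝ} (hμ : η + 1 ≤ μ)
    (hμ0 : 0 ≤ μ) (hc₀ : 0 < c₀)
    (h1 : 2 * m * (A.boundVec T l * (c₀ * (1 + ‖(1 : SobAlg T l)‖))) ≤ ρ)
    (h2 : 4 * Fintype.card J * C * A.contractionConst T l c ρ * c₀ ≤ 1) :
    ∃ Φ : J → PowAlg (I ⊕ J) (SobAlg T l),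
      IsNormalizer A L₁ Λ a c ρ p (c₀ / (p : ℝ) ^ μ) c₀ Φ ∧
      ∀ b α, SobAlg.MemHigher (l + 1) ((Φ b).coef α) := by
  have hp1 : (1 : ℝ) ≤ p := by exact_mod_cast hp
  have hp0 : (0 : ℝ) < p := by linarith
  have hpμ : 1 ≤ (p : ℝ) ^ μ := Real.one_le_rpow hp1 hμ0
  have hpη : 0 ≤ (p : ℝ) ^ η := by positivity
  set r := c₀ / (p : ℝ) ^ μ with hr
  have hr0 : 0 < r := by positivity
  have hrc : r ≤ c₀ := div_le_self hc₀.le hpμ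
  have hbv := A.boundVec_nonneg (T := T) (l := l)
  have hcc := A.contractionConst_nonneg (T := T) (l := l) (ρ := ρ) hc
  have hsm : 2 * m * (A.boundVec T l * (r + c₀ * ‖(1 : SobAlg T l)‖)) ≤ ρ := by
    refine le_trans ?_ h1
    rw [mul_one_add c₀]
    gcongr
  have hK : ∀ b b' (α : (I ⊕ J) →₀ ℕ) k,
      ‖truncatedResolvent A.e L₁ T Λ p b b' α k‖ ≤ C * (p : ℝ) ^ η := fun b b' α k => by
    rw [truncatedResolvent]
    split_ifs with hα
    · exact ((hres p α hα.1 (by have := hα.2.1; omega) hα.2.2 k).2 b b').1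
    · rw [norm_zero]; positivity
  have hK' : ∀ b b' (α : (I ⊕ J) →₀ ℕ) (k : ℤ),
      |(k : ℝ)| * ‖truncatedResolvent A.e L₁ T Λ p b b' α k‖ ≤ C * (p : ℝ) ^ η * p :=
    fun b b' α k => by
    rw [truncatedResolvent]
    split_ifs with hα
    · exact ((hres p α hα.1 (by have := hα.2.1; omega) hα.2.2 k).2 b b').2
    · rw [norm_zero, mul_zero]; positivity
  have hinv : ∀ α : (I ⊕ J) →₀ ℕ, InRange p α → ∀ k : ℤ,
      (freq T (Sum.elim Λ 0) α k • (1 : Matrix J J ℂ) -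
        (LinearMap.toMatrix A.e A.e L₁).map (algebraMap ℝ ℂ)) *
        resolventMatrix A.e L₁ (freq T (Sum.elim Λ 0) α k) = 1 := fun α hα k =>
    (hres p α hα.1 (by have := hα.2.1; omega) hα.2.2 k).1
  have hconj : ∀ b b' (α : (I ⊕ J) →₀ ℕ) k, truncatedResolvent A.e L₁ T Λ p b b' α k =
      (starRingEnd ℂ) (truncatedResolvent A.e L₁ T Λ p b b' (PowAlg.permIdx A.perm α) (-k)) := by
    intro b b' α k
    rw [truncatedResolvent, truncatedResolvent]
    by_cases hα : InRange p α
    · rw [if_pos hα, if_pos ((inRange_permIdx A.toFrame).2 hα), freq_permIdx A.toFrame hΛ,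
        resolventMatrix_conj A.e L₁ (hinv α hα k), Complex.conj_conj]
    · rw [if_neg hα, if_neg (mt (inRange_permIdx A.toFrame).1 hα), map_zero]
  -- The loss `p^{η + 1}` is compensated by `r = c₀ p^{-μ}`.
  have hpr : C * (p : ℝ) ^ η * p * r ≤ C * c₀ := by
    have h3 : (p : ℝ) ^ η * p ≤ (p : ℝ) ^ μ := by
      rw [← Real.rpow_add_one hp0.ne']
      exact Real.rpow_le_rpow_of_exponent_le hp1 hμ
    calc C * (p : ℝ) ^ η * p * r = C * c₀ * (((p : ℝ) ^ η * p) / (p : ℝ) ^ μ) := by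
          rw [hr]; ring
      _ ≤ C * c₀ * 1 := by
          gcongr
          exact div_le_one_of_le₀ h3 (by positivity)
      _ = _ := mul_one _
  have hcontr : 4 * Fintype.card J * (C * (p : ℝ) ^ η) * A.contractionConst T l c ρ * p * r ≤ 1 := by
    refine le_trans ?_ h2
    calc 4 * Fintype.card J * (C * (p : ℝ) ^ η) * A.contractionConst T l c ρ * p * r
        = 4 * Fintype.card J * A.contractionConst T l c ρ * (C * (p : ℝ) ^ η * p * r) := by ring
      _ ≤ 4 * Fintype.card J * A.contractionConst T l c ρ * (C * c₀) := by gcongr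
      _ = _ := by ring
  have hsm' : 2 * m * (A.boundVec T l * r) ≤ ρ := by
    refine le_trans ?_ hsm
    gcongr
    exact le_add_of_nonneg_right (by positivity)
  obtain ⟨Φ, hΦr, hΦc, hΦ⟩ := A.exists_fixedPoint ha hρ hc hreal hp hr0 (by positivity) hK hconj
    hsm' hcontr
  exact ⟨Φ, ⟨hp, hr0, hc₀, hρ, ha, hreal, hsm, hΦr, hΦc,
    fun b α hα => coef_solution_of_not_inRange hK hΦ b hα, coef_transport hK hinv hΦ⟩,
    memHigher_solution hK hK' hΦ⟩

/-- The degree `p` is the largest one for which the variables of size `c₀ p^{-μ}` cover the ball of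
radius `e κ δ`. -/
lemma exists_degree {c₀ κ μ b δ : ℝ} (hc₀ : 0 < c₀) (hκ : 0 < κ) (hμ : 0 < μ) (hb : b = 1 / μ)
    (hδ : 0 < δ) (hδc : δ ≤ c₀ / (Real.exp 1 * κ)) :
    ∃ p : ℕ, 1 ≤ p ∧ (p : ℝ) ≤ (c₀ / (Real.exp 1 * κ)) ^ b * δ ^ (-b) ∧
      (c₀ / (Real.exp 1 * κ)) ^ b / δ ^ b ≤ p + 1 ∧
      (c₀ / (p : ℝ) ^ μ)⁻¹ * (κ * δ) ≤ Real.exp (-1) := by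
  have he := Real.exp_pos 1
  set D := c₀ / (Real.exp 1 * κ) with hD
  have hD0 : 0 < D := by positivity
  have hb0 : 0 < b := by rw [hb]; positivity
  have hx : D ^ b * δ ^ (-b) = (D / δ) ^ b := by
    rw [Real.div_rpow hD0.le hδ.le, Real.rpow_neg hδ.le, div_eq_mul_inv]
  have hx' : D ^ b / δ ^ b = (D / δ) ^ b := (Real.div_rpow hD0.le hδ.le b).symm
  have h1 : 1 ≤ (D / δ) ^ b := Real.one_le_rpow ((one_le_div hδ).2 hδc) hb0.le
  have hp := Nat.floor_le (zero_le_one.trans h1)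
  -- With `D = c₀ / (e κ)` and `b μ = 1`, the condition `κ δ ≤ r / e` reads `p ≤ (D / δ)^b`.
  refine ⟨⌊(D / δ) ^ b⌋₊, Nat.le_floor (by exact_mod_cast h1), hx ▸ hp, hx' ▸
    (Nat.lt_floor_add_one _).le, ?_⟩
  set p := ⌊(D / δ) ^ b⌋₊
  have h2 : (p : ℝ) ^ μ ≤ D / δ := by
    refine (Real.rpow_le_rpow (Nat.cast_nonneg _) hp hμ.le).trans_eq ?_
    rw [← Real.rpow_mul (by positivity), hb, one_div, inv_mul_cancel₀ hμ.ne', Real.rpow_one]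
  rw [inv_div]
  calc (p : ℝ) ^ μ / c₀ * (κ * δ) ≤ D / δ / c₀ * (κ * δ) := by gcongr
    _ = (Real.exp 1)⁻¹ := by rw [hD]; field_simp
    _ = Real.exp (-1) := (Real.exp_neg 1).symm

end Existence

/-! ### The normal form theorem -/

section Conclusion

lemma PowAlg.OrderGe.ev_zero {ι H : Type*} [Fintype ι] [NormedCommRing H] [NormedAlgebra ℂ H]
    {f : PowAlg ι H} {k : ℕ} (hf : PowAlg.OrderGe (k + 1) f) : PowAlg.ev (0 : ι → ℂ) f = 0 := by
  have h : ∀ α : ι →₀ ℕ, PowAlg.mon (0 : ι → ℂ) α • f.coef α = 0 := fun α => by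
    by_cases hα : α = 0
    · rw [hf α (by simp [hα]), smul_zero]
    · obtain ⟨i, hi⟩ := Finsupp.ne_iff.1 hα
      have : PowAlg.mon (0 : ι → ℂ) α = 0 :=
        Finset.prod_eq_zero (Finset.mem_univ i) (zero_pow hi)
      rw [this, zero_smul]
  rw [PowAlg.ev]
  simp only [h, tsum_zero]

namespace IsNormalizer

variable {m l : ℕ} {T : ℝ} [hT : Fact (0 < T)] [hl : Fact (1 ≤ l)] {I J : Type*} [Fintype I]
  [Fintype J] [DecidableEq I] [DecidableEq J]
  {E₀ E₁ : Submodule ℝ (EuclideanSpace ℝ (Fin m))} {hE : IsCompl E₀ E₁}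
  {A : AdaptedFrame hE I J} {L₁ : E₁ →ₗ[ℝ] E₁} {Λ : I → ℂ}
  {a : Fin m → (q : ℕ) → (Fin q → Fin m) → SobAlg T l} {c ρ : ℝ} {p : ℕ} {r δ₁ : ℝ}
  {Φ : J → PowAlg (I ⊕ J) (SobAlg T l)} {κ : ℝ}

lemma value_zero (h : IsNormalizer A L₁ Λ a c ρ p r δ₁ Φ) (t : AddCircle T) :
    A.value r δ₁ Φ (0, 0) t = 0 := by
  have e : (fun i => A.coords r δ₁ i ((0 : E₀), (0 : E₁))) = 0 := by
    funext i
    exact map_zero (A.coords r δ₁ i)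
  rw [AdaptedFrame.value]
  simp only [e, (h.orderGe _).ev_zero, map_zero, Complex.zero_re, zero_smul,
    Finset.sum_const_zero]

lemma hasFDerivAt_value_zero (h : IsNormalizer A L₁ Λ a c ρ p r δ₁ Φ) (hκ : A.CoordBound κ)
    (t : AddCircle T) :
    HasFDerivAt (fun u : E₀ => A.value r δ₁ Φ (u, 0) t) (0 : E₀ →L[ℝ] E₁) 0 := by
  have hr := h.r_pos
  have hκ0 := hκ.pos
  refine Asymptotics.IsBigO.hasFDerivAt (n := 2) ?_ one_lt_two
  refine Asymptotics.IsBigO.of_bound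
    ((SobAlg.embConst l * ∑ b, ‖A.e b‖) * (r⁻¹ * κ ^ 2)) ?_
  have hball : Metric.ball (0 : E₀) (r / κ) ∈ 𝓝 (0 : E₀) := Metric.ball_mem_nhds _ (by positivity)
  filter_upwards [hball] with u hu
  rw [mem_ball_zero_iff, lt_div_iff₀ hκ0] at hu
  have hu' : r⁻¹ * (κ * ‖u‖) ≤ 1 := by
    rw [inv_mul_le_iff₀ hr]; linarith
  refine (AdaptedFrame.norm_value_le (fun b => h.norm_ev_le_sq hκ hu' b) t).trans (le_of_eq ?_)
  rw [sub_zero, norm_pow, norm_norm]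
  ring

lemma norm_value_le (h : IsNormalizer A L₁ Λ a c ρ p r δ₁ Φ) (hκ : A.CoordBound κ) {u : E₀}
    (hu : r⁻¹ * (κ * ‖u‖) ≤ 1) (t : AddCircle T) :
    ‖A.value r δ₁ Φ (u, 0) t‖ ≤ (SobAlg.embConst l * ∑ b, ‖A.e b‖) * κ * ‖u‖ :=
  (AdaptedFrame.norm_value_le (fun b => h.norm_ev_le hκ hu b) t).trans
    (le_of_eq (by ring))

end IsNormalizer

/-- The first component of the new vector field is analytic. -/
lemma IsNormalizer.isAnalyticSobolev_fst {m l : ℕ} {T : ℝ} [hT : Fact (0 < T)] [hl : Fact (1 ≤ l)]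
    {I J : Type*} [Fintype I] [Fintype J] [DecidableEq I] [DecidableEq J]
    {E₀ E₁ : Submodule ℝ (EuclideanSpace ℝ (Fin m))} {hE : IsCompl E₀ E₁}
    {A : AdaptedFrame hE I J} {L₁ : E₁ →ₗ[ℝ] E₁} {Λ : I → ℂ}
    {a : Fin m → (q : ℕ) → (Fin q → Fin m) → SobAlg T l} {c ρ : ℝ} {p : ℕ} {r δ₁ : ℝ}
    {Φ : J → PowAlg (I ⊕ J) (SobAlg T l)} {κ : ℝ} {Ω : Set (EuclideanSpace ℝ (Fin m))}
    {V : EuclideanSpace ℝ (Fin m) → AddCircle T → EuclideanSpace ℝ (Fin m)}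
    (h : IsNormalizer A L₁ Λ a c ρ p r δ₁ Φ) (hκ : A.CoordBound κ)
    (hV : ∀ u ∈ Ω, ∀ t i, ((V u t i : ℝ) : ℂ) =
      wordSeries (fun q J => SobAlg.eval t (a i q J)) fun j => ((u j : ℝ) : ℂ))
    {S : Set (E₀ × E₁)} (hx : ∀ x ∈ S, ∀ i, ‖A.coords r δ₁ i x‖ ≤ 1)
    (hΩ : ∀ x ∈ S, ∀ t, (x.1 : EuclideanSpace ℝ (Fin m)) +
      (x.2 + A.value r δ₁ Φ (x.1, 0) t : E₁) ∈ Ω) :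
    IsAnalyticSobolev l S fun x (t : AddCircle T) => (E₀.projectionOnto E₁ hE
      (V ((x.1 : EuclideanSpace ℝ (Fin m)) + (x.2 + A.value r δ₁ Φ (x.1, 0) t : E₁)) t) :
        EuclideanSpace ℝ (Fin m)) := by
  have hκ0 := hκ.pos
  have hr := h.r_pos
  have hδ := h.δ₁_pos
  refine PowAlg.isAnalyticSobolev (ζ := A.coords r δ₁) (κ := (r⁻¹ + δ₁⁻¹) * κ) (by positivity)
    (fun i x => hκ.norm_coords_le hr hδ i x)
    (fun j => ∑ i, A.vec₀ j i • ∑ k, A.proj₀ i k •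
      Frame.series a (A.point r (AdaptedFrame.shifted δ₁ Φ)) k) hx fun x hxS t j => ?_
  have hx' := hx x hxS
  rw [A.coe₀, PowAlg.ev_sum hx', map_sum]
  refine Finset.sum_congr rfl fun i _ => ?_
  rw [PowAlg.ev_smul, SobAlg.eval_smul, A.proj₀_eq, PowAlg.ev_sum hx', map_sum]
  congr 1
  refine Finset.sum_congr rfl fun k _ => ?_
  rw [PowAlg.ev_smul, SobAlg.eval_smul]
  congr 1
  exact (h.eval_ev_series_shifted hV hx' (hΩ x hxS t) k).symm

theorem theorem2p1 (T : ℝ) [Fact (0 < T)] (m : ℕ)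
    (E₀ E₁ : Submodule ℝ (EuclideanSpace ℝ (Fin m))) (hE : IsCompl E₀ E₁)
    (L₀ : E₀ →ₗ[ℝ] E₀) (L₁ : E₁ →ₗ[ℝ] E₁)
    (lam : Fin (Module.finrank ℝ E₀) → ℂ) (hdiag : IsDiagonalizedBy L₀ lam)
    (l : ℕ) (hl : 1 ≤ l) (τ : ℝ) (hτ : 0 < τ) (hres : NonResonant T lam L₁ τ)
    (hν : τ * (maxJordanBlockSize L₁ : ℝ) ≤ (l : ℝ))
    (c ρ : ℝ) (hc : 0 < c) (hρ : 0 < ρ)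
    (b : ℝ) (hb : b = 1 / ((l : ℝ) + τ * (maxJordanBlockSize L₁ : ℝ) + 1)) :
    ∃ M M₀ ω K : ℝ, 0 < M ∧ 0 < M₀ ∧ 0 < ω ∧ 0 < K ∧
    ∀ Ω ∈ 𝓝 (0 : EuclideanSpace ℝ (Fin m)), ∃ δ₀ : ℝ, 0 < δ₀ ∧
    ∀ V : EuclideanSpace ℝ (Fin m) → AddCircle T → EuclideanSpace ℝ (Fin m),
      IsAnalyticWith l c ρ Ω V →
      (∀ t, V 0 t = 0) → (∀ t, HasFDerivAt (fun u => V u t)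
        (0 : EuclideanSpace ℝ (Fin m) →L[ℝ] EuclideanSpace ℝ (Fin m)) 0) →
    ∀ δ : ℝ, 0 < δ → δ < δ₀ →
    ∃ (p : ℕ) (Φ : E₀ → AddCircle T → E₁) (W₀ : E₀ × E₁ → AddCircle T → E₀)
      (W₁ : E₀ × E₁ → AddCircle T → E₁) (R : E₀ → AddCircle T → E₁),
      (p : ℝ) ≤ K * δ ^ (-b) ∧
      IsSobolevPolynomial (l + 1) p Φ ∧
      (∀ t, Φ 0 t = 0) ∧ (∀ t, HasFDerivAt (fun u => Φ u t) (0 : E₀ →L[ℝ] E₁) 0) ∧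
      TransformsOn {x : E₀ × E₁ | ‖x.1‖ ≤ δ ∧ ‖x.2‖ ≤ δ₀} Φ
        (fun u₀ u₁ t => L₀ u₀ + E₀.projectionOnto E₁ hE (V (u₀ + u₁) t))
        (fun u₀ u₁ t => L₁ u₁ + E₁.projectionOnto E₀ hE.symm (V (u₀ + u₁) t))
        (fun u₀ v₁ t => L₀ u₀ + W₀ (u₀, v₁) t)
        (fun u₀ v₁ t => L₁ v₁ + W₁ (u₀, v₁) t + R u₀ t) ∧
      IsAnalyticSobolev l {x : E₀ × E₁ | ‖x.1‖ ≤ δ ∧ ‖x.2‖ ≤ δ₀}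
        (fun x t => (W₀ x t : EuclideanSpace ℝ (Fin m))) ∧
      IsAnalyticSobolev l {x : E₀ × E₁ | ‖x.1‖ ≤ δ ∧ ‖x.2‖ ≤ δ₀}
        (fun x t => (W₁ x t : EuclideanSpace ℝ (Fin m))) ∧
      IsAnalyticSobolev l {u₀ : E₀ | ‖u₀‖ ≤ δ}
        (fun u₀ t => (R u₀ t : EuclideanSpace ℝ (Fin m))) ∧
      (∀ (u₀ : E₀) (v₁ : E₁), ‖u₀‖ ≤ δ → ‖v₁‖ ≤ δ₀ →
        MemSobolev l (fun t => (W₁ (u₀, v₁) t : EuclideanSpace ℝ (Fin m))) ∧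
        sobolevNorm l (fun t => (W₁ (u₀, v₁) t : EuclideanSpace ℝ (Fin m)))
          ≤ M₀ * ‖v₁‖ * (‖u₀‖ + ‖v₁‖)) ∧
      (∀ u₀ : E₀, ‖u₀‖ ≤ δ →
        MemSobolev l (fun t => (R u₀ t : EuclideanSpace ℝ (Fin m))) ∧
        sobolevNorm l (fun t => (R u₀ t : EuclideanSpace ℝ (Fin m)))
          ≤ M * Real.exp (-ω / δ ^ b)) ∧
      (∀ (u₀ : E₀) (v₁ : E₁) (t : AddCircle T), W₀ (u₀, v₁) t =
        E₀.projectionOnto E₁ hE (V (u₀ + (v₁ + Φ u₀ t : E₁)) t)) := by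
  have hT : 0 < T := Fact.out
  have : Fact (1 ≤ l) := ⟨hl⟩
  obtain ⟨A, hσ, hL₀⟩ := exists_adaptedFrame hE hdiag
  obtain ⟨κ, hκ⟩ := A.exists_coordBound
  have hκ0 := hκ.pos
  obtain ⟨γ, hγ, hnr⟩ := hres
  obtain ⟨-, -, -, hlam⟩ := exists_eigenCoordinates hdiag
  set Λ := pairedEigenvalue lam with hΛdef
  have hΛ : ∀ i, Λ (A.σ i) = (starRingEnd ℂ) (Λ i) := by
    rw [hσ]
    rintro (i | i)
    · rfl
    · exact (Complex.conj_conj _).symm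
  set η : ℝ := τ * (maxJordanBlockSize L₁ : ℝ) with hη
  have hη0 : 0 ≤ η := by positivity
  obtain ⟨C, hC, hbound⟩ := resolventMatrix_freq_bound A.e L₁ hT
    (ι := (Fin (finrank ℝ E₀) ⊕ Fin (finrank ℝ E₀)) ⊕
    Fin (finrank ℝ E₁)) (Sum.elim Λ 0) (fun α => IsFree α) hτ hγ
    fun α hα hα0 k μ hμ => NonResonant.freq_bound hlam hnr hα hα0 k hμ
  set c' : ℝ := sobConst l * c with hc'
  have hc0 : 0 ≤ c' := mul_nonneg (sobConst_pos l).le hc.le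
  set N := IsNormalizer.pointConst A T l κ with hN
  set B := A.boundVec T l with hB
  have hB0 : 0 ≤ B := A.boundVec_nonneg
  have hN0 : 0 ≤ N := mul_nonneg hB0 (by positivity)
  set Q := A.contractionConst T l c' ρ with hQ
  have hQ0 : 0 ≤ Q := A.contractionConst_nonneg hc0
  have hlip : 0 ≤ lipConst m c' ρ := by unfold lipConst; positivity
  have hb01 : 0 ≤ A.bound₀ + A.bound₁ := add_nonneg A.bound₀_nonneg A.bound₁_nonneg
  set P := SobAlg.embConst l * ∑ b, ‖A.e b‖ with hP
  have hP0 : 0 ≤ P := mul_nonneg (Real.sqrt_nonneg _) (by positivity)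
  -- The size of the domain in the scaled variables, limited by the radius of convergence of the
  -- nonlinearity and by the contraction condition.
  obtain ⟨c₀, hc₀, hc₁, hc₂⟩ : ∃ c₀ : ℝ, 0 < c₀ ∧
      2 * m * (B * (c₀ * (1 + ‖(1 : SobAlg T l)‖))) ≤ ρ ∧
      4 * Fintype.card (Fin (finrank ℝ E₁)) * C * Q * c₀ ≤ 1 := by
    refine ⟨min (ρ / (2 * m * (B * (1 + ‖(1 : SobAlg T l)‖)) + 1))
      (1 / (4 * Fintype.card (Fin (finrank ℝ E₁)) * C * Q + 1)), by positivity, ?_, ?_⟩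
    · have h := min_le_left (ρ / (2 * m * (B * (1 + ‖(1 : SobAlg T l)‖)) + 1))
        (1 / (4 * Fintype.card (Fin (finrank ℝ E₁)) * C * Q + 1))
      rw [le_div_iff₀ (by positivity)] at h
      refine le_trans ?_ h
      have h0 : 0 ≤ min (ρ / (2 * m * (B * (1 + ‖(1 : SobAlg T l)‖)) + 1))
        (1 / (4 * Fintype.card (Fin (finrank ℝ E₁)) * C * Q + 1)) := by positivity
      linarith
    · have h := min_le_right (ρ / (2 * m * (B * (1 + ‖(1 : SobAlg T l)‖)) + 1))
        (1 / (4 * Fintype.card (Fin (finrank ℝ E₁)) * C * Q + 1))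
      rw [le_div_iff₀ (by positivity)] at h
      have h0 : 0 ≤ min (ρ / (2 * m * (B * (1 + ‖(1 : SobAlg T l)‖)) + 1))
        (1 / (4 * Fintype.card (Fin (finrank ℝ E₁)) * C * Q + 1)) := by positivity
      linarith
  set D := c₀ / (Real.exp 1 * κ) with hD
  have hD0 : 0 < D := by positivity
  have hDκ : κ * D ≤ c₀ := by
    have : κ * D = c₀ / Real.exp 1 := by rw [hD]; field_simp
    rw [this]
    exact div_le_self hc₀.le (Real.one_le_exp zero_le_one)
  have hμ0 : 0 < (l : ℝ) + η + 1 := by positivity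
  -- The exponent is `ω = K = D^b`, because the degree is `p = ⌊(D / δ)^b⌋` and the remainder is at
  -- most a multiple of `e^{-(p + 1)}`; the summands `1` make `M` and `M₀` positive in degenerate
  -- cases.
  refine ⟨m * (B * (Q * c₀ ^ 2)) + 1,
    m * (B * ((A.bound₀ + A.bound₁) * (lipConst m c' ρ * N ^ 2))) + 1, D ^ b, D ^ b,
    by positivity, by positivity, by positivity, by positivity, fun Ω hΩ => ?_⟩
  obtain ⟨ε, hε, hεΩ⟩ := Metric.mem_nhds_iff.1 hΩ
  -- The three conditions on `δ₀`: the region lies in the polydisc of the scaled coordinates, the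
  -- nonlinearity converges there, and `u₀ + v₁ + Φ` stays in `Ω`.
  refine ⟨min D (min (ρ / (4 * m * N + 1)) (ε / (3 + P * κ))), by positivity, ?_⟩
  set δ₀ := min D (min (ρ / (4 * m * N + 1)) (ε / (3 + P * κ))) with hδ₀
  have hδ₀0 : 0 < δ₀ := by positivity
  have hδ₀D : δ₀ ≤ D := min_le_left _ _
  have hδ₀N : δ₀ * (4 * m * N + 1) ≤ ρ :=
    (le_div_iff₀ (by positivity)).1 ((min_le_right _ _).trans (min_le_left _ _))
  have hδ₀ε : δ₀ * (3 + P * κ) ≤ ε :=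
    (le_div_iff₀ (by positivity)).1 ((min_le_right _ _).trans (min_le_right _ _))
  intro V hVa hV0 hV1 δ hδ hδδ₀
  obtain ⟨a, ha, hreal, hV⟩ := exists_wordSeries hΩ hVa hV0 hV1
  obtain ⟨p, hp1, hpK, hpω, hpr⟩ := exists_degree (μ := (l : ℝ) + η + 1) hc₀ hκ0 hμ0 hb hδ
    (hδδ₀.le.trans hδ₀D)
  obtain ⟨Φ, hΦ, hΦm⟩ := exists_isNormalizer A hΛ hC hbound ha hρ hc0 hreal hp1
    (μ := (l : ℝ) + η + 1) (by linarith [(Nat.cast_nonneg l : (0 : ℝ) ≤ l)]) hμ0.le hc₀ hc₁ hc₂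
  set r := c₀ / (p : ℝ) ^ ((l : ℝ) + η + 1) with hr
  have hr0 := hΦ.r_pos
  -- Points of the region in scaled coordinates.
  have hu : ∀ u : E₀, ‖u‖ ≤ δ → r⁻¹ * (κ * ‖u‖) ≤ Real.exp (-1) := fun u hu =>
    le_trans (by gcongr) hpr
  have he : Real.exp (-1) ≤ 1 / 2 := by
    rw [Real.exp_neg, one_div]
    exact inv_anti₀ two_pos (by have := Real.add_one_le_exp 1; linarith)
  have hu2 : ∀ u : E₀, ‖u‖ ≤ δ → r⁻¹ * (κ * ‖u‖) ≤ 1 / 2 := fun u h => (hu u h).trans he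
  have hu1 : ∀ u : E₀, ‖u‖ ≤ δ → r⁻¹ * (κ * ‖u‖) ≤ 1 := fun u h =>
    (hu2 u h).trans (by norm_num)
  set S : Set (E₀ × E₁) := {x : E₀ × E₁ | ‖x.1‖ ≤ δ ∧ ‖x.2‖ ≤ δ₀} with hS
  have hx : ∀ x ∈ S, ∀ i, ‖A.coords r c₀ i x‖ ≤ 1 := by
    rintro x ⟨hx1, hx2⟩ (i | b)
    · exact (hκ.norm_coords_inl_le hr0 i x).trans (hu1 _ hx1)
    · refine (hκ.norm_coords_inr_le hc₀ b x).trans ?_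
      rw [inv_mul_le_iff₀ hc₀, mul_one]
      exact le_trans (by gcongr; exact hx2.trans hδ₀D) hDκ
  have hΦn : ∀ u : E₀, ‖u‖ ≤ δ → ∀ t, ‖A.value r c₀ Φ (u, 0) t‖ ≤ P * κ * δ₀ := fun u h t =>
    (hΦ.norm_value_le hκ (hu1 u h) t).trans (by gcongr; exact h.trans hδδ₀.le)
  have hmem : ∀ (u : E₀) (v w : E₁), ‖u‖ ≤ δ → ‖v‖ ≤ δ₀ → ‖w‖ ≤ P * κ * δ₀ →
      (u : EuclideanSpace ℝ (Fin m)) + (v + w : E₁) ∈ Ω := fun u v w h1 h2 h3 => by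
    refine hεΩ (mem_ball_zero_iff.2 ?_)
    have h4 := norm_add_le (u : EuclideanSpace ℝ (Fin m)) ((v + w : E₁) : EuclideanSpace ℝ (Fin m))
    have h5 : ‖((v + w : E₁) : EuclideanSpace ℝ (Fin m))‖ ≤ ‖v‖ + ‖w‖ := norm_add_le v w
    have h6 : ‖(u : EuclideanSpace ℝ (Fin m))‖ ≤ δ := h1
    linarith
  have hΩ₀ : ∀ x ∈ S, ∀ t, (x.1 : EuclideanSpace ℝ (Fin m)) +
      (A.value r c₀ Φ (x.1, 0) t : E₁) ∈ Ω := fun x hxS t => by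
    have := hmem x.1 0 (A.value r c₀ Φ (x.1, 0) t) hxS.1 (by simpa using hδ₀0.le)
      (hΦn _ hxS.1 t)
    rwa [zero_add] at this
  have hΩ₁ : ∀ x ∈ S, ∀ t, (x.1 : EuclideanSpace ℝ (Fin m)) +
      (x.2 + A.value r c₀ Φ (x.1, 0) t : E₁) ∈ Ω := fun x hxS t =>
    hmem _ _ _ hxS.1 hxS.2 (hΦn _ hxS.1 t)
  have hκ' : 0 < (r⁻¹ + c₀⁻¹) * κ := by positivity
  refine ⟨p, fun u t => A.value r c₀ Φ (u, 0) t, fun x t => E₀.projectionOnto E₁ hE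
      (V ((x.1 : EuclideanSpace ℝ (Fin m)) + (x.2 + A.value r c₀ Φ (x.1, 0) t : E₁)) t),
    fun x t => A.value r c₀ (A.field p r Φ (A.increment a r c₀ Φ)) x t,
    fun u t => A.value r c₀ (A.remainder a p r Φ) (u, 0) t, hpK, ?_, hΦ.value_zero,
    hΦ.hasFDerivAt_value_zero hκ, hΦ.transformsOn hL₀ hV hx hΩ₀ hΩ₁,
    hΦ.isAnalyticSobolev_fst hκ hV hx hΩ₁, ?_, ?_, ?_, ?_, fun _ _ _ => rfl⟩
  · exact isSobolevPolynomial_of_ev A.e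
      (fun i => (A.coords r c₀ i).comp (LinearMap.inl ℝ E₀ E₁)) hΦ.degreeLe hΦm
  · exact A.isAnalyticSobolev_value LinearMap.id hκ'
      (fun i x => hκ.norm_coords_le hr0 hc₀ i x) hΦ.conj_field_increment hx
  · refine A.isAnalyticSobolev_value (LinearMap.inl ℝ E₀ E₁) hκ' (fun i u => ?_)
      hΦ.conj_remainder fun u hu' i => (hκ.norm_coords_zero_le hr0 i u).trans (hu1 u hu')
    refine (hκ.norm_coords_le hr0 hc₀ i _).trans (le_of_eq ?_)
    rw [LinearMap.inl_apply, Prod.norm_mk, norm_zero, max_eq_left (norm_nonneg _)]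
  · intro u v hu' hv'
    have hsmall : 2 * m * (N * (‖u‖ + ‖v‖)) ≤ ρ := by
      have h1 : ‖u‖ + ‖v‖ ≤ 2 * δ₀ := by linarith
      calc 2 * m * (N * (‖u‖ + ‖v‖)) ≤ 2 * m * (N * (2 * δ₀)) := by gcongr
        _ ≤ δ₀ * (4 * m * N + 1) := by linarith
        _ ≤ ρ := hδ₀N
    have h := A.sobolevNorm_value_le (hx (u, v) ⟨hu', hv'⟩) hΦ.conj_field_increment
      (by positivity) (hΦ.norm_ev_field_increment_le hκ (hx (u, v) ⟨hu', hv'⟩) (hu2 u hu') hc0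
        hsmall)
    refine ⟨h.1, h.2.trans ?_⟩
    have h0 : 0 ≤ ‖v‖ * (‖u‖ + ‖v‖) := by positivity
    set G := m * (B * ((A.bound₀ + A.bound₁) * (lipConst m c' ρ * N ^ 2))) with hG
    calc m * (B * ((A.bound₀ + A.bound₁) * (lipConst m c' ρ * N ^ 2 * (‖v‖ * (‖u‖ + ‖v‖)))))
        = G * (‖v‖ * (‖u‖ + ‖v‖)) := by rw [hG]; ring
      _ ≤ (G + 1) * (‖v‖ * (‖u‖ + ‖v‖)) := by gcongr; linarith
      _ = _ := (mul_assoc _ _ _).symm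
  · intro u hu'
    have h := A.sobolevNorm_value_le (δ₁ := c₀)
      (fun i => (hκ.norm_coords_zero_le hr0 i u).trans (hu1 u hu')) hΦ.conj_remainder
      (by positivity) (hΦ.norm_ev_remainder_le hκ hc0 (hu u hu'))
    refine ⟨h.1, h.2.trans ?_⟩
    -- The algebraic prefactor is bounded, since `p r ≤ c₀ p^{1 - μ}` with `μ ≥ 1`.
    have hpr2 : p * r ^ 2 ≤ c₀ ^ 2 := by
      have hp1' : (1 : ℝ) ≤ p := by exact_mod_cast hp1
      have hpp : (p : ℝ) ≤ (p : ℝ) ^ ((l : ℝ) + η + 1) := by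
        conv_lhs => rw [← Real.rpow_one (p : ℝ)]
        exact Real.rpow_le_rpow_of_exponent_le hp1' (by linarith [(Nat.cast_nonneg l : (0 : ℝ) ≤ l)])
      have h1 : p * r ≤ c₀ := by
        rw [hr, mul_div_assoc', div_le_iff₀ (by positivity), mul_comm]
        gcongr
      have h2 : r ≤ c₀ := div_le_self hc₀.le (hp1'.trans hpp)
      calc p * r ^ 2 = (p * r) * r := by ring
        _ ≤ c₀ * c₀ := by gcongr
        _ = _ := by ring
    have hexp : Real.exp (-(p + 1 : ℝ)) ≤ Real.exp (-(D ^ b) / δ ^ b) := by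
      rw [neg_div]
      exact Real.exp_le_exp.2 (neg_le_neg hpω)
    calc m * (B * (Q * (p * r ^ 2) * Real.exp (-(p + 1 : ℝ))))
        ≤ m * (B * (Q * c₀ ^ 2 * Real.exp (-(D ^ b) / δ ^ b))) := by gcongr
      _ = m * (B * (Q * c₀ ^ 2)) * Real.exp (-(D ^ b) / δ ^ b) := by ring
      _ ≤ _ := by gcongr; linarith

end Conclusion
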